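/- **Setting.** Let $\omega(u,v)=u_1v_2-u_2v_1$ on $\mathbb{C}^2$. All maps are considered in a neighbourhood of the origin. A *real-analytic area-preserving map at 1:3 resonance* is an analytic map $g_0$ defined near $0\in\mathbb{C}^2$ with values in $\mathbb{C}^2$, real at real arguments, preserving $\omega$, with $g_0(0)=0$ and such that $g_0'(0)$ has the eigenvalues $\mathrm{e}^{\pm 2\pi \mathrm{i}/3}$. Its Taylor series is conjugate, by a real formal canonical change of coordinates, to $N=R\circ\phi^1_H$, where $R$ is the rotation by $2\pi/3$ or $-2\pi/3$ and $\phi^1_H$ is the formal time-one flow of a real formal Hamiltonian $H$ which is invariant under the rotation by $2\pi/3$ and has no terms of order less than $3$. The map $g_0$ is *non-degenerate* if the terms of order $3$ in $H$ do not vanish. Let $G_0=g_0^3$. A *compatible pair of separatrices* of $G_0$ consists of $\mathbb{C}^2$-valued functions $V^+$ and $V^-$, analytic in sectorial neighbourhoods of infinity $D^+=\{|t|>R,\ |\arg t|<\pi/2+\delta\}$ and $D^-=-D^+$ respectively (for some $R,\delta>0$), real at real $t$, which satisfy $V^\pm(t+1)=G_0(V^\pm(t))$ whenever $t,t+1\in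 D^\pm$ and which share an asymptotic expansion $V^\pm(t)\sim\sum_{n\ge1}a_nt^{-n}$ as $t\to\infty$ in $D^\pm$, with $a_1\neq0$. The *Stokes constant* of the pair is $$\theta=\lim_{s\to+\infty} \mathrm{e}^{2\pi \mathrm{i} t}\,\omega\bigl(V^+(t)-V^-(t),\dot V^-(t)\bigr)\Big|_{t=-\mathrm{i}s}.$$ **Lemma.** Let $g_0$ and $f_0$ be non-degenerate real-analytic area-preserving maps at 1:3 resonance, and let $G_0=g_0^3$, $F_0=f_0^3$. Let $\Phi$ be a (complex) analytic symplectic map defined near the origin of $\mathbb{C}^2$, with $\Phi(0)=0$, such that $G_0=\Phi^{-1}\circ F_0\circ\Phi$ near the origin. Let $\theta_G$ and $\theta_F$ be the Stokes constants of any compatible pair of separatrices $V^\pm$ of $G_0$ and any compatible pair of separatrices $W^\pm$ of $F_0$, respectively. Then $$|\theta_G|=|\theta_F|,$$ and there is a real constant $c$ such that $\theta_G=\mathrm{e}^{-2\pi \mathrm{i} c}\,\theta_F$. If moreover $\Phi$ is real at real arguments, then $c$ can be chosen to be a time shift between the two pairs: for some $k\in\{0,1,2\}$, $$\Phi(V^\pm(t))=f_0^{k}\bigl(W^\pm(t+c)\bigr)$$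 for all $t$ in some sectorial neighbourhoods of infinity $\pm\{|t|>R',\ |\arg t|<\pi/2+\delta'\}$ with $R',\delta'>0$. -/

import Mathlib

namespace Resonance13

open Filter Topology

noncomputable section

/-- The complex plane `ℂ²` in which the maps act; the real points are those with real coordinates. -/
abbrev C2 : Type := Fin 2 → ℂ

/-- The standard symplectic form `ω(u, v) = u₁ v₂ - u₂ v₁` on `ℂ²`. -/
def omega (u v : C2) : ℂ := u 0 * v 1 - u 1 * v 0

/-- `z` is a point of `ℝ² ⊂ ℂ²`. -/
def IsRealPoint (z : C2) : Prop := ∀ i, (z i).im = 0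

/-- The germ of `g` at the origin takes real values at real arguments. -/
def IsRealMap (g : C2 → C2) : Prop :=
  ∀ᶠ z in 𝓝 (0 : C2), IsRealPoint z → IsRealPoint (g z)

/-- `g` is (complex) analytic near the origin, fixes the origin, and preserves `ω` near it. -/
structure IsSymplecticMap (g : C2 → C2) : Prop where
  analytic : AnalyticAt ℂ g 0
  map_zero : g 0 = 0
  preserves : ∀ᶠ z in 𝓝 (0 : C2), ∀ u v : C2,
    omega (fderiv ℂ g z u) (fderiv ℂ g z v) = omega u v

/-- A real-analytic area-preserving map at 1:3 resonance: the origin is a fixed point at which the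
Jacobian has the eigenvalues `exp(± 2πi/3)`. -/
structure IsAreaPreservingMapAtResonance (g : C2 → C2) : Prop extends IsSymplecticMap g where
  real : IsRealMap g
  eigenvalue_pos : Module.End.HasEigenvalue
    (fderiv ℂ g 0 : C2 →ₗ[ℂ] C2) (Complex.exp (2 * Real.pi * Complex.I / 3))
  eigenvalue_neg : Module.End.HasEigenvalue
    (fderiv ℂ g 0 : C2 →ₗ[ℂ] C2) (Complex.exp (-(2 * Real.pi * Complex.I / 3)))

/-! ### Formal normal form -/

/-- Real formal power series in the two variables `x = X 0`, `y = X 1`. -/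
abbrev Series : Type := MvPowerSeries (Fin 2) ℝ

/-- Formal maps of the plane. -/
abbrev FormalMap : Type := Fin 2 → Series

/-- The composition `A ∘ B` of formal maps (meaningful when `B` has no constant term). -/
def FormalMap.comp (A B : FormalMap) : FormalMap := fun i => MvPowerSeries.subst B (A i)

/-- `T` is the Taylor series of `g` at the origin. -/
def IsTaylorSeries (g : C2 → C2) (T : FormalMap) : Prop :=
  ∀ᶠ z in 𝓝 (0 : C2), ∀ i, HasSum
    (fun d : Fin 2 →₀ ℕ => ((MvPowerSeries.coeff d (T i) : ℝ) : ℂ) * (z 0 ^ d 0 * z 1 ^ d 1))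
    (g z i)

/-- A formal canonical change of coordinates: a formal map fixing the origin whose Jacobian
determinant is the constant series `1`. -/
def IsFormalCanonical (P : FormalMap) : Prop :=
  (∀ i, MvPowerSeries.constantCoeff (P i) = 0) ∧
  MvPowerSeries.pderiv ℝ 0 (P 0) * MvPowerSeries.pderiv ℝ 1 (P 1)
    - MvPowerSeries.pderiv ℝ 1 (P 0) * MvPowerSeries.pderiv ℝ 0 (P 1) = 1

/-- The rotation by the angle `α`, as a formal map. -/
def formalRotation (α : ℝ) : FormalMap :=
  ![MvPowerSeries.C (Real.cos α) * MvPowerSeries.X 0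
      - MvPowerSeries.C (Real.sin α) * MvPowerSeries.X 1,
    MvPowerSeries.C (Real.sin α) * MvPowerSeries.X 0
      + MvPowerSeries.C (Real.cos α) * MvPowerSeries.X 1]

/-- The derivative of `u` along the Hamiltonian vector field `(∂H/∂y, -∂H/∂x)`. -/
def hamiltonianDeriv (H u : Series) : Series :=
  MvPowerSeries.pderiv ℝ 0 u * MvPowerSeries.pderiv ℝ 1 H
    - MvPowerSeries.pderiv ℝ 1 u * MvPowerSeries.pderiv ℝ 0 H

/-- The formal time-one flow of the Hamiltonian `H`, given by the Lie series
`∑ₙ (1/n!) (L_H)ⁿ`. For `H` without terms of order below 3 (the only case in which it is used),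
`(L_H)ⁿ` applied to a coordinate starts at order `n + 1` or later, so that only the terms with
`n ≤ |d|` contribute to the coefficient of index `d`. -/
def formalTimeOneFlow (H : Series) : FormalMap := fun i d =>
  ∑ n ∈ Finset.range (d.degree + 1),
    ((Nat.factorial n : ℝ))⁻¹ * MvPowerSeries.coeff d ((hamiltonianDeriv H)^[n] (MvPowerSeries.X i))

/-- `H` is a normal form (Takens) Hamiltonian of `g`: the Taylor series `T` of `g` is conjugate by
a formal canonical change `P` to `N = R ∘ φ¹_H`, where `R` is the rotation by `2π/3` or by `-2π/3`
(whichever the linear part of `g` is conjugate to by an orientation-preserving real map), and `H`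
is `ℤ₃`-symmetric and has no terms of order below 3. In particular `N` commutes with `R`. -/
def IsNormalFormHamiltonian (g : C2 → C2) (H : Series) : Prop :=
  (∀ d : Fin 2 →₀ ℕ, d.degree < 3 → MvPowerSeries.coeff d H = 0) ∧
  MvPowerSeries.subst (formalRotation (2 * Real.pi / 3)) H = H ∧
  ∃ (T P : FormalMap) (α : ℝ), (α = 2 * Real.pi / 3 ∨ α = -(2 * Real.pi / 3)) ∧
    IsTaylorSeries g T ∧ IsFormalCanonical P ∧
    P.comp T = ((formalRotation α).comp (formalTimeOneFlow H)).comp P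

/-- `g` is non-degenerate: the terms of order 3 of its normal form Hamiltonian do not vanish. -/
def IsNondegenerate (g : C2 → C2) : Prop :=
  ∃ H : Series, IsNormalFormHamiltonian g H ∧
    ∃ d : Fin 2 →₀ ℕ, d.degree = 3 ∧ MvPowerSeries.coeff d H ≠ 0

/-! ### Separatrices and the Stokes constant -/

/-- The sectorial neighbourhood of infinity `{|t| > R, |arg t| < π/2 + δ}`, of opening `π + 2δ`
and symmetric around the real axis. -/
def sectorPlus (R δ : ℝ) : Set ℂ := {t | R < ‖t‖ ∧ |t.arg| < Real.pi / 2 + δ}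

/-- The opposite sectorial neighbourhood `-sectorPlus R δ`. -/
def sectorMinus (R δ : ℝ) : Set ℂ := {t | -t ∈ sectorPlus R δ}

/-- `V t ~ ∑_{n ≥ 1} aₙ t⁻ⁿ` as `t → ∞` in `D`. -/
def HasAsymptoticExpansion (V : ℂ → C2) (a : ℕ → C2) (D : Set ℂ) : Prop :=
  ∀ N : ℕ, Asymptotics.IsBigO (Bornology.cobounded ℂ ⊓ 𝓟 D)
    (fun t => V t - ∑ n ∈ Finset.Icc 1 N, (t⁻¹) ^ n • a n)
    (fun t => ‖t‖⁻¹ ^ (N + 1))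

/-- `V` is a real-analytic solution of `V(t + 1) = G(V(t))` in `D` with asymptotic expansion
`∑_{n ≥ 1} aₙ t⁻ⁿ`. -/
structure IsSeparatrix (G : C2 → C2) (a : ℕ → C2) (D : Set ℂ) (V : ℂ → C2) : Prop where
  analytic : AnalyticOnNhd ℂ V D
  real : ∀ t ∈ D, t.im = 0 → IsRealPoint (V t)
  equation : ∀ t ∈ D, t + 1 ∈ D → V (t + 1) = G (V t)
  expansion : HasAsymptoticExpansion V a D

/-- `Vp`, `Vm` is a compatible pair of separatrices (stable and unstable) of the degenerate saddle
of `G` at the origin: they share an asymptotic expansion, whose leading term does not vanish, in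
sectorial neighbourhoods of infinity `D⁺` and `D⁻ = -D⁺` of opening larger than `π`. -/
def IsCompatiblePair (G : C2 → C2) (Vp Vm : ℂ → C2) : Prop :=
  ∃ (R δ : ℝ) (a : ℕ → C2), 0 < R ∧ 0 < δ ∧ a 1 ≠ 0 ∧
    IsSeparatrix G a (sectorPlus R δ) Vp ∧ IsSeparatrix G a (sectorMinus R δ) Vm

/-- `θ` is the Stokes constant of the pair `Vp`, `Vm`:
`θ = lim exp(2πit) ω(V⁺(t) - V⁻(t), (d/dt) V⁻(t))` as `t = -is`, `s → +∞`. -/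
def IsStokesConstant (Vp Vm : ℂ → C2) (θ : ℂ) : Prop :=
  Tendsto
    (fun s : ℝ =>
      Complex.exp (2 * Real.pi * Complex.I * (-Complex.I * s)) *
        omega (Vp (-Complex.I * s) - Vm (-Complex.I * s)) (deriv Vm (-Complex.I * s)))
    atTop (𝓝 θ)

end

end Resonance13

namespace Resonance13

open Filter Topology

noncomputable section

/-! ### Exponential decay of almost periodic functions -/

/-! The proof rests on the rigidity of solutions of X(t+1) = F(X(t)) with X ~ b/t, where F = f^[3].
The map F is tangent to the identity, and its quadratic part q commutes with L = f'(0), which has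
order three. Comparing coefficients of t⁻² gives q(b) = -b, and in a suitable eigenbasis of L the
form q is (ξ, η) ↦ -(η², ξ²); so b is one of three vectors, which L permutes
(`exists_normal_coordinates`, `quadraticPart_leading`). The derivative of Φ at 0 is injective, so
Φ∘V± is a solution with nonzero leading term, and this term is shared by f^k∘W± for some k.

The difference Δ of two solutions with the same leading term satisfies Δ(t+1) ≈ Δ(t) - (2/t) swap
Δ(t). Its antisymmetric part is multiplied by about 1 + 2/t, so it cannot tend to zero like t⁻²
(`second_coefficient_symmetric`). The second coefficients therefore differ by a multiple of b, and a
shift of time removes this multiple. What is left is O(t⁻³), which is faster than the equation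
allows a nonzero difference to decay (`eventually_eq_of_hasTwoTerms`). Hence Φ(V±(t)) =
f^k(W±(t+c)), with one complex c for both signs because the members of a pair share their expansion
(`exists_shift`).

For the Stokes constants, V⁺ - V⁻ is flat and nearly 1-periodic, hence O(exp(-3πs/2)) along vertical
lines (`exists_exponential_decay`). A symplectic change of variables alters ω(V⁺ - V⁻, dV⁻/dt) only
by a term quadratic in V⁺ - V⁻, of size exp(-3πs), which the weight exp(2πs) does not see
(`tendsto_stokesForm_comp_sub`). A Phragmén–Lindelöf argument shows that the weighted limit does not
depend on the vertical line (`limit_eq_of_halfStrip`), and θ_F = exp(2πic) θ_G follows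
(`stokesConstant_phase`).

For complex Φ the shift c may be complex. But the separatrices and f are real, so by Schwarz
reflection the complex conjugate of Φ relates the same pairs with shift c̄
(`eventually_conjMap_eq`). Thus θ_F = exp(2πic̄) θ_G as well, and either θ_G = θ_F = 0 or c is real.
If Φ is real, all the coefficients are real, and so is c. -/

open MeasureTheory Set in
/-- Cauchy's theorem for `u - u 0` against a meromorphic periodic kernel with a pole at `0`. -/
theorem integral_boundary_periodic_kernel {E : Type*} [NormedAddCommGroup E] [NormedSpace ℂ E]
    [CompleteSpace E] (u : ℂ → E) (a b : ℝ) (ha : 0 < a) (hb : 0 < b)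
    (hu : ∀ z : ℂ, |z.re| ≤ 1 / 2 → -b ≤ z.im → z.im ≤ a → DifferentiableAt ℂ u z) :
    (∫ x : ℝ in (-(1/2) : ℝ)..(1/2), (Complex.exp (2 * Real.pi * Complex.I * (x + (-b : ℝ) * Complex.I)) /
        (Complex.exp (2 * Real.pi * Complex.I * (x + (-b : ℝ) * Complex.I)) - 1)) •
          (u (x + (-b : ℝ) * Complex.I) - u 0))
      - (∫ x : ℝ in (-(1/2) : ℝ)..(1/2), (Complex.exp (2 * Real.pi * Complex.I * (x + a * Complex.I)) /
        (Complex.exp (2 * Real.pi * Complex.I * (x + a * Complex.I)) - 1)) •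
          (u (x + a * Complex.I) - u 0))
      + Complex.I • (∫ y : ℝ in (-b)..a, ((1 + Real.exp (2 * Real.pi * y) : ℝ) : ℂ)⁻¹ •
          (u ((1/2 : ℝ) + y * Complex.I) - u ((-(1/2) : ℝ) + y * Complex.I))) = 0 := by
  set e : ℂ → ℂ := fun z => Complex.exp (2 * Real.pi * Complex.I * z) with he
  -- Away from 0 this is e/(e - 1) · (u - u 0), with e = exp(2πiz). Subtracting u 0 makes the pole
  -- at 0 removable, and writing both factors as slopes supplies the continuous extension, so the
  -- rectangle theorem applies with exceptional set {0}.
  set F : ℂ → E := fun z => (e z / dslope e 0 z) • dslope u 0 z with hF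
  have hed : Differentiable ℂ e := by intro z; simp only [he]; fun_prop
  have he0 : e 0 = 1 := by simp [he]
  have hpi := Real.pi_pos
  have hpiC : (Real.pi : ℂ) ≠ 0 := by exact_mod_cast hpi.ne'
  have hne : ∀ z : ℂ, |z.re| ≤ 1 / 2 → z ≠ 0 → e z - 1 ≠ 0 := by
    intro z hz hz0 h
    have h1 : Complex.exp (2 * Real.pi * Complex.I * z) = 1 := sub_eq_zero.1 h
    obtain ⟨n, hn⟩ := Complex.exp_eq_one_iff.1 h1
    have h2 : z = n := by
      have : (2 * Real.pi * Complex.I) * z = (2 * Real.pi * Complex.I) * n := by rw [hn]; ring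
      exact mul_left_cancel₀ (by simp [hpiC]) this
    have h3 : n ≠ 0 := by rintro rfl; simp at h2; exact hz0 h2
    rw [h2] at hz
    simp only [Complex.intCast_re] at hz
    have h4 : (1 : ℝ) ≤ |(n : ℝ)| := by exact_mod_cast Int.one_le_abs h3
    linarith
  have hds : ∀ z : ℂ, |z.re| ≤ 1 / 2 → dslope e 0 z ≠ 0 := by
    intro z hz
    by_cases h0 : z = 0
    · subst h0
      rw [dslope_same]
      have : HasDerivAt e (Complex.exp (2 * Real.pi * Complex.I * 0) * (2 * Real.pi * Complex.I * 1)) 0 := by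
        simp only [he]
        exact ((hasDerivAt_id (0 : ℂ)).const_mul (2 * Real.pi * Complex.I : ℂ)).cexp
      rw [this.deriv]
      simp [hpiC]
    · rw [dslope_of_ne _ h0, slope_def_field, he0]
      exact div_ne_zero (hne z hz h0) (by simpa using h0)
  have hFv : ∀ z : ℂ, z ≠ 0 → F z = (e z / (e z - 1)) • (u z - u 0) := by
    intro z hz
    simp only [hF]
    rw [dslope_of_ne _ hz, dslope_of_ne _ hz, slope_def_field, slope_def_module, he0, smul_smul]
    congr 1
    simp only [sub_zero]
    field_simp
  have main := Complex.integral_boundary_rect_eq_zero_of_differentiable_on_off_countable F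
    (⟨-(1/2), -b⟩ : ℂ) (⟨1/2, a⟩ : ℂ) {0} (countable_singleton _) ?_ ?_
  · rw [← main]
    have hcong1 : ∀ c : ℝ, c ≠ 0 → (∫ x : ℝ in (-(1/2) : ℝ)..(1/2),
        (Complex.exp (2 * Real.pi * Complex.I * (x + c * Complex.I)) /
        (Complex.exp (2 * Real.pi * Complex.I * (x + c * Complex.I)) - 1)) •
          (u (x + c * Complex.I) - u 0)) = ∫ x : ℝ in (-(1/2) : ℝ)..(1/2), F (x + c * Complex.I) := by
      intro c hc
      refine intervalIntegral.integral_congr fun x _ => ?_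
      rw [hFv]
      intro h
      have := congrArg Complex.im h
      simp at this
      exact hc this
    rw [hcong1 (-b) (by linarith), hcong1 a ha.ne', add_sub_assoc, ← smul_sub]
    congr 2
    have hci : ∀ x : ℝ, |x| = 1/2 → IntervalIntegrable (fun y : ℝ => F (x + y * Complex.I)) volume (-b) a := by
      intro x hx
      have hx0 : x ≠ 0 := by rintro rfl; norm_num at hx
      refine ContinuousOn.intervalIntegrable fun y hy => ?_
      rw [uIcc_of_le (by linarith)] at hy
      have hz0 : (x + y * Complex.I : ℂ) ≠ 0 := by
        intro h
        have := congrArg Complex.re h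
        simp at this; exact hx0 this
      have hD : DifferentiableAt ℂ F (x + y * Complex.I) := by
        refine DifferentiableAt.smul (DifferentiableAt.div hed.differentiableAt
          ((differentiableAt_dslope_of_ne hz0).2 hed.differentiableAt) (hds _ (by simp [hx])))
          ((differentiableAt_dslope_of_ne hz0).2 (hu _ ?_ ?_ ?_))
        · simp [hx]
        · simpa using hy.1
        · simpa using hy.2
      have h2 : Continuous fun y : ℝ => (x + y * Complex.I : ℂ) := by fun_prop
      exact (ContinuousAt.comp (f := fun y : ℝ => (x + y * Complex.I : ℂ)) hD.continuousAt h2.continuousAt).continuousWithinAt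
    rw [← intervalIntegral.integral_sub (hci (1/2) (by norm_num)) (hci (-(1/2)) (by norm_num))]
    refine intervalIntegral.integral_congr fun y _ => ?_
    -- On both sides re z = ±1/2 one has e = -exp(-2πy), so the kernel takes the same positive value
    -- and the two vertical integrals merge into one integral of increments over a period.
    have hval : ∀ x : ℝ, |x| = 1/2 → e (x + y * Complex.I) / (e (x + y * Complex.I) - 1) =
        ((1 + Real.exp (2 * Real.pi * y) : ℝ) : ℂ)⁻¹ := by
      intro x hx
      have h1 : e (x + y * Complex.I) = -((Real.exp (2 * Real.pi * y) : ℝ) : ℂ)⁻¹ := by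
        have h3 : Complex.exp (2 * Real.pi * Complex.I * x) = -1 := by
          rcases (abs_eq (by norm_num : (0:ℝ) ≤ 1/2)).1 hx with h | h
          · rw [h]; push_cast
            rw [show (2 * Real.pi * Complex.I * (1/2) : ℂ) = Real.pi * Complex.I by ring, Complex.exp_pi_mul_I]
          · rw [h]; push_cast
            rw [show (2 * Real.pi * Complex.I * -(1/2) : ℂ) = -(Real.pi * Complex.I) by ring, Complex.exp_neg,
              Complex.exp_pi_mul_I]; norm_num
        simp only [he]
        rw [show (2 * Real.pi * Complex.I * (x + y * Complex.I) : ℂ) = 2 * Real.pi * Complex.I * x +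
          -((2 * Real.pi * y : ℝ) : ℂ) by push_cast; linear_combination (2 * Real.pi * y : ℂ) * Complex.I_mul_I,
          Complex.exp_add, h3, Complex.exp_neg, Complex.ofReal_exp]
        ring
      rw [h1]
      have h4 : ((Real.exp (2 * Real.pi * y) : ℝ) : ℂ) ≠ 0 := by exact_mod_cast (Real.exp_pos _).ne'
      have h5 : 1 + ((Real.exp (2 * Real.pi * y) : ℝ) : ℂ) ≠ 0 := by
        have : (1 + Real.exp (2 * Real.pi * y)) ≠ 0 := by positivity
        exact_mod_cast this
      rw [Complex.ofReal_add, Complex.ofReal_one]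
      generalize ((Real.exp (2 * Real.pi * y) : ℝ) : ℂ) = r at h4 h5
      have h6 : -r⁻¹ - 1 ≠ 0 := by
        intro h
        apply h5
        field_simp at h
        linear_combination -h
      rw [div_eq_iff h6]
      field_simp
      ring
    have hz : ∀ x : ℝ, |x| = 1/2 → (x + y * Complex.I : ℂ) ≠ 0 := by
      intro x hx h
      have := congrArg Complex.re h
      simp at this; rw [this] at hx; norm_num at hx
    rw [hFv _ (hz _ (by norm_num)), hFv _ (hz _ (by norm_num)), hval _ (by norm_num), hval _ (by norm_num),
      ← smul_sub]
    congr 1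
    abel
  · intro z hz
    simp only [Complex.mem_reProdIm] at hz
    rw [uIcc_of_le (by norm_num), uIcc_of_le (by linarith)] at hz
    have hz' : |z.re| ≤ 1/2 := abs_le.2 hz.1
    have hc1 : ContinuousAt (dslope e 0) z := by
      by_cases h0 : z = 0
      · subst h0; exact continuousAt_dslope_same.2 hed.differentiableAt
      · exact (continuousAt_dslope_of_ne h0).2 hed.continuous.continuousAt
    have hc2 : ContinuousAt (dslope u 0) z := by
      by_cases h0 : z = 0
      · subst h0; exact continuousAt_dslope_same.2 (hu _ (by norm_num) (by simp; linarith) (by simp; linarith))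
      · exact (continuousAt_dslope_of_ne h0).2 (hu _ hz' hz.2.1 hz.2.2).continuousAt
    exact ((hed.continuous.continuousAt.div hc1 (hds z hz')).smul hc2).continuousWithinAt
  · rintro z ⟨hz, hz0⟩
    simp only [Complex.mem_reProdIm] at hz
    rw [min_eq_left (by norm_num), max_eq_right (by norm_num), min_eq_left (by linarith),
      max_eq_right (by linarith)] at hz
    have hz0 : z ≠ 0 := hz0
    have hz' : |z.re| ≤ 1/2 := abs_le.2 ⟨hz.1.1.le, hz.1.2.le⟩
    exact DifferentiableAt.smul (DifferentiableAt.div hed.differentiableAt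
          ((differentiableAt_dslope_of_ne hz0).2 hed.differentiableAt) (hds _ hz'))
          ((differentiableAt_dslope_of_ne hz0).2 (hu _ hz' hz.2.1.le hz.2.2.le))

/-- A bound for a function at the centre of a rectangle of width one, in terms of its values at the
top and at the bottom, and of its increments over one period. -/
theorem norm_le_of_periodic_kernel {E : Type*} [NormedAddCommGroup E] [NormedSpace ℂ E]
    [CompleteSpace E] (u : ℂ → E) (a b : ℝ) (ha : 1 ≤ a) (hb : 1 ≤ b)
    (hu : ∀ z : ℂ, |z.re| ≤ 1 / 2 → -b ≤ z.im → z.im ≤ a → DifferentiableAt ℂ u z)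
    (A B : ℝ) (hA : ∀ z : ℂ, |z.re| ≤ 1 / 2 → z.im = a → ‖u z‖ ≤ A)
    (hB : ∀ z : ℂ, |z.re| ≤ 1 / 2 → z.im = -b → ‖u z‖ ≤ B)
    (D : ℝ → ℝ) (hDc : ContinuousOn D (Set.Icc (-b) a))
    (hD : ∀ y ∈ Set.Icc (-b) a,
      ‖u ((1/2 : ℝ) + y * Complex.I) - u ((-(1/2) : ℝ) + y * Complex.I)‖ ≤ D y) :
    ‖u 0‖ ≤ 4 * B + 4 * A * Real.exp (-(2 * Real.pi * a)) +
      2 * ∫ y in (-b)..a, (1 + Real.exp (2 * Real.pi * y))⁻¹ * D y := by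
  have main := integral_boundary_periodic_kernel u a b (by linarith) (by linarith) hu
  have hpi := Real.pi_gt_three
  have hexp : ∀ r : ℝ, 1 ≤ r → 8 ≤ Real.exp (2 * Real.pi * r) := by
    intro r hr
    have h1 : Real.exp (2 * 3 * 1) ≤ Real.exp (2 * Real.pi * r) := Real.exp_le_exp.2 (by nlinarith)
    have h2 : Real.exp (2 * 3 * 1) = Real.exp 3 * Real.exp 3 := by rw [← Real.exp_add]; norm_num
    have h3 := Real.add_one_le_exp 3
    nlinarith
  have hnorm : ∀ x c : ℝ, ‖Complex.exp (2 * Real.pi * Complex.I * (x + c * Complex.I))‖ =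
      Real.exp (-(2 * Real.pi * c)) := by
    intro x c
    rw [Complex.norm_exp]
    congr 1
    simp
  have hxa : ∀ x : ℝ, x ∈ Set.uIoc (-(1/2) : ℝ) (1/2) → |x| ≤ 1/2 := by
    intro x hx
    rw [Set.uIoc_of_le (by norm_num)] at hx
    exact abs_le.2 ⟨hx.1.le, hx.2⟩
  set T := ∫ x : ℝ in (-(1/2) : ℝ)..(1/2), (Complex.exp (2 * Real.pi * Complex.I * (x + a * Complex.I)) /
        (Complex.exp (2 * Real.pi * Complex.I * (x + a * Complex.I)) - 1)) •
          (u (x + a * Complex.I) - u 0) with hT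
  set J := (∫ y : ℝ in (-b)..a, ((1 + Real.exp (2 * Real.pi * y) : ℝ) : ℂ)⁻¹ •
          (u ((1/2 : ℝ) + y * Complex.I) - u ((-(1/2) : ℝ) + y * Complex.I))) with hJ
  have hTb : ‖T‖ ≤ 2 * Real.exp (-(2 * Real.pi * a)) * (A + ‖u 0‖) := by
    have := intervalIntegral.norm_integral_le_of_norm_le_const (a := (-(1/2) : ℝ)) (b := 1/2)
      (C := 2 * Real.exp (-(2 * Real.pi * a)) * (A + ‖u 0‖)) (f := fun x : ℝ =>
      (Complex.exp (2 * Real.pi * Complex.I * (x + a * Complex.I)) /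
        (Complex.exp (2 * Real.pi * Complex.I * (x + a * Complex.I)) - 1)) •
          (u (x + a * Complex.I) - u 0)) ?_
    · norm_num at this ⊢
      exact this
    · intro x hx
      rw [norm_smul, norm_div, hnorm]
      have h1 : ‖u (x + a * Complex.I) - u 0‖ ≤ A + ‖u 0‖ :=
        (norm_sub_le _ _).trans (by
          gcongr
          exact hA _ (by simpa using hxa x hx) (by simp))
      have h2 : 1/2 ≤ ‖Complex.exp (2 * Real.pi * Complex.I * (x + a * Complex.I)) - 1‖ := by
        have h3 := norm_sub_norm_le 1 (Complex.exp (2 * Real.pi * Complex.I * (x + a * Complex.I)))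
        rw [norm_sub_rev, hnorm, norm_one] at h3
        have h4 : Real.exp (-(2 * Real.pi * a)) ≤ 1/8 := by
          rw [Real.exp_neg, one_div]
          exact inv_anti₀ (by norm_num) (hexp a ha)
        linarith
      calc _ ≤ Real.exp (-(2 * Real.pi * a)) / (1/2) * (A + ‖u 0‖) := by gcongr
        _ = _ := by ring
  have hcontF : IntervalIntegrable (fun x : ℝ => (Complex.exp (2 * Real.pi * Complex.I * (x + (-b : ℝ) * Complex.I)) /
        (Complex.exp (2 * Real.pi * Complex.I * (x + (-b : ℝ) * Complex.I)) - 1)) •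
          (u (x + (-b : ℝ) * Complex.I) - u 0)) MeasureTheory.volume (-(1/2)) (1/2) := by
    refine ContinuousOn.intervalIntegrable fun x hx => ?_
    rw [Set.uIcc_of_le (by norm_num)] at hx
    have h2 : Continuous fun x : ℝ => (x + (-b : ℝ) * Complex.I : ℂ) := by fun_prop
    have h3 : ContinuousAt (fun x : ℝ => u (x + (-b : ℝ) * Complex.I)) x :=
      ContinuousAt.comp (f := fun x : ℝ => (x + (-b : ℝ) * Complex.I : ℂ))
        (hu _ (by simpa using abs_le.2 hx) (by simp) (by simp; linarith)).continuousAt h2.continuousAt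
    refine (ContinuousAt.smul (ContinuousAt.div (by fun_prop) (by fun_prop) ?_)
      (h3.sub continuousAt_const)).continuousWithinAt
    intro h
    have h4 := congrArg norm (sub_eq_zero.1 h)
    rw [hnorm, norm_one] at h4
    have h5 := hexp b hb
    rw [show -(2 * Real.pi * -b) = 2 * Real.pi * b by ring] at h4
    linarith
  have hBb : ‖(∫ x : ℝ in (-(1/2) : ℝ)..(1/2), (Complex.exp (2 * Real.pi * Complex.I * (x + (-b : ℝ) * Complex.I)) /
        (Complex.exp (2 * Real.pi * Complex.I * (x + (-b : ℝ) * Complex.I)) - 1)) •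
          (u (x + (-b : ℝ) * Complex.I) - u 0)) + u 0‖ ≤ 2 * B + 1/4 * ‖u 0‖ := by
    have h0 : u 0 = ∫ x : ℝ in (-(1/2) : ℝ)..(1/2), u 0 := by
      rw [intervalIntegral.integral_const]; norm_num
    rw [show ∀ v : E, v + u 0 = v + ∫ x : ℝ in (-(1/2) : ℝ)..(1/2), u 0 from fun v => by rw [← h0],
      ← intervalIntegral.integral_add hcontF (by simp)]
    have := intervalIntegral.norm_integral_le_of_norm_le_const (a := (-(1/2) : ℝ)) (b := 1/2)
      (C := 2 * B + 1/4 * ‖u 0‖) (f := fun x : ℝ =>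
      (Complex.exp (2 * Real.pi * Complex.I * (x + (-b : ℝ) * Complex.I)) /
        (Complex.exp (2 * Real.pi * Complex.I * (x + (-b : ℝ) * Complex.I)) - 1)) •
          (u (x + (-b : ℝ) * Complex.I) - u 0) + u 0) ?_
    · norm_num at this ⊢
      exact this
    · intro x hx
      set w := Complex.exp (2 * Real.pi * Complex.I * (x + (-b : ℝ) * Complex.I)) with hw
      have hwn : 8 ≤ ‖w‖ := by
        rw [hnorm, show -(2 * Real.pi * -b) = 2 * Real.pi * b by ring]; exact hexp b hb
      have h7 : ‖w‖ - 1 ≤ ‖w - 1‖ := by simpa using norm_sub_norm_le w 1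
      have hw1 : w - 1 ≠ 0 := by
        intro h; rw [h] at h7; simp at h7; linarith
      have hub := hB (x + (-b : ℝ) * Complex.I) (by simpa using hxa x hx) (by simp)
      -- On the bottom edge the kernel is close to 1. Adding u 0, which is its own mean over the
      -- edge of length one, cancels the part that does not decay and leaves u 0 with the small
      -- coefficient 1/(w - 1).
      have h8 : (w / (w - 1)) • (u (x + (-b : ℝ) * Complex.I) - u 0) + u 0 =
        (w / (w - 1)) • u (x + (-b : ℝ) * Complex.I) - (w - 1)⁻¹ • u 0 := by
        have : w / (w - 1) = 1 + (w - 1)⁻¹ := by field_simp; ring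
        rw [this, add_smul, add_smul, one_smul, one_smul, smul_sub]; abel
      rw [h8]
      refine (norm_sub_le _ _).trans ?_
      rw [norm_smul, norm_smul, norm_div, norm_inv]
      gcongr
      · rw [div_le_iff₀ (by linarith)]; linarith
      · rw [one_div]; exact inv_anti₀ (by norm_num) (by linarith)
  have hJb : ‖J‖ ≤ ∫ y in (-b)..a, (1 + Real.exp (2 * Real.pi * y))⁻¹ * D y := by
    refine intervalIntegral.norm_integral_le_of_norm_le (by linarith) (Filter.Eventually.of_forall fun y hy => ?_) ?_
    · rw [norm_smul, norm_inv, Complex.norm_real, Real.norm_of_nonneg (by positivity)]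
      gcongr
      exact hD y ⟨hy.1.le, hy.2⟩
    · refine ContinuousOn.intervalIntegrable ?_
      rw [Set.uIcc_of_le (by linarith)]
      refine ContinuousOn.mul (Continuous.continuousOn ?_) hDc
      refine Continuous.inv₀ (by fun_prop) fun y => by positivity
  generalize (∫ x : ℝ in (-(1/2) : ℝ)..(1/2), (Complex.exp (2 * Real.pi * Complex.I * (x + (-b : ℝ) * Complex.I)) /
        (Complex.exp (2 * Real.pi * Complex.I * (x + (-b : ℝ) * Complex.I)) - 1)) •
          (u (x + (-b : ℝ) * Complex.I) - u 0)) = X at main hBb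
  have key : u 0 = X + u 0 - T + Complex.I • J := by
    rw [show X + u 0 - T + Complex.I • J = (X - T + Complex.I • J) + u 0 by abel, main, zero_add]
  have hfin : ‖u 0‖ ≤ 2 * B + 1/4 * ‖u 0‖ + 2 * Real.exp (-(2 * Real.pi * a)) * (A + ‖u 0‖) + ‖J‖ := by
    calc ‖u 0‖ = ‖X + u 0 - T + Complex.I • J‖ := by rw [← key]
      _ ≤ ‖X + u 0‖ + ‖T‖ + ‖Complex.I • J‖ :=
          (norm_add_le _ _).trans (add_le_add (norm_sub_le _ _) le_rfl)
      _ ≤ _ := by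
          rw [norm_smul, Complex.norm_I, one_mul]
          gcongr
  have h4 : Real.exp (-(2 * Real.pi * a)) ≤ 1/8 := by
    rw [Real.exp_neg, one_div]
    exact inv_anti₀ (by norm_num) (hexp a ha)
  -- The multiples of ‖u 0‖ on the right add up to at most 1/4 + 2/8 = 1/2. Absorbing them doubles
  -- the other constants.
  nlinarith [norm_nonneg (u 0)]

/-- The kernel is at most 1 for y < 0 and at most exp(-2πy) for y > 0. With these majorants the two
hypotheses on φ turn each half of the integral into that of an exact derivative, of ψ(s - y) and of
-exp(-2πy) ψ(s - y) respectively, and each half contributes at most ψ(s)/16. So ψ is a supersolution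
of the integral inequality coming from the periodic kernel. -/
theorem integral_kernel_supersolution_le (ψ ψ' φ : ℝ → ℝ) (s a b : ℝ) (ha : 0 ≤ a) (hb : 0 ≤ b)
    (hψ : ∀ σ ∈ Set.Icc (s - a) (s + b), HasDerivAt ψ (ψ' σ) σ)
    (hψ0 : ∀ σ ∈ Set.Icc (s - a) (s + b), 0 ≤ ψ σ)
    (hψc : ContinuousOn ψ' (Set.Icc (s - a) (s + b)))
    (hφc : ContinuousOn φ (Set.Icc (s - a) (s + b)))
    (hφ0 : ∀ σ ∈ Set.Icc (s - a) (s + b), 0 ≤ φ σ)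
    (h1 : ∀ σ ∈ Set.Icc (s - a) (s + b), φ σ ≤ -ψ' σ / 16)
    (h2 : ∀ σ ∈ Set.Icc (s - a) (s + b), φ σ ≤ (ψ' σ + 2 * Real.pi * ψ σ) / 16) :
    ∫ y in (-b)..a, (1 + Real.exp (2 * Real.pi * y))⁻¹ * φ (s - y) ≤ ψ s / 8 := by
  have hmaps : Set.MapsTo (fun y : ℝ => s - y) (Set.Icc (-b) a) (Set.Icc (s - a) (s + b)) := by
    intro y hy
    exact ⟨by linarith [hy.2], by linarith [hy.1]⟩
  have hsub1 : Set.Icc (-b) 0 ⊆ Set.Icc (-b) a := Set.Icc_subset_Icc le_rfl ha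
  have hsub2 : Set.Icc 0 a ⊆ Set.Icc (-b) a := Set.Icc_subset_Icc (by linarith) le_rfl
  have hcs : ContinuousOn (fun y : ℝ => s - y) (Set.Icc (-b) a) := by fun_prop
  have hcont : ContinuousOn (fun y : ℝ => (1 + Real.exp (2 * Real.pi * y))⁻¹ * φ (s - y)) (Set.Icc (-b) a) :=
    ContinuousOn.mul (Continuous.continuousOn (Continuous.inv₀ (by fun_prop) fun y => by positivity))
      (hφc.comp hcs hmaps)
  have hψcont : ContinuousOn ψ (Set.Icc (s - a) (s + b)) := fun σ hσ => (hψ σ hσ).continuousAt.continuousWithinAt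
  have hc1 : ContinuousOn (fun y => -ψ' (s - y) / 16) (Set.Icc (-b) a) :=
    ((hψc.comp hcs hmaps).neg).div_const _
  have hc2 : ContinuousOn (fun y => (Real.exp (-(2 * Real.pi * y)) * (ψ' (s - y) + 2 * Real.pi * ψ (s - y))) / 16) (Set.Icc (-b) a) :=
    (ContinuousOn.mul (by fun_prop) ((hψc.comp hcs hmaps).add
      ((hψcont.comp hcs hmaps).const_mul (2 * Real.pi)))).div_const _
  have hI1 : ∫ y in (-b)..0, (1 + Real.exp (2 * Real.pi * y))⁻¹ * φ (s - y) ≤ ψ s / 16 := by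
    calc _ ≤ ∫ y in (-b)..0, -ψ' (s - y) / 16 := by
          refine intervalIntegral.integral_mono_on (by linarith) ?_ ?_ fun y hy => ?_
          · exact ContinuousOn.intervalIntegrable (by rw [Set.uIcc_of_le (by linarith)]; exact hcont.mono hsub1)
          · exact ContinuousOn.intervalIntegrable (by rw [Set.uIcc_of_le (by linarith)]; exact hc1.mono hsub1)
          · have hm := hmaps (hsub1 hy)
            refine le_trans ?_ (h1 _ hm)
            refine mul_le_of_le_one_left (hφ0 _ hm) ?_
            exact inv_le_one_of_one_le₀ (by linarith [Real.exp_pos (2 * Real.pi * y)])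
      _ = ψ (s - 0) / 16 - ψ (s - -b) / 16 := by
          refine intervalIntegral.integral_eq_sub_of_hasDerivAt (f := fun y => ψ (s - y) / 16) (fun y hy => ?_) ?_
          · rw [Set.uIcc_of_le (by linarith)] at hy
            have := (hψ _ (hmaps (hsub1 hy))).comp y ((hasDerivAt_id y).const_sub s)
            simpa using this.div_const 16
          · exact ContinuousOn.intervalIntegrable (by rw [Set.uIcc_of_le (by linarith)]; exact hc1.mono hsub1)
      _ ≤ _ := by
          have := hψ0 (s - -b) ⟨by linarith, by linarith⟩
          rw [sub_zero]; linarith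
  have hI2 : ∫ y in (0:ℝ)..a, (1 + Real.exp (2 * Real.pi * y))⁻¹ * φ (s - y) ≤ ψ s / 16 := by
    calc _ ≤ ∫ y in (0:ℝ)..a, (Real.exp (-(2 * Real.pi * y)) * (ψ' (s - y) + 2 * Real.pi * ψ (s - y))) / 16 := by
          refine intervalIntegral.integral_mono_on ha ?_ ?_ fun y hy => ?_
          · exact ContinuousOn.intervalIntegrable (by rw [Set.uIcc_of_le ha]; exact hcont.mono hsub2)
          · exact ContinuousOn.intervalIntegrable (by rw [Set.uIcc_of_le ha]; exact hc2.mono hsub2)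
          · have hm := hmaps (hsub2 hy)
            rw [mul_div_assoc]
            refine mul_le_mul ?_ (h2 _ hm) (hφ0 _ hm) (Real.exp_pos _).le
            rw [Real.exp_neg]
            exact inv_anti₀ (Real.exp_pos _) (by linarith)
      _ = -(Real.exp (-(2 * Real.pi * a)) * ψ (s - a)) / 16 -
            -(Real.exp (-(2 * Real.pi * 0)) * ψ (s - 0)) / 16 := by
          refine intervalIntegral.integral_eq_sub_of_hasDerivAt
            (f := fun y => -(Real.exp (-(2 * Real.pi * y)) * ψ (s - y)) / 16) (fun y hy => ?_) ?_
          · rw [Set.uIcc_of_le ha] at hy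
            have h3 := (hψ _ (hmaps (hsub2 hy))).comp y ((hasDerivAt_id y).const_sub s)
            have h4 := (((hasDerivAt_id y).const_mul (2 * Real.pi)).neg).exp
            refine ((h4.mul h3).neg.div_const 16).congr_deriv ?_
            simp only [id, Function.comp, Pi.neg_apply]
            ring
          · exact ContinuousOn.intervalIntegrable (by rw [Set.uIcc_of_le ha]; exact hc2.mono hsub2)
      _ ≤ _ := by
          have := mul_nonneg (Real.exp_pos (-(2 * Real.pi * a))).le (hψ0 (s - a) ⟨by linarith, by linarith⟩)
          rw [sub_zero]; simp; linarith
  rw [← intervalIntegral.integral_add_adjacent_intervals (b := 0)]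
  · linarith
  · exact ContinuousOn.intervalIntegrable (by rw [Set.uIcc_of_le (by linarith)]; exact hcont.mono hsub1)
  · exact ContinuousOn.intervalIntegrable (by rw [Set.uIcc_of_le ha]; exact hcont.mono hsub2)

/-- A function on a vertical half-strip whose increments over one period are small and which decays
faster than all powers decays exponentially. -/
theorem exists_exponential_decay {E : Type*} [NormedAddCommGroup E] [NormedSpace ℂ E]
    [CompleteSpace E] (U : ℂ → E) (M C : ℝ)  (hC : 0 ≤ C)
    (hd : ∀ t : ℂ, |t.re| ≤ 2 → t.im ≤ -M → DifferentiableAt ℂ U t)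
    (h1 : ∀ t : ℂ, |t.re| ≤ 1 → t.im ≤ -M → ‖U (t + 1) - U t‖ ≤ C / (-t.im) * ‖U t‖)
    (hN : ∀ N : ℕ, ∃ B M' : ℝ, ∀ t : ℂ, |t.re| ≤ 2 → t.im ≤ -M' → ‖U t‖ ≤ B * (-t.im) ^ (-(N : ℤ))) :
    ∃ B S : ℝ, ∀ s : ℝ, S ≤ s → ‖U (-Complex.I * s)‖ ≤ B * Real.exp (-(3 * Real.pi / 2 * s)) := by
  have hpi := Real.pi_gt_three
  -- With N ≥ 16C the power σ^(-N) satisfies 16 (C/σ) ψ ≤ -ψ', so it is itself a supersolution.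
  obtain ⟨N, hNC⟩ := exists_nat_ge (16 * C)
  obtain ⟨A, M0, hA⟩ := hN 0
  obtain ⟨B1, M1, hB1⟩ := hN 1
  obtain ⟨BN, MN, hBN⟩ := hN N
  simp only [Nat.cast_zero, neg_zero, zpow_zero, mul_one] at hA
  set s0 : ℝ := max (max M (max M0 (max M1 MN))) (max (N : ℝ) 1) + 1 + 16 * C with hs0
  have hs0M : M ≤ s0 := by
    have := (le_max_left M (max M0 (max M1 MN))).trans (le_max_left _ (max (N : ℝ) 1)); linarith
  have hs00 : M0 ≤ s0 := by
    have := ((le_max_left M0 (max M1 MN)).trans (le_max_right M _)).trans (le_max_left _ (max (N : ℝ) 1)); linarith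
  have hs01 : M1 ≤ s0 := by
    have := (((le_max_left M1 MN).trans (le_max_right M0 _)).trans (le_max_right M _)).trans (le_max_left _ (max (N : ℝ) 1)); linarith
  have hs0N' : MN ≤ s0 := by
    have := (((le_max_right M1 MN).trans (le_max_right M0 _)).trans (le_max_right M _)).trans (le_max_left _ (max (N : ℝ) 1)); linarith
  have hs0N : (N : ℝ) ≤ s0 := by
    have := (le_max_left (N : ℝ) 1).trans (le_max_right (max M (max M0 (max M1 MN))) _); linarith
  have hs0p : 1 + 16 * C ≤ s0 := by
    have := (le_max_right (N : ℝ) 1).trans (le_max_right (max M (max M0 (max M1 MN))) _); linarith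
  clear_value s0
  have hA0 : 0 ≤ A := (norm_nonneg _).trans (hA (-Complex.I * s0) (by simp) (by simp; linarith))
  -- Large enough that A'/2 · exp(-3πs/2) dominates the top-edge term 4A exp(-2π(s - s0)), and that
  -- A' · exp(-3πs/2) dominates the crude bound A at depths between s0 and s0 + 1.
  set A' := 8 * A * Real.exp (2 * Real.pi * (s0 + 1)) with hA'
  have hA'0 : 0 ≤ A' := by positivity
  -- The exponential is the desired rate. The term ε σ^(-N) makes the comparison start from a finite
  -- constant, by the decay of order N, and disappears as ε → 0.
  set ψ : ℝ → ℝ → ℝ := fun ε σ => Real.exp (-(3 * Real.pi / 2 * σ)) + ε * σ ^ (-(N : ℤ)) with hψ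
  have hψpos : ∀ ε > 0, ∀ σ, s0 ≤ σ → 0 < ψ ε σ := by
    intro ε hε σ hσ
    have : 0 < σ := by linarith
    simp only [hψ]; positivity
  -- one step along a vertical line
  have step : ∀ ε > 0, ∀ K, 0 ≤ K → ∀ x : ℝ, 0 ≤ x → x ≤ 1/2 →
      (∀ σ : ℝ, s0 ≤ σ → ‖U (x - Complex.I * σ)‖ ≤ K * ψ ε σ) →
      ∀ s, s0 + 1 ≤ s → ‖U (x + 1/2 - Complex.I * s)‖ ≤ A' / 2 * ψ ε s + K / 4 * ψ ε s := by
    intro ε hε K hK x hx0 hx1 hline s hs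
    have hbound : ∀ b : ℝ, 1 ≤ b → ‖U (x + 1/2 - Complex.I * s)‖ ≤
        4 * (B1 * (s + b)⁻¹) + (4 * A * Real.exp (-(2 * Real.pi * (s - s0))) + K / 4 * ψ ε s) := by
      intro b hb
      have hre : ∀ z : ℂ, |z.re| ≤ 1/2 → |(x + 1/2 - Complex.I * s + z).re| ≤ 2 := by
        intro z hz
        rw [abs_le] at hz ⊢
        simp
        constructor <;> linarith [hz.1, hz.2]
      have him : ∀ z : ℂ, (x + 1/2 - Complex.I * s + z).im = -s + z.im := by
        intro z
        rw [show (1/2 : ℂ) = ((1/2 : ℝ) : ℂ) by norm_num]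
        simp
      -- The rectangle is centred at x + 1/2 - is, so its sides lie over x and x + 1 and the
      -- increments are controlled by U on the line re t = x alone. Its top edge is at depth s0.
      have hk := norm_le_of_periodic_kernel (fun z => U (x + 1/2 - Complex.I * s + z)) (s - s0) b
        (by linarith) hb ?_ A (B1 * (s + b)⁻¹) ?_ ?_ (fun y => K * (C / (s - y) * ψ ε (s - y))) ?_ ?_
      · simp only [add_zero] at hk
        refine hk.trans ?_
        have hint : ∫ y in (-b)..(s - s0), (1 + Real.exp (2 * Real.pi * y))⁻¹ * (C / (s - y) * ψ ε (s - y)) ≤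
            ψ ε s / 8 := by
          refine integral_kernel_supersolution_le (ψ ε)
            (fun σ => -(3 * Real.pi / 2) * Real.exp (-(3 * Real.pi / 2 * σ)) + ε * (-(N : ℤ) * σ ^ (-(N : ℤ) - 1)))
            (fun σ => C / σ * ψ ε σ) s (s - s0) b (by linarith) (by linarith) ?_ ?_ ?_ ?_ ?_ ?_ ?_
          · intro σ hσ
            have hσ0 : 0 < σ := by linarith [hσ.1]
            have h3 := (((hasDerivAt_id σ).const_mul (3 * Real.pi / 2)).neg).exp
            have h4 := (hasDerivAt_zpow (-(N : ℤ)) σ (Or.inl hσ0.ne')).const_mul ε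
            refine (h3.add h4).congr_deriv ?_
            simp only [id, Int.cast_neg, Int.cast_natCast, Pi.neg_apply]
            ring
          · intro σ hσ
            exact (hψpos ε hε σ (by linarith [hσ.1])).le
          · intro σ hσ
            have hσ0 : σ ≠ 0 := by have := hσ.1; intro h; rw [h] at this; linarith
            have h5 : ContinuousAt (fun σ : ℝ => σ ^ (-(N : ℤ) - 1)) σ := continuousAt_zpow₀ _ _ (Or.inl hσ0)
            exact ContinuousAt.continuousWithinAt (by fun_prop)
          · intro σ hσ
            have hσ0 : σ ≠ 0 := by have := hσ.1; intro h; rw [h] at this; linarith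
            have h5 : ContinuousAt (fun σ : ℝ => σ ^ (-(N : ℤ))) σ := continuousAt_zpow₀ _ _ (Or.inl hσ0)
            simp only [hψ]
            exact ContinuousAt.continuousWithinAt (by fun_prop (disch := assumption))
          · intro σ hσ
            have hσ0 : 0 < σ := by linarith [hσ.1]
            have := hψpos ε hε σ (by linarith [hσ.1])
            positivity
          · intro σ hσ
            have hσ1 : s0 ≤ σ := by linarith [hσ.1]
            have hσ0 : 0 < σ := by linarith
            have hz : 0 < σ ^ (-(N : ℤ)) := by positivity
            have he : 0 < Real.exp (-(3 * Real.pi / 2 * σ)) := Real.exp_pos _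
            simp only [hψ]
            rw [zpow_sub_one₀ hσ0.ne']
            have h6 : 16 * (C / σ) ≤ 1 := by
              rw [← mul_div_assoc, div_le_one hσ0]; linarith
            have h7 : 16 * (C / σ) ≤ N * σ⁻¹ := by
              rw [div_eq_mul_inv, ← mul_assoc]; gcongr
            have h8 : 16 * (C / σ) * Real.exp (-(3 * Real.pi / 2 * σ)) ≤ 3 * Real.pi / 2 * Real.exp (-(3 * Real.pi / 2 * σ)) := by
              gcongr; linarith
            have h9 : 16 * (C / σ) * (ε * σ ^ (-(N : ℤ))) ≤ N * σ⁻¹ * (ε * σ ^ (-(N : ℤ))) := by gcongr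
            push_cast
            linarith
          · intro σ hσ
            have hσ1 : s0 ≤ σ := by linarith [hσ.1]
            have hσ0 : 0 < σ := by linarith
            have hz : 0 < σ ^ (-(N : ℤ)) := by positivity
            have he : 0 < Real.exp (-(3 * Real.pi / 2 * σ)) := Real.exp_pos _
            simp only [hψ]
            rw [zpow_sub_one₀ hσ0.ne']
            have h6 : 16 * (C / σ) ≤ 1 := by
              rw [← mul_div_assoc, div_le_one hσ0]; linarith
            have h7 : N * σ⁻¹ ≤ 1 := by
              rw [← div_eq_mul_inv, div_le_one hσ0]; linarith
            have h8 : 16 * (C / σ) * Real.exp (-(3 * Real.pi / 2 * σ)) ≤ (2 * Real.pi - 3 * Real.pi / 2) * Real.exp (-(3 * Real.pi / 2 * σ)) := by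
              gcongr; linarith
            have h9 : 16 * (C / σ) * (ε * σ ^ (-(N : ℤ))) ≤ (2 * Real.pi - N * σ⁻¹) * (ε * σ ^ (-(N : ℤ))) := by
              gcongr; linarith
            push_cast
            linarith
        have hmul : ∫ y in (-b)..(s - s0), (1 + Real.exp (2 * Real.pi * y))⁻¹ * (K * (C / (s - y) * ψ ε (s - y))) =
            K * ∫ y in (-b)..(s - s0), (1 + Real.exp (2 * Real.pi * y))⁻¹ * (C / (s - y) * ψ ε (s - y)) := by
          rw [← intervalIntegral.integral_const_mul]
          congr 1; ext y; ring
        rw [hmul]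
        have := mul_le_mul_of_nonneg_left hint hK
        linarith
      · intro z hz1 hz2 hz3
        have h3 := hd (x + 1/2 - Complex.I * s + z) (hre z hz1) (by rw [him]; linarith)
        exact h3.comp z (by fun_prop)
      · intro z hz1 hz2
        exact hA _ (hre z hz1) (by rw [him]; linarith)
      · intro z hz1 hz2
        have := hB1 _ (hre z hz1) (by rw [him]; linarith)
        rw [him, hz2] at this
        simpa [add_comm] using this
      · intro y hy
        have hσ0 : s - y ≠ 0 := by have := hy.2; intro h; linarith
        have h5 : ContinuousAt (fun y : ℝ => (s - y) ^ (-(N : ℤ))) y :=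
          ContinuousAt.comp (f := fun y : ℝ => s - y) (continuousAt_zpow₀ _ _ (Or.inl hσ0)) (by fun_prop)
        simp only [hψ]
        exact ContinuousAt.continuousWithinAt (by fun_prop (disch := assumption))
      · intro y hy
        have hy1 := hy.2
        have e1 : (x + 1/2 - Complex.I * s + ((1/2 : ℝ) + y * Complex.I) : ℂ) = (x - Complex.I * (s - y : ℝ)) + 1 := by
          push_cast; ring
        have e2 : (x + 1/2 - Complex.I * s + ((-(1/2) : ℝ) + y * Complex.I) : ℂ) = (x - Complex.I * (s - y : ℝ)) := by
          push_cast; ring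
        simp only [e1, e2]
        have hp : 0 < s - y := by linarith
        have h3 := h1 (x - Complex.I * (s - y : ℝ)) (by simp; rw [abs_le]; constructor <;> linarith) (by simp; linarith)
        have h4 : -(x - Complex.I * (s - y : ℝ) : ℂ).im = s - y := by simp
        rw [h4] at h3
        refine h3.trans ?_
        have h5 := hline (s - y) (by linarith)
        calc _ ≤ C / (s - y) * (K * ψ ε (s - y)) := by gcongr
          _ = _ := by ring
    -- Letting b → ∞ pushes the bottom edge to infinity, where U decays like the inverse of the
    -- depth.
    have hlim : ‖U (x + 1/2 - Complex.I * s)‖ ≤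
        4 * (B1 * 0) + (4 * A * Real.exp (-(2 * Real.pi * (s - s0))) + K / 4 * ψ ε s) := by
      refine ge_of_tendsto (x := atTop) (f := fun b : ℝ => 4 * (B1 * (s + b)⁻¹) + (4 * A * Real.exp (-(2 * Real.pi * (s - s0))) + K / 4 * ψ ε s)) ?_
        (Filter.eventually_atTop.2 ⟨1, hbound⟩)
      refine Tendsto.add_const _ (Tendsto.const_mul _ (Tendsto.const_mul _ ?_))
      exact tendsto_inv_atTop_zero.comp (tendsto_atTop_add_const_left _ _ tendsto_id)
    refine hlim.trans ?_
    have h3 : 4 * A * Real.exp (-(2 * Real.pi * (s - s0))) ≤ A' / 2 * ψ ε s := by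
      have hz : 0 < ε * s ^ (-(N : ℤ)) := by
        have : 0 < s := by linarith
        positivity
      calc 4 * A * Real.exp (-(2 * Real.pi * (s - s0)))
          ≤ 4 * A * (Real.exp (2 * Real.pi * (s0 + 1)) * Real.exp (-(3 * Real.pi / 2 * s))) := by
            rw [← Real.exp_add]
            gcongr
            nlinarith
        _ = A' / 2 * Real.exp (-(3 * Real.pi / 2 * s)) := by rw [hA']; ring
        _ ≤ _ := by
            simp only [hψ]
            gcongr
            linarith
    linarith
  have hloc : ∀ ε > 0, ∀ t : ℂ, |t.re| ≤ 2 → t.im ≤ -s0 → -(s0 + 1) ≤ t.im → ‖U t‖ ≤ A' * ψ ε (-t.im) := by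
    intro ε hε t ht1 ht2 ht3
    have hp : 0 < -t.im := by linarith
    have hz : 0 < ε * (-t.im) ^ (-(N : ℤ)) := by positivity
    calc ‖U t‖ ≤ A := hA t ht1 (by linarith)
      _ ≤ 8 * A * 1 := by linarith
      _ ≤ 8 * A * (Real.exp (2 * Real.pi * (s0 + 1)) * Real.exp (-(3 * Real.pi / 2 * (-t.im)))) := by
          rw [← Real.exp_add]
          gcongr
          rw [Real.one_le_exp_iff]
          nlinarith
      _ = A' * Real.exp (-(3 * Real.pi / 2 * (-t.im))) := by rw [hA']; ring
      _ ≤ _ := by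
          simp only [hψ]
          gcongr
          linarith
  have iter : ∀ ε > 0, ∀ K, 0 ≤ K →
      ((∀ σ : ℝ, s0 ≤ σ → ‖U ((0:ℝ) - Complex.I * σ)‖ ≤ K * ψ ε σ) ∧
       (∀ σ : ℝ, s0 ≤ σ → ‖U ((1/2 : ℝ) - Complex.I * σ)‖ ≤ K * ψ ε σ)) →
      ((∀ σ : ℝ, s0 ≤ σ → ‖U ((0:ℝ) - Complex.I * σ)‖ ≤ (A' + K / 2) * ψ ε σ) ∧
       (∀ σ : ℝ, s0 ≤ σ → ‖U ((1/2 : ℝ) - Complex.I * σ)‖ ≤ (A' + K / 2) * ψ ε σ)) := by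
    rintro ε hε K hK ⟨ha, hb⟩
    refine ⟨fun s hs => ?_, fun s hs => ?_⟩
    · have hp := hψpos ε hε s hs
      rcases le_total s (s0 + 1) with h | h
      · have h3 := hloc ε hε ((0:ℝ) - Complex.I * s) (by simp) (by simp; linarith) (by simp; linarith)
        have h4 : -((0:ℝ) - Complex.I * s : ℂ).im = s := by simp
        rw [h4] at h3
        nlinarith
      · have h3 := step ε hε K hK (1/2) (by norm_num) le_rfl hb s h
        have h5 := h1 ((0:ℝ) - Complex.I * s) (by simp) (by simp; linarith)
        have h4 : -((0:ℝ) - Complex.I * s : ℂ).im = s := by simp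
        rw [h4, show ((0:ℝ) - Complex.I * s + 1 : ℂ) = (1/2 : ℝ) + 1/2 - Complex.I * s by push_cast; ring] at h5
        have h6 : C / s ≤ 1/2 := by rw [div_le_iff₀ (by linarith)]; linarith
        have h7 := mul_le_mul_of_nonneg_right h6 (norm_nonneg (U ((0:ℝ) - Complex.I * s)))
        have h8 := norm_sub_norm_le (U ((0:ℝ) - Complex.I * s)) (U ((1/2 : ℝ) + 1/2 - Complex.I * s))
        rw [norm_sub_rev] at h8
        linarith
    · have hp := hψpos ε hε s hs
      rcases le_total s (s0 + 1) with h | h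
      · have h3 := hloc ε hε ((1/2 : ℝ) - Complex.I * s) (by simp; norm_num) (by simp; linarith) (by simp; linarith)
        have h4 : -((1/2 : ℝ) - Complex.I * s : ℂ).im = s := by simp
        rw [h4] at h3
        nlinarith
      · have h3 := step ε hε K hK 0 le_rfl (by norm_num) ha s h
        rw [show ((0:ℝ) + 1/2 - Complex.I * s : ℂ) = (1/2 : ℝ) - Complex.I * s by push_cast; ring] at h3
        nlinarith
  have final : ∀ ε > 0, ∀ σ : ℝ, s0 ≤ σ → ‖U ((0:ℝ) - Complex.I * σ)‖ ≤ 2 * A' * ψ ε σ := by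
    intro ε hε σ hσ
    have hall : ∀ n : ℕ,
      ((∀ σ : ℝ, s0 ≤ σ → ‖U ((0:ℝ) - Complex.I * σ)‖ ≤ (2 * A' + |BN| / ε * (1/2) ^ n) * ψ ε σ) ∧
       (∀ σ : ℝ, s0 ≤ σ → ‖U ((1/2 : ℝ) - Complex.I * σ)‖ ≤ (2 * A' + |BN| / ε * (1/2) ^ n) * ψ ε σ)) := by
      intro n
      induction n with
      | zero =>
        have hx : ∀ x : ℝ, |x| ≤ 2 → ∀ σ : ℝ, s0 ≤ σ → ‖U (x - Complex.I * σ)‖ ≤ (2 * A' + |BN| / ε * (1/2) ^ 0) * ψ ε σ := by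
          intro x hx σ hσ
          have h3 := hBN (x - Complex.I * σ) (by simpa using hx) (by simp; linarith)
          have h4 : -(x - Complex.I * σ : ℂ).im = σ := by simp
          rw [h4] at h3
          have hp : 0 < σ := by linarith
          have hz : 0 < σ ^ (-(N : ℤ)) := by positivity
          have he : 0 < Real.exp (-(3 * Real.pi / 2 * σ)) := Real.exp_pos _
          calc _ ≤ _ := h3
            _ ≤ |BN| * σ ^ (-(N : ℤ)) := by gcongr; exact le_abs_self _
            _ = |BN| / ε * (ε * σ ^ (-(N : ℤ))) := by field_simp
            _ ≤ (2 * A' + |BN| / ε * (1/2) ^ 0) * ψ ε σ := by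
                simp only [hψ, pow_zero, mul_one]
                gcongr <;> linarith
        exact ⟨hx 0 (by simp), hx (1/2) (by rw [abs_le]; norm_num)⟩
      | succ n ih =>
        have := iter ε hε _ (by positivity) ih
        -- The constant 2A' is the fixed point of K ↦ A' + K/2, so iteration halves the excess
        -- |BN|/ε each time and leaves a bound independent of ε.
        have e : A' + (2 * A' + |BN| / ε * (1/2) ^ n) / 2 = 2 * A' + |BN| / ε * (1/2) ^ (n + 1) := by
          rw [pow_succ]; ring
        rwa [e] at this
    have hl : Tendsto (fun n : ℕ => (2 * A' + |BN| / ε * (1/2 : ℝ) ^ n) * ψ ε σ) atTop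
        (𝓝 ((2 * A' + |BN| / ε * 0) * ψ ε σ)) :=
      ((((tendsto_pow_atTop_nhds_zero_of_lt_one (by norm_num) (by norm_num)).const_mul _).const_add _).mul_const _)
    simpa using ge_of_tendsto' hl fun n => (hall n).1 σ hσ
  refine ⟨2 * A', s0, fun s hs => ?_⟩
  have hl : Tendsto (fun ε : ℝ => 2 * A' * ψ ε s) (𝓝[>] 0) (𝓝 (2 * A' * ψ 0 s)) := by
    refine (Continuous.tendsto ?_ 0).mono_left nhdsWithin_le_nhds
    simp only [hψ]; fun_prop
  have h3 := ge_of_tendsto hl (eventually_nhdsWithin_of_forall fun ε (hε : 0 < ε) => final ε hε s hs)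
  simp only [hψ, zero_mul, add_zero] at h3
  simpa using h3

/-! ### A Phragmén–Lindelöf principle in a vertical half-strip -/

/-- Multiplying G by exp(-δ cos(α(t - m))), with m the midpoint of the strip, keeps moduli below
those of G and beats any exponential growth at depth. The maximum principle applies on a rectangle
cut off far below, and then δ → 0. -/
theorem norm_le_of_halfStrip (G : ℂ → ℂ) (a b S B k ε : ℝ) (hab : a < b) (hε : 0 < ε) (hB : 0 ≤ B)
    (hd : ∀ t : ℂ, a ≤ t.re → t.re ≤ b → t.im ≤ -S → DifferentiableAt ℂ G t)
    (hgrow : ∀ t : ℂ, a ≤ t.re → t.re ≤ b → t.im ≤ -S → ‖G t‖ ≤ B * Real.exp (k * (-t.im)))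
    (hl : ∀ t : ℂ, t.re = a → t.im ≤ -S → ‖G t‖ ≤ ε)
    (hr : ∀ t : ℂ, t.re = b → t.im ≤ -S → ‖G t‖ ≤ ε)
    (ht : ∀ t : ℂ, a ≤ t.re → t.re ≤ b → t.im = -S → ‖G t‖ ≤ ε)
    (t : ℂ) (ht1 : a ≤ t.re) (ht2 : t.re ≤ b) (ht3 : t.im ≤ -S) : ‖G t‖ ≤ ε := by
  have hw : 0 < b - a := by linarith
  have hpi := Real.pi_pos
  -- The real part of the argument of the cosine then stays within π/4, so the cosine factor is at
  -- least cos(π/3) = 1/2 up to the edges of the strip.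
  set α := Real.pi / (2 * (b - a)) with hα
  have hα0 : 0 < α := by positivity
  set c : ℂ → ℂ := fun t => Complex.cos (α * (t - ((a + b) / 2 : ℝ))) with hc
  have hcre : ∀ t : ℂ, a ≤ t.re → t.re ≤ b → 1/2 * Real.cosh (α * t.im) ≤ (c t).re := by
    intro t h1 h2
    have e : (α * (t - ((a + b) / 2 : ℝ)) : ℂ) = ((α * (t.re - (a + b) / 2) : ℝ) : ℂ) + ((α * t.im : ℝ) : ℂ) * Complex.I := by
      conv_lhs => rw [← Complex.re_add_im t]
      push_cast; ring
    simp only [hc]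
    rw [e, Complex.cos_add_mul_I, ← Complex.ofReal_cos, ← Complex.ofReal_cosh, ← Complex.ofReal_sin,
      ← Complex.ofReal_sinh]
    have e2 : (((Real.cos (α * (t.re - (a + b) / 2)) : ℝ) : ℂ) * ((Real.cosh (α * t.im) : ℝ) : ℂ) -
      ((Real.sin (α * (t.re - (a + b) / 2)) : ℝ) : ℂ) * ((Real.sinh (α * t.im) : ℝ) : ℂ) * Complex.I).re =
      Real.cos (α * (t.re - (a + b) / 2)) * Real.cosh (α * t.im) := by
      rw [← Complex.ofReal_mul, ← Complex.ofReal_mul, Complex.sub_re, Complex.ofReal_re, Complex.re_ofReal_mul,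
        Complex.I_re, mul_zero, sub_zero]
    rw [e2]
    refine mul_le_mul_of_nonneg_right ?_ (Real.cosh_pos _).le
    have h3 : |α * (t.re - (a + b) / 2)| ≤ Real.pi / 3 := by
      rw [abs_mul, abs_of_pos hα0]
      have h4 : |t.re - (a + b) / 2| ≤ (b - a) / 2 := abs_le.2 ⟨by linarith, by linarith⟩
      calc α * |t.re - (a + b) / 2| ≤ α * ((b - a) / 2) := by gcongr
        _ = Real.pi / 4 := by rw [hα]; field_simp; norm_num
        _ ≤ _ := by linarith
    rw [← Real.cos_abs, ← Real.cos_pi_div_three]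
    exact Real.cos_le_cos_of_nonneg_of_le_pi (abs_nonneg _) (by linarith) h3
  have hcosh : ∀ y : ℝ, y ^ 2 / 4 ≤ Real.cosh y := by
    intro y
    rw [← Real.cosh_abs, Real.cosh_eq]
    have h1 := Real.quadratic_le_exp_of_nonneg (abs_nonneg y)
    have h2 := Real.exp_pos (-|y|)
    rw [sq_abs] at h1
    have := abs_nonneg y
    linarith
  have hδ : ∀ δ > 0, ‖G t * Complex.exp (-(δ : ℝ) * c t)‖ ≤ ε := by
    intro δ hδ
    have hen : ∀ u : ℂ, ‖Complex.exp (-(δ : ℝ) * c u)‖ = Real.exp (-(δ * (c u).re)) := by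
      intro u
      rw [Complex.norm_exp]; simp
    have hle1 : ∀ u : ℂ, a ≤ u.re → u.re ≤ b → ‖Complex.exp (-(δ : ℝ) * c u)‖ ≤ 1 := by
      intro u h1 h2
      rw [hen, Real.exp_le_one_iff]
      have := hcre u h1 h2
      have := Real.cosh_pos (α * u.im)
      have h3 : 0 ≤ (c u).re := by linarith
      have := mul_nonneg hδ.le h3
      linarith
    -- The bound cosh y ≥ y²/4 suffices here: a quadratic in the exponent already beats the linear
    -- term k s.
    obtain ⟨s1, hs1, hs1S, hs1t⟩ : ∃ s1 : ℝ, B * Real.exp (k * s1 - δ * α ^ 2 / 8 * s1 ^ 2) ≤ ε ∧ S < s1 ∧ -t.im ≤ s1 := by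
      have h1 : Tendsto (fun s : ℝ => B * Real.exp (k * s - δ * α ^ 2 / 8 * s ^ 2)) atTop (𝓝 (B * 0)) := by
        refine Tendsto.const_mul _ (Real.tendsto_exp_atBot.comp ?_)
        have h2 : Tendsto (fun s : ℝ => s * (k - δ * α ^ 2 / 8 * s)) atTop atBot := by
          refine Tendsto.atTop_mul_atBot₀ tendsto_id ?_
          have h3 : Tendsto (fun s : ℝ => δ * α ^ 2 / 8 * s) atTop atTop :=
            tendsto_id.const_mul_atTop (by positivity)
          simpa [sub_eq_add_neg] using tendsto_atBot_add_const_left _ k (tendsto_neg_atTop_atBot.comp h3)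
        refine h2.congr fun s => by ring
      rw [mul_zero] at h1
      have h2 := h1.eventually (ge_mem_nhds hε)
      obtain ⟨s, hs⟩ := (h2.and ((eventually_gt_atTop S).and (eventually_ge_atTop (-t.im)))).exists
      exact ⟨s, hs.1, hs.2.1, hs.2.2⟩
    have hne : -s1 ≠ -S := by intro h; linarith
    have hmem : ∀ u : ℂ, u ∈ closure (Set.Ioo a b ×ℂ Set.Ioo (-s1) (-S)) → a ≤ u.re ∧ u.re ≤ b ∧ -s1 ≤ u.im ∧ u.im ≤ -S := by
      intro u hu
      rw [Complex.closure_reProdIm, closure_Ioo hab.ne, closure_Ioo hne, Complex.mem_reProdIm] at hu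
      exact ⟨hu.1.1, hu.1.2, hu.2.1, hu.2.2⟩
    refine Complex.norm_le_of_forall_mem_frontier_norm_le (f := fun u => G u * Complex.exp (-(δ : ℝ) * c u))
      (U := Set.Ioo a b ×ℂ Set.Ioo (-s1) (-S)) ?_ ?_ ?_ ?_
    · exact (Metric.isBounded_Ioo a b).reProdIm (Metric.isBounded_Ioo _ _)
    · refine DifferentiableOn.diffContOnCl fun u hu => ?_
      have hu := hmem u hu
      refine (DifferentiableAt.mul (hd u hu.1 hu.2.1 hu.2.2.2) ?_).differentiableWithinAt
      simp only [hc]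
      fun_prop
    · intro u hu
      have hucl := hmem u (frontier_subset_closure hu)
      have hsmall : ‖G u‖ ≤ ε → ‖G u * Complex.exp (-(δ : ℝ) * c u)‖ ≤ ε := by
        intro h
        rw [norm_mul]
        exact (mul_le_of_le_one_right (norm_nonneg _) (hle1 u hucl.1 hucl.2.1)).trans h
      rw [Complex.frontier_reProdIm, closure_Ioo hab.ne, closure_Ioo hne, frontier_Ioo hab,
        frontier_Ioo (by linarith)] at hu
      rcases hu with hu | hu
      · rcases hu.2 with h | h
        · rw [norm_mul, hen]
          have h : u.im = -s1 := h
          refine le_trans ?_ hs1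
          have h3 := hcre u hucl.1 hucl.2.1
          have h4 := hcosh (α * u.im)
          calc _ ≤ B * Real.exp (k * (-u.im)) * Real.exp (-(δ * (α ^ 2 * u.im ^ 2 / 8))) := by
                refine mul_le_mul (hgrow u hucl.1 hucl.2.1 hucl.2.2.2) ?_ (Real.exp_pos _).le (by positivity)
                refine Real.exp_le_exp.2 (neg_le_neg (mul_le_mul_of_nonneg_left ?_ hδ.le))
                nlinarith
            _ = _ := by
                rw [mul_assoc, ← Real.exp_add, h]
                ring_nf
        · exact hsmall (ht u hucl.1 hucl.2.1 h)
      · rcases hu.1 with h | h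
        · exact hsmall (hl u h hucl.2.2.2)
        · exact hsmall (hr u h hucl.2.2.2)
    · rw [Complex.closure_reProdIm, closure_Ioo hab.ne, closure_Ioo hne, Complex.mem_reProdIm]
      exact ⟨⟨ht1, ht2⟩, ⟨by linarith, ht3⟩⟩
  have hlim : Tendsto (fun δ : ℝ => ‖G t * Complex.exp (-(δ : ℝ) * c t)‖) (𝓝[>] 0)
      (𝓝 ‖G t * Complex.exp (-((0 : ℝ) : ℂ) * c t)‖) := by
    refine (Continuous.tendsto ?_ 0).mono_left nhdsWithin_le_nhds
    fun_prop
  have := le_of_tendsto hlim (eventually_nhdsWithin_of_forall fun δ hδ' => hδ δ hδ')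
  simpa using this

/-- A function of exponential growth in a vertical half-strip has at most one limit along the two
sides. -/
theorem limit_eq_of_halfStrip (h : ℂ → ℂ) (a b M C k : ℝ) (L₁ L₂ : ℂ) (hab : a < b)
    (hk : 0 ≤ k) (hM : 0 ≤ M)
    (hd : ∀ t : ℂ, a ≤ t.re → t.re ≤ b → t.im ≤ -M → DifferentiableAt ℂ h t)
    (hgrow : ∀ t : ℂ, a ≤ t.re → t.re ≤ b → t.im ≤ -M → ‖h t‖ ≤ C * Real.exp (k * (-t.im)))
    (h₁ : Tendsto (fun s : ℝ => h (a - Complex.I * s)) atTop (𝓝 L₁))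
    (h₂ : Tendsto (fun s : ℝ => h (b - Complex.I * s)) atTop (𝓝 L₂)) : L₁ = L₂ := by
  by_contra hne
  have hw : 0 < b - a := by linarith
  set d := ‖L₁ - L₂‖ with hd'
  have hd0 : 0 < d := norm_pos_iff.2 (sub_ne_zero.2 hne)
  -- Since g = (h - L₁)(h - L₂) tends to zero on both sides, the aim is |g| ≤ 2ε on a whole
  -- horizontal segment. But |h - L₁| crosses the value d/2 there, and at that point |g| ≥ d²/4.
  set ε := d ^ 2 / 64 with hε
  have hε0 : 0 < ε := by positivity
  set g : ℂ → ℂ := fun t => (h t - L₁) * (h t - L₂) with hg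
  have hg1 : Tendsto (fun s : ℝ => ‖g (a - Complex.I * s)‖) atTop (𝓝 0) := by
    have : Tendsto (fun s : ℝ => g (a - Complex.I * s)) atTop (𝓝 ((L₁ - L₁) * (L₁ - L₂))) :=
      (h₁.sub_const _).mul (h₁.sub_const _)
    simpa using this.norm
  have hg2 : Tendsto (fun s : ℝ => ‖g (b - Complex.I * s)‖) atTop (𝓝 0) := by
    have : Tendsto (fun s : ℝ => g (b - Complex.I * s)) atTop (𝓝 ((L₂ - L₁) * (L₂ - L₂))) :=
      (h₂.sub_const _).mul (h₂.sub_const _)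
    simpa using this.norm
  have hn1 : Tendsto (fun s : ℝ => ‖h (a - Complex.I * s) - L₁‖) atTop (𝓝 0) := by
    simpa using (h₁.sub_const L₁).norm
  have hn2 : Tendsto (fun s : ℝ => ‖h (b - Complex.I * s) - L₂‖) atTop (𝓝 0) := by
    simpa using (h₂.sub_const L₂).norm
  obtain ⟨S, hS⟩ := eventually_atTop.1 (((hg1.eventually (ge_mem_nhds hε0)).and (hg2.eventually (ge_mem_nhds hε0))).and
    (((hn1.eventually (ge_mem_nhds (by positivity : 0 < d / 4))).and (hn2.eventually (ge_mem_nhds (by positivity : 0 < d / 4)))).and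
      (eventually_ge_atTop M)))
  have hMS : M ≤ S := (hS S le_rfl).2.2
  have hform : ∀ t : ℂ, t = t.re - Complex.I * (-t.im : ℝ) := by
    intro t
    conv_lhs => rw [← Complex.re_add_im t]
    push_cast; ring
  have hC : 0 ≤ C := by
    have := (norm_nonneg _).trans (hgrow (a - Complex.I * M) (by simp) (by simp; linarith) (by simp))
    exact nonneg_of_mul_nonneg_left this (Real.exp_pos _)
  set B := (C + ‖L₁‖) * (C + ‖L₂‖) with hB
  have hB0 : 0 ≤ B := by positivity
  have hgB : ∀ t : ℂ, a ≤ t.re → t.re ≤ b → t.im ≤ -S → ‖g t‖ ≤ B * Real.exp ((2 * k) * (-t.im)) := by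
    intro t h1 h2 h3
    have he : 1 ≤ Real.exp (k * (-t.im)) := Real.one_le_exp (mul_nonneg hk (by linarith))
    have h4 := hgrow t h1 h2 (by linarith)
    have hh : ∀ L : ℂ, ‖h t - L‖ ≤ (C + ‖L‖) * Real.exp (k * (-t.im)) := by
      intro L
      refine (norm_sub_le _ _).trans ?_
      nlinarith [norm_nonneg L]
    simp only [hg]
    rw [norm_mul]
    calc _ ≤ ((C + ‖L₁‖) * Real.exp (k * (-t.im))) * ((C + ‖L₂‖) * Real.exp (k * (-t.im))) := by
          gcongr <;> exact hh _
      _ = B * (Real.exp (k * (-t.im)) * Real.exp (k * (-t.im))) := by rw [hB]; ring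
      _ = _ := by rw [← Real.exp_add]; ring_nf
  -- The top edge, where g need not be small, is handled by the factor z/(z + K). Its modulus is at
  -- most 1 in the half-strip and at most (b - a)/K on the top edge, and this K makes the product at
  -- most ε there. At depth S + K the factor is still at least 1/2.
  set K := 1 + B * Real.exp ((2 * k) * S) * (b - a) / ε with hK
  have hK0 : 0 < K := by positivity
  set z : ℂ → ℂ := fun t => Complex.I * (t - a) - S with hz
  have hzre : ∀ t : ℂ, (z t).re = -t.im - S := by intro t; simp [hz]
  have hzim : ∀ t : ℂ, (z t).im = t.re - a := by intro t; simp [hz]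
  have hzK : ∀ t : ℂ, t.im ≤ -S → ‖z t‖ ≤ ‖z t + K‖ ∧ K ≤ ‖z t + K‖ := by
    intro t ht
    have h0 : 0 ≤ (z t).re := by rw [hzre]; linarith
    constructor
    · rw [Complex.norm_def, Complex.norm_def]
      refine Real.sqrt_le_sqrt ?_
      rw [Complex.normSq_apply, Complex.normSq_apply]
      simp only [Complex.add_re, Complex.add_im, Complex.ofReal_re, Complex.ofReal_im]
      nlinarith
    · refine le_trans ?_ (Complex.re_le_norm _)
      simp only [Complex.add_re, Complex.ofReal_re]
      linarith
  have hφ1 : ∀ t : ℂ, t.im ≤ -S → ‖z t / (z t + K)‖ ≤ 1 := by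
    intro t ht
    rw [norm_div]
    exact div_le_one_of_le₀ (hzK t ht).1 (norm_nonneg _)
  have key := norm_le_of_halfStrip (fun t => g t * (z t / (z t + K))) a b S B (2 * k) ε hab hε0 hB0 ?_ ?_ ?_ ?_ ?_
  · -- look at one far horizontal segment
    set s := S + K with hs
    have hsS : S ≤ s := by linarith
    have hpt : ∀ x : ℝ, a ≤ x → x ≤ b → ‖g (x - Complex.I * s)‖ ≤ 2 * ε := by
      intro x hx1 hx2
      have him : (x - Complex.I * s : ℂ).im = -s := by simp
      have h3 := key (x - Complex.I * s) (by simpa) (by simpa) (by rw [him]; linarith)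
      rw [norm_mul] at h3
      have h4 : 1/2 ≤ ‖z (x - Complex.I * s) / (z (x - Complex.I * s) + K)‖ := by
        have h5 := hzK (x - Complex.I * s) (by rw [him]; linarith)
        rw [norm_div, le_div_iff₀ (by linarith)]
        have h6 : ‖z (x - Complex.I * s) + K‖ ≤ ‖z (x - Complex.I * s)‖ + K := by
          refine (norm_add_le _ _).trans ?_
          rw [Complex.norm_real, Real.norm_of_nonneg hK0.le]
        have h7 : K ≤ ‖z (x - Complex.I * s)‖ := by
          refine le_trans ?_ (Complex.re_le_norm _)
          rw [hzre, him]; linarith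
        linarith
      nlinarith [norm_nonneg (g (x - Complex.I * s))]
    have hcont : ContinuousOn (fun x : ℝ => ‖h (x - Complex.I * s) - L₁‖) (Set.Icc a b) := by
      intro x hx
      have h3 := (hd (x - Complex.I * s) (by simpa using hx.1) (by simpa using hx.2) (by simp; linarith)).continuousAt
      have h4 : ContinuousAt (fun x : ℝ => h (x - Complex.I * s)) x :=
        ContinuousAt.comp (f := fun x : ℝ => (x - Complex.I * s : ℂ)) h3 (by fun_prop)
      exact (h4.sub continuousAt_const).norm.continuousWithinAt
    have hSs := (hS s hsS).2.1
    have hend : d / 2 ≤ ‖h (b - Complex.I * s) - L₁‖ := by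
      have h5 := norm_sub_le (h (b - Complex.I * s) - L₂) (h (b - Complex.I * s) - L₁)
      rw [show h (b - Complex.I * s) - L₂ - (h (b - Complex.I * s) - L₁) = L₁ - L₂ by ring] at h5
      linarith [hSs.2]
    obtain ⟨x, hx, hxe⟩ := intermediate_value_Icc hab.le hcont
      (show d / 2 ∈ Set.Icc _ _ from ⟨by linarith [hSs.1], hend⟩)
    have h6 := hpt x hx.1 hx.2
    simp only [hg] at h6
    rw [norm_mul] at h6
    simp only at hxe
    have h5 := norm_sub_le (h (x - Complex.I * s) - L₂) (h (x - Complex.I * s) - L₁)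
    rw [show h (x - Complex.I * s) - L₂ - (h (x - Complex.I * s) - L₁) = L₁ - L₂ by ring] at h5
    rw [hxe] at h5 h6
    nlinarith
  · intro t h1 h2 h3
    have h4 := hd t h1 h2 (by linarith)
    have h5 : z t + K ≠ 0 := by
      intro h0
      have := (hzK t h3).2
      rw [h0, norm_zero] at this; linarith
    have h6 : DifferentiableAt ℂ z t := by simp only [hz]; fun_prop
    simp only [hg]
    exact ((h4.sub_const _).mul (h4.sub_const _)).mul (h6.div (h6.add_const _) h5)
  · intro t h1 h2 h3
    rw [norm_mul]
    exact (mul_le_of_le_one_right (norm_nonneg _) (hφ1 t h3)).trans (hgB t h1 h2 h3)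
  · intro t h1 h3
    rw [norm_mul]
    refine (mul_le_of_le_one_right (norm_nonneg _) (hφ1 t h3)).trans ?_
    rw [hform t, h1]
    exact (hS (-t.im) (by linarith)).1.1
  · intro t h1 h3
    rw [norm_mul]
    refine (mul_le_of_le_one_right (norm_nonneg _) (hφ1 t h3)).trans ?_
    rw [hform t, h1]
    exact (hS (-t.im) (by linarith)).1.2
  · intro t h1 h2 h3
    rw [norm_mul, norm_div]
    have h4 : ‖z t‖ ≤ b - a := by
      refine (Complex.norm_le_abs_re_add_abs_im _).trans ?_
      rw [hzre, hzim, h3, abs_of_nonneg (by linarith : 0 ≤ t.re - a)]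
      simp; linarith
    have h5 := (hzK t h3.le).2
    have h6 := hgB t h1 h2 h3.le
    rw [h3, neg_neg] at h6
    calc _ ≤ (B * Real.exp ((2 * k) * S)) * ((b - a) / K) := by gcongr
      _ ≤ ε := by
          rw [← mul_div_assoc, div_le_iff₀ hK0, hK]
          have : ε * (1 + B * Real.exp ((2 * k) * S) * (b - a) / ε) = ε + B * Real.exp ((2 * k) * S) * (b - a) := by
            field_simp
          rw [this]; linarith

/-! ### Wedges at infinity -/

/-- The wedge `{t | M < ε re t + κ |im t|}`, used with `ε = 1` and `ε = -1`. -/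
def wedge (ε M κ : ℝ) : Set ℂ := {t | M < ε * t.re + κ * |t.im|}

theorem lt_norm_of_mem_wedge {ε M κ : ℝ} (hε : |ε| = 1) (hκ : κ ≤ 1) {t : ℂ}
    (ht : t ∈ wedge ε M κ) : M < 2 * ‖t‖ := by
  have h1 : ε * t.re ≤ ‖t‖ := by
    calc ε * t.re ≤ |ε * t.re| := le_abs_self _
      _ = |t.re| := by rw [abs_mul, hε, one_mul]
      _ ≤ ‖t‖ := Complex.abs_re_le_norm t
  have h2 : κ * |t.im| ≤ ‖t‖ := by
    have := Complex.abs_im_le_norm t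
    have := abs_nonneg t.im
    nlinarith
  have h3 : M < ε * t.re + κ * |t.im| := ht
  linarith

theorem wedge_mono {ε M M' κ : ℝ} (h : M ≤ M') : wedge ε M' κ ⊆ wedge ε M κ :=
  fun _ ht => lt_of_le_of_lt h ht

theorem add_real_mem_wedge {ε M κ : ℝ} {t : ℂ} {x : ℝ} (hx : 0 ≤ ε * x) (ht : t ∈ wedge ε M κ) :
    t + x ∈ wedge ε M κ := by
  have h : M < ε * t.re + κ * |t.im| := ht
  change M < ε * (t + x).re + κ * |(t + x).im|
  simp only [Complex.add_re, Complex.ofReal_re, Complex.add_im, Complex.ofReal_im, add_zero]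
  linarith

theorem add_mem_wedge {ε M κ : ℝ} (hε : |ε| = 1) (hκ0 : 0 ≤ κ) (hκ : κ ≤ 1) {t : ℂ} (c : ℂ)
    (ht : t ∈ wedge ε (M + 2 * ‖c‖) κ) : t + c ∈ wedge ε M κ := by
  have h : M + 2 * ‖c‖ < ε * t.re + κ * |t.im| := ht
  change M < ε * (t + c).re + κ * |(t + c).im|
  simp only [Complex.add_re, Complex.add_im]
  have h1 : -‖c‖ ≤ ε * c.re := by
    have h2 : |ε * c.re| ≤ ‖c‖ := by rw [abs_mul, hε, one_mul]; exact Complex.abs_re_le_norm c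
    exact (abs_le.1 h2).1
  have h2 : κ * |t.im| ≤ κ * |t.im + c.im| + ‖c‖ := by
    have h3 : |t.im| ≤ |t.im + c.im| + |c.im| := by
      have := abs_sub (t.im + c.im) c.im
      simpa using this
    have h4 := Complex.abs_im_le_norm c
    have h5 := abs_nonneg c.im
    nlinarith
  linarith

theorem isOpen_wedge (ε M κ : ℝ) : IsOpen (wedge ε M κ) :=
  isOpen_lt continuous_const (by fun_prop)

theorem conj_mem_wedge {ε M κ : ℝ} {t : ℂ} (ht : t ∈ wedge ε M κ) :
    (starRingEnd ℂ) t ∈ wedge ε M κ := by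
  simpa [wedge] using ht

/-- For κ > 0 the wedge is not convex, but it is star-shaped about a real point. The identity
theorem in the reflection principle needs this. -/
theorem isPreconnected_wedge {ε M κ : ℝ} (hε : |ε| = 1) :
    IsPreconnected (wedge ε M κ) := by
  have hε2 : ε * ε = 1 := by rw [← abs_mul_abs_self, hε, one_mul]
  have hp : ((ε * (M + 1) : ℝ) : ℂ) ∈ wedge ε M κ := by
    change M < ε * ((ε * (M + 1) : ℝ) : ℂ).re + κ * |((ε * (M + 1) : ℝ) : ℂ).im|
    rw [Complex.ofReal_re, Complex.ofReal_im, ← mul_assoc, hε2]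
    simp
  have hstar : StarConvex ℝ ((ε * (M + 1) : ℝ) : ℂ) (wedge ε M κ) := by
    intro t ht x y hx hy hxy
    have h : M < ε * t.re + κ * |t.im| := ht
    change M < ε * (x • ((ε * (M + 1) : ℝ) : ℂ) + y • t).re + κ * |(x • ((ε * (M + 1) : ℝ) : ℂ) + y • t).im|
    simp only [Complex.add_re, Complex.add_im, Complex.real_smul, Complex.re_ofReal_mul,
      Complex.im_ofReal_mul, Complex.ofReal_re, Complex.ofReal_im, mul_zero, zero_add, abs_mul, abs_of_nonneg hy]
    have e : ε * (x * (ε * (M + 1)) + y * t.re) + κ * (y * |t.im|) =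
      x * (M + 1) + y * (ε * t.re + κ * |t.im|) := by linear_combination (x * (M + 1)) * hε2
    rw [e]
    have h3 : M = x * M + y * M := by rw [← add_mul, hxy, one_mul]
    rcases hy.eq_or_lt with h0 | h0
    · rw [← h0] at hxy ⊢
      have : x = 1 := by linarith
      rw [this]; linarith
    · nlinarith
  exact (hstar.isPathConnected hp).isConnected.isPreconnected

/-- If |arg t| ≥ π/2 + δ', then re t ≤ -sin δ' · |t|, so re t + κ|im t| ≤ 0 as soon as κ ≤ sin δ'.
Together with the reverse inclusion this lets wedges, which behave simply under translation, replace
sectors throughout. -/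
theorem exists_wedge_subset_sectorPlus {δ : ℝ} (hδ : 0 < δ) :
    ∃ κ₀ > 0, ∀ κ, 0 < κ → κ ≤ κ₀ → κ ≤ 1 → ∀ R M : ℝ, 0 ≤ M → 2 * R ≤ M →
      wedge 1 M κ ⊆ sectorPlus R δ := by
  have hpi := Real.pi_pos
  set δ' := min δ (Real.pi / 2) with hδ'
  have hδ0 : 0 < δ' := lt_min hδ (by positivity)
  have hδ1 : δ' ≤ Real.pi / 2 := min_le_right _ _
  refine ⟨Real.sin δ', Real.sin_pos_of_pos_of_lt_pi hδ0 (by linarith), ?_⟩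
  intro κ hκ hκ0 hκ1 R M hM hR t ht
  have hn := lt_norm_of_mem_wedge (by simp) hκ1 ht
  have htn : 0 < ‖t‖ := by linarith
  refine ⟨by linarith, ?_⟩
  by_contra hcon
  rw [not_lt] at hcon
  have h1 : Real.pi / 2 + δ' ≤ |t.arg| := le_trans (by linarith [min_le_left δ (Real.pi / 2)]) hcon
  have h2 := Real.cos_le_cos_of_nonneg_of_le_pi (by linarith) (Complex.abs_arg_le_pi t) h1
  rw [Real.cos_abs, Complex.cos_arg (norm_pos_iff.1 htn), div_le_iff₀ htn, add_comm, Real.cos_add_pi_div_two] at h2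
  have h3 : M < 1 * t.re + κ * |t.im| := ht
  have h4 := Complex.abs_im_le_norm t
  have h5 := abs_nonneg t.im
  nlinarith

/-- With |arg t| < π/2 + κ/4 one has re t ≥ -(κ/4)|t|, hence |im t| ≥ (1 - κ/4)|t| when re t ≤ 0,
and re t + κ|im t| ≥ (κ/2)|t|. The radius makes this exceed M. -/
theorem exists_sectorPlus_subset_wedge {M κ : ℝ} (hκ0 : 0 < κ) (hκ : κ ≤ 1) :
    ∃ R > 0, ∃ δ > 0, sectorPlus R δ ⊆ wedge 1 M κ := by
  have hpi := Real.pi_gt_three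
  refine ⟨2 * |M| / κ + 1, by positivity, κ / 4, by positivity, ?_⟩
  rintro t ⟨h1, h2⟩
  have htn : 0 < ‖t‖ := lt_trans (by positivity) h1
  have h3 := Real.cos_le_cos_of_nonneg_of_le_pi (abs_nonneg t.arg) (by linarith : Real.pi / 2 + κ / 4 ≤ Real.pi) h2.le
  rw [Real.cos_abs, Complex.cos_arg (norm_pos_iff.1 htn), le_div_iff₀ htn, add_comm, Real.cos_add_pi_div_two] at h3
  have h4 : Real.sin (κ / 4) ≤ κ / 4 := Real.sin_le (by positivity)
  have h5 : -(κ / 4) * ‖t‖ ≤ t.re := le_trans (by nlinarith) h3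
  have h6 := Complex.norm_le_abs_re_add_abs_im t
  change M < 1 * t.re + κ * |t.im|
  have h7 : M < κ / 2 * ‖t‖ := by
    have : 2 * |M| / κ < ‖t‖ := by linarith
    rw [div_lt_iff₀ hκ0] at this
    have := le_abs_self M
    linarith
  rcases le_total 0 t.re with h | h
  · rw [abs_of_nonneg h] at h6
    nlinarith
  · rw [abs_of_nonpos h] at h6
    nlinarith

theorem mem_wedge_neg_one {M κ : ℝ} {t : ℂ} : t ∈ wedge (-1) M κ ↔ -t ∈ wedge 1 M κ := by
  simp [wedge]

/-- The filter of neighbourhoods of infinity in wedges. -/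
def wedgeFilter (ε κ : ℝ) : Filter ℂ := comap (fun t : ℂ => ε * t.re + κ * |t.im|) atTop

theorem eventually_wedgeFilter {ε κ : ℝ} {P : ℂ → Prop} :
    (∀ᶠ t in wedgeFilter ε κ, P t) ↔ ∃ M, ∀ t ∈ wedge ε M κ, P t := by
  rw [wedgeFilter, (atTop_basis_Ioi.comap _).eventually_iff]
  simp [wedge]

theorem eventually_mem_wedge (ε M κ : ℝ) : ∀ᶠ t in wedgeFilter ε κ, t ∈ wedge ε M κ :=
  eventually_wedgeFilter.2 ⟨M, fun _ ht => ht⟩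

theorem tendsto_norm_wedgeFilter {ε κ : ℝ} (hε : |ε| = 1) (hκ : κ ≤ 1) :
    Tendsto (fun t : ℂ => ‖t‖) (wedgeFilter ε κ) atTop := by
  refine tendsto_atTop.2 fun r => eventually_wedgeFilter.2 ⟨2 * r, fun t ht => ?_⟩
  have := lt_norm_of_mem_wedge hε hκ ht
  linarith

theorem tendsto_add_wedgeFilter {ε κ : ℝ} (hε : |ε| = 1) (hκ0 : 0 ≤ κ) (hκ : κ ≤ 1) (c : ℂ) :
    Tendsto (fun t : ℂ => t + c) (wedgeFilter ε κ) (wedgeFilter ε κ) := by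
  intro s hs
  obtain ⟨M, hM⟩ := eventually_wedgeFilter.1 (show ∀ᶠ t in wedgeFilter ε κ, t ∈ s from hs)
  exact eventually_wedgeFilter.2 ⟨M + 2 * ‖c‖, fun t ht => hM _ (add_mem_wedge hε hκ0 hκ c ht)⟩

theorem tendsto_ofReal_wedgeFilter (κ : ℝ) :
    Tendsto (fun x : ℝ => (x : ℂ)) atTop (wedgeFilter 1 κ) := by
  refine tendsto_comap_iff.2 (tendsto_id.congr fun x => ?_)
  simp

theorem isBigO_of_cobounded {E : Type*} [NormedAddCommGroup E] {V : ℂ → E} {φ : ℂ → ℝ} {D : Set ℂ} {ε M κ : ℝ}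
    (hε : |ε| = 1) (hκ : κ ≤ 1) (hD : wedge ε M κ ⊆ D)
    (h : V =O[Bornology.cobounded ℂ ⊓ 𝓟 D] φ) : V =O[wedgeFilter ε κ] φ := by
  refine h.mono (le_inf ?_ ?_)
  · rw [← comap_norm_atTop]
    exact (tendsto_norm_wedgeFilter hε hκ).le_comap
  · exact le_principal_iff.2 ((eventually_mem_wedge ε M κ).mono hD)

/-- A separatrix on a wedge. -/
structure IsWedgeSeparatrix (G : C2 → C2) (a : ℕ → C2) (ε M κ : ℝ) (V : ℂ → C2) : Prop where
  analytic : DifferentiableOn ℂ V (wedge ε M κ)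
  real : ∀ t ∈ wedge ε M κ, t.im = 0 → IsRealPoint (V t)
  equation : ∀ t ∈ wedge ε M κ, t + 1 ∈ wedge ε M κ → V (t + 1) = G (V t)
  expansion : ∀ N : ℕ, (fun t => V t - ∑ n ∈ Finset.Icc 1 N, (t⁻¹) ^ n • a n) =O[wedgeFilter ε κ]
    fun t => ‖t‖⁻¹ ^ (N + 1)

theorem IsSeparatrix.isWedgeSeparatrix {G : C2 → C2} {a : ℕ → C2} {D : Set ℂ} {V : ℂ → C2}
    (h : IsSeparatrix G a D V) {ε M κ : ℝ} (hε : |ε| = 1) (hκ : κ ≤ 1)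
    (hD : wedge ε M κ ⊆ D) : IsWedgeSeparatrix G a ε M κ V where
  analytic := fun t ht => (h.analytic t (hD ht)).differentiableAt.differentiableWithinAt
  real := fun t ht => h.real t (hD ht)
  equation := fun t ht ht1 => h.equation t (hD ht) (hD ht1)
  expansion := fun N => isBigO_of_cobounded hε hκ hD (h.expansion N)

/-- Two compatible pairs are defined on common wedges. -/
theorem exists_isWedgeSeparatrix {G F : C2 → C2} {Vp Vm Wp Wm : ℂ → C2}
    (hV : IsCompatiblePair G Vp Vm) (hW : IsCompatiblePair F Wp Wm) :
    ∃ (M κ : ℝ) (a b : ℕ → C2), 0 < M ∧ 0 < κ ∧ κ ≤ 1 ∧ a 1 ≠ 0 ∧ b 1 ≠ 0 ∧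
      IsWedgeSeparatrix G a 1 M κ Vp ∧ IsWedgeSeparatrix G a (-1) M κ Vm ∧
      IsWedgeSeparatrix F b 1 M κ Wp ∧ IsWedgeSeparatrix F b (-1) M κ Wm := by
  obtain ⟨R, δ, a, hR, hδ, ha, hVp, hVm⟩ := hV
  obtain ⟨R', δ', b, hR', hδ', hb, hWp, hWm⟩ := hW
  obtain ⟨κ₁, hκ₁, h₁⟩ := exists_wedge_subset_sectorPlus hδ
  obtain ⟨κ₂, hκ₂, h₂⟩ := exists_wedge_subset_sectorPlus hδ'
  set κ := min 1 (min κ₁ κ₂) with hκ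
  have hκ0 : 0 < κ := lt_min one_pos (lt_min hκ₁ hκ₂)
  have hκ1 : κ ≤ 1 := min_le_left _ _
  have s1 := h₁ κ hκ0 ((min_le_right _ _).trans (min_le_left _ _)) hκ1 R (2 * R + 2 * R') (by linarith) (by linarith)
  have s2 := h₂ κ hκ0 ((min_le_right _ _).trans (min_le_right _ _)) hκ1 R' (2 * R + 2 * R') (by linarith) (by linarith)
  refine ⟨2 * R + 2 * R', κ, a, b, by linarith, hκ0, hκ1, ha, hb, ?_, ?_, ?_, ?_⟩
  · exact hVp.isWedgeSeparatrix (by simp) hκ1 s1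
  · exact hVm.isWedgeSeparatrix (by simp) hκ1 fun t ht => s1 (mem_wedge_neg_one.1 ht)
  · exact hWp.isWedgeSeparatrix (by simp) hκ1 s2
  · exact hWm.isWedgeSeparatrix (by simp) hκ1 fun t ht => s2 (mem_wedge_neg_one.1 ht)

/-! ### Local estimates for analytic maps -/

section Taylor

variable {E F : Type*} [NormedAddCommGroup E] [NormedSpace ℂ E] [NormedAddCommGroup F]
  [NormedSpace ℂ F]

theorem exists_norm_sub_sub_fderiv_le {f : E → F} (hf : AnalyticAt ℂ f 0) :
    ∃ C r : ℝ, 0 ≤ C ∧ 0 < r ∧ ∀ z w : E, ‖z‖ < r → ‖w‖ < r →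
      ‖f z - f w - fderiv ℂ f 0 (z - w)‖ ≤ C * max ‖z‖ ‖w‖ * ‖z - w‖ := by
  obtain ⟨p, hp⟩ := hf
  obtain ⟨C, hC, h⟩ := hp.isBigO_image_sub_norm_mul_norm_sub.exists_nonneg
  rw [Asymptotics.isBigOWith_iff, Metric.eventually_nhds_iff] at h
  obtain ⟨r, hr, h⟩ := h
  refine ⟨C, r, hC, hr, fun z w hz hw => ?_⟩
  have h1 := h (y := (z, w)) (by
    rw [Prod.dist_eq, dist_zero_right, dist_zero_right]; exact max_lt hz hw)
  rw [hp.hasFDerivAt.fderiv]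
  simp only [Prod.mk_zero_zero, sub_zero, Prod.norm_mk, norm_mul, norm_norm] at h1
  rw [mul_assoc]
  rw [Real.norm_of_nonneg (le_max_of_le_left (norm_nonneg z))] at h1
  exact h1

/-- The quadratic part of a map at the origin. -/
def quadraticPart (f : E → F) (z : E) : F := (1 / 2 : ℂ) • fderiv ℂ (fderiv ℂ f) 0 z z

theorem quadraticPart_smul (f : E → F) (c : ℂ) (z : E) :
    quadraticPart f (c • z) = c ^ 2 • quadraticPart f z := by
  simp only [quadraticPart, map_smul, smul_apply, smul_smul]
  congr 1; ring

variable [CompleteSpace F]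

/-- The derivative is Lipschitz near 0, and the mean value inequality on the segment from w to z
gives an error quadratic in z - w. This is what makes a change of coordinates act linearly on
exponentially small differences. -/
theorem exists_norm_sub_sub_fderiv_le_sq [CompleteSpace E] {f : E → F} (hf : AnalyticAt ℂ f 0) :
    ∃ C r : ℝ, 0 ≤ C ∧ 0 < r ∧ (∀ z : E, ‖z‖ < r → DifferentiableAt ℂ f z) ∧
      ∀ z w : E, ‖z‖ < r → ‖w‖ < r →
      ‖f z - f w - fderiv ℂ f w (z - w)‖ ≤ C * ‖z - w‖ ^ 2 := by
  obtain ⟨C, r, hC, hr, h⟩ := exists_norm_sub_sub_fderiv_le hf.fderiv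
  have hev : ∀ᶠ z in 𝓝 (0 : E), DifferentiableAt ℂ f z :=
    hf.eventually_analyticAt.mono fun z hz => hz.differentiableAt
  obtain ⟨r', hr', hd⟩ := Metric.eventually_nhds_iff.1 hev
  set K := C * r + ‖fderiv ℂ (fderiv ℂ f) 0‖ with hK
  refine ⟨K, min r r', by positivity, lt_min hr hr', fun z hz => hd ?_, fun z w hz hw => ?_⟩
  · rw [dist_zero_right]; exact hz.trans_le (min_le_right _ _)
  have hball : ∀ u ∈ segment ℝ w z, ‖u‖ < min r r' := by
    intro u hu
    have := (convex_ball (0 : E) (min r r')).segment_subset (mem_ball_zero_iff.2 hw) (mem_ball_zero_iff.2 hz) hu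
    exact mem_ball_zero_iff.1 this
  have := Convex.norm_image_sub_le_of_norm_fderiv_le' (𝕜 := ℂ) (f := f) (C := K * ‖z - w‖) (s := segment ℝ w z)
    (x := w) (y := z) (φ := fderiv ℂ f w)
    (fun u hu => hd (by rw [dist_zero_right]; exact (hball u hu).trans_le (min_le_right _ _))) ?_
    (convex_segment w z) (left_mem_segment ℝ w z) (right_mem_segment ℝ w z)
  · calc _ ≤ _ := this
      _ = _ := by ring
  · intro u hu
    have h1 : ‖u‖ < r := (hball u hu).trans_le (min_le_left _ _)
    have h2 : ‖w‖ < r := hw.trans_le (min_le_left _ _)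
    have h3 := h u w h1 h2
    have h4 : ‖u - w‖ ≤ ‖z - w‖ := by
      obtain ⟨a, b, ha, hb, hab, rfl⟩ := hu
      have : a • w + b • z - w = b • (z - w) := by
        have : a = 1 - b := by linarith
        rw [this]; module
      rw [this, norm_smul, Real.norm_of_nonneg hb]
      exact mul_le_of_le_one_left (norm_nonneg _) (by linarith)
    have h5 := norm_sub_norm_le (fderiv ℂ f u - fderiv ℂ f w) (fderiv ℂ (fderiv ℂ f) 0 (u - w))
    have h6 := (fderiv ℂ (fderiv ℂ f) 0).le_opNorm (u - w)
    have h7 : C * max ‖u‖ ‖w‖ * ‖u - w‖ ≤ C * r * ‖u - w‖ := by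
      gcongr; exact (max_lt h1 h2).le
    calc _ ≤ K * ‖u - w‖ := by rw [hK]; linarith
      _ ≤ _ := by gcongr

/-- The mean value inequality is applied to f minus its linear and quadratic parts; by symmetry of
the second derivative its derivative at u is f'(u) - f'(0) - f''(0)u = O(‖u‖²). The factor ‖z - w‖
is essential for the linear difference equation below. -/
theorem exists_norm_remainder_sub_le {f : E → F} (hf : AnalyticAt ℂ f 0) :
    ∃ C r : ℝ, 0 ≤ C ∧ 0 < r ∧ ∀ z w : E, ‖z‖ < r → ‖w‖ < r →
      ‖f z - f w - fderiv ℂ f 0 (z - w) - (quadraticPart f z - quadraticPart f w)‖ ≤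
        C * max ‖z‖ ‖w‖ ^ 2 * ‖z - w‖ := by
  obtain ⟨C, r, hC, hr, h⟩ := exists_norm_sub_sub_fderiv_le hf.fderiv
  have hev : ∀ᶠ z in 𝓝 (0 : E), DifferentiableAt ℂ f z :=
    hf.eventually_analyticAt.mono fun z hz => hz.differentiableAt
  obtain ⟨r', hr', hd⟩ := Metric.eventually_nhds_iff.1 hev
  have hsymm : ∀ x y, fderiv ℂ (fderiv ℂ f) 0 x y = fderiv ℂ (fderiv ℂ f) 0 y x := by
    have h1 : IsSymmSndFDerivAt ℂ f 0 := (hf.contDiffAt (n := 2)).isSymmSndFDerivAt (by simp)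
    exact fun x y => h1.eq x y
  have hq : ∀ u : E, HasFDerivAt (quadraticPart f) (fderiv ℂ (fderiv ℂ f) 0 u) u := by
    intro u
    have h1 := ((fderiv ℂ (fderiv ℂ f) 0).hasFDerivAt (x := u)).clm_apply (hasFDerivAt_id u)
    refine (h1.const_smul (1 / 2 : ℂ)).congr_fderiv ?_
    ext v
    simp only [smul_apply, add_apply,
      ContinuousLinearMap.comp_apply, ContinuousLinearMap.flip_apply, ContinuousLinearMap.id_apply, id]
    rw [hsymm v u]
    module
  refine ⟨C, min r r', hC, lt_min hr hr', fun z w hz hw => ?_⟩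
  set ρ := max ‖z‖ ‖w‖ with hρ
  have hmem : ∀ u ∈ Metric.closedBall (0 : E) ρ, ‖u‖ ≤ ρ ∧ ‖u‖ < r ∧ ‖u‖ < r' := by
    intro u hu
    have h1 : ‖u‖ ≤ ρ := by simpa using hu
    have h2 : ρ < min r r' := max_lt hz hw
    exact ⟨h1, h1.trans_lt (h2.trans_le (min_le_left _ _)), h1.trans_lt (h2.trans_le (min_le_right _ _))⟩
  have key := Convex.norm_image_sub_le_of_norm_hasFDerivWithin_le (𝕜 := ℂ)
    (f := fun u => f u - fderiv ℂ f 0 u - quadraticPart f u)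
    (f' := fun u => fderiv ℂ f u - fderiv ℂ f 0 - fderiv ℂ (fderiv ℂ f) 0 u)
    (C := C * ρ ^ 2) (s := Metric.closedBall (0 : E) ρ) (x := w) (y := z) ?_ ?_ (convex_closedBall _ _)
    (by simp [hρ]) (by simp [hρ])
  · convert key using 2
    rw [map_sub]; abel
  · intro u hu
    have h1 := hmem u hu
    refine (HasFDerivAt.sub (HasFDerivAt.sub (hd ?_).hasFDerivAt (fderiv ℂ f 0).hasFDerivAt) (hq u)).hasFDerivWithinAt
    rw [dist_zero_right]; exact h1.2.2
  · intro u hu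
    have h1 := hmem u hu
    have h2 := h u 0 h1.2.1 (by simpa using hr)
    simp only [sub_zero, norm_zero] at h2
    rw [max_eq_left (norm_nonneg u)] at h2
    calc _ ≤ _ := h2
      _ ≤ C * ρ * ρ := by gcongr <;> exact h1.1
      _ = _ := by ring

theorem isBigO_sub_quadraticPart {f : E → F} (hf : AnalyticAt ℂ f 0) (h0 : f 0 = 0) :
    (fun z => f z - fderiv ℂ f 0 z - quadraticPart f z) =O[𝓝 0] fun z => ‖z‖ ^ 3 := by
  obtain ⟨C, r, hC, hr, h⟩ := exists_norm_remainder_sub_le hf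
  refine Asymptotics.IsBigO.of_bound C ?_
  filter_upwards [Metric.ball_mem_nhds (0 : E) hr] with z hz
  have h1 := h z 0 (by simpa using hz) (by simpa using hr)
  have hq0 : quadraticPart f 0 = 0 := by simp [quadraticPart]
  rw [h0, hq0] at h1
  simp only [sub_zero, norm_zero] at h1
  rw [max_eq_left (norm_nonneg z)] at h1
  rw [norm_pow, norm_norm]
  calc _ ≤ _ := h1
    _ = _ := by ring

end Taylor

/-! ### Normal coordinates at the 1:3 resonance -/

/-- The iterate F = f^[3] commutes with f and is tangent to the identity because L³ = 1. Up to third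
order F(f w) = f w + q(L w) and f(F w) = f w + L(q w); the second-order terms of f cancel, and a
quadratic form of third order is zero. -/
theorem quadraticPart_equivariant {f : C2 → C2} (hf : AnalyticAt ℂ f 0) (h0 : f 0 = 0)
    (hL : fderiv ℂ f 0 ^ 3 = 1) (z : C2) :
    quadraticPart f^[3] (fderiv ℂ f 0 z) = fderiv ℂ f 0 (quadraticPart f^[3] z) := by
  set L := fderiv ℂ f 0 with hLdef
  set q := quadraticPart f^[3] with hq
  have hF : AnalyticAt ℂ f^[3] 0 := by
    have h1 : AnalyticAt ℂ (f ∘ f) 0 := AnalyticAt.comp (by rwa [h0]) hf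
    have h2 : AnalyticAt ℂ ((f ∘ f) ∘ f) 0 := AnalyticAt.comp (by rwa [h0]) hf
    exact h2
  have hF0 : f^[3] 0 = 0 := by simp [h0]
  have hFd : fderiv ℂ f^[3] 0 = 1 := by
    rw [← hL]
    exact (hf.differentiableAt.hasFDerivAt.iterate h0 3).fderiv
  have hFO := isBigO_sub_quadraticPart hF hF0
  rw [hFd] at hFO
  simp only [one_apply_eq_self] at hFO
  have hfO : (fun w => f w - L w) =O[𝓝 0] fun w => ‖w‖ ^ 2 := by
    obtain ⟨C, r, hC, hr, h⟩ := exists_norm_sub_sub_fderiv_le hf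
    refine Asymptotics.IsBigO.of_bound C ?_
    filter_upwards [Metric.ball_mem_nhds (0 : C2) hr] with w hw
    have h1 := h w 0 (by simpa using hw) (by simpa using hr)
    rw [h0] at h1
    simp only [sub_zero, norm_zero] at h1
    rw [max_eq_left (norm_nonneg w)] at h1
    rw [norm_pow, norm_norm]
    calc _ ≤ _ := h1
      _ = _ := by ring
  have hid : (fun w : C2 => w) =O[𝓝 0] fun w => ‖w‖ := Asymptotics.isBigO_norm_right.2 (Asymptotics.isBigO_refl _ _)
  have hf1 : f =O[𝓝 0] fun w : C2 => ‖w‖ := by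
    have := hf.differentiableAt.isBigO_sub
    simpa [h0] using Asymptotics.isBigO_norm_right.2 this
  have hft : Tendsto f (𝓝 0) (𝓝 0) := by simpa [h0] using hf.continuousAt.tendsto
  have hFt : Tendsto f^[3] (𝓝 0) (𝓝 0) := by simpa [hF0] using hF.continuousAt.tendsto
  have hqO : q =O[𝓝 0] fun w => ‖w‖ ^ 2 := by
    refine Asymptotics.IsBigO.of_bound (‖(1 / 2 : ℂ)‖ * ‖fderiv ℂ (fderiv ℂ f^[3]) 0‖) (Eventually.of_forall fun w => ?_)
    simp only [hq, quadraticPart]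
    rw [norm_smul, norm_pow, norm_norm, mul_assoc]
    gcongr
    have := (fderiv ℂ (fderiv ℂ f^[3]) 0).le_opNorm₂ w w
    calc _ ≤ _ := this
      _ = _ := by ring
  -- `q` is Lipschitz with small constants
  have hqL : (fun w => q (f w) - q (L w)) =O[𝓝 0] fun w => ‖w‖ ^ 3 := by
    have hsum : (fun w => f w + L w) =O[𝓝 0] fun w => ‖w‖ :=
      hf1.add (Asymptotics.isBigO_norm_right.2 (L.isBigO_id _))
    set B := fderiv ℂ (fderiv ℂ f^[3]) 0 with hB
    have hsymm : ∀ x y, B x y = B y x := by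
      have h1 : IsSymmSndFDerivAt ℂ f^[3] 0 := (hF.contDiffAt (n := 2)).isSymmSndFDerivAt (by simp)
      exact fun x y => h1.eq x y
    have e : ∀ w, q (f w) - q (L w) = (1 / 2 : ℂ) • B (f w - L w) (f w + L w) := by
      intro w
      simp only [hq, quadraticPart, ← hB]
      rw [← smul_sub, map_sub, map_add, sub_apply, sub_apply,
        hsymm (L w) (f w)]
      congr 1; abel
    simp only [e]
    have hb : (fun w => (1 / 2 : ℂ) • B (f w - L w) (f w + L w)) =O[𝓝 0]
        fun w => ‖f w - L w‖ * ‖f w + L w‖ :=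
      Asymptotics.IsBigO.of_bound (‖(1 / 2 : ℂ)‖ * ‖B‖) (Eventually.of_forall fun w => by
        rw [norm_smul, norm_mul, norm_norm, norm_norm, mul_assoc, ← mul_assoc ‖B‖]
        exact mul_le_mul_of_nonneg_left (B.le_opNorm₂ _ _) (norm_nonneg _))
    refine hb.trans ?_
    have := hfO.norm_left.mul hsum.norm_left
    refine this.congr_right fun w => by ring
  have hA : (fun w => f^[3] (f w) - f w - q (f w)) =O[𝓝 0] fun w => ‖w‖ ^ 3 :=
    (hFO.comp_tendsto hft).trans (hf1.norm_left.pow 3)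
  have hC : (fun w => f (f^[3] w) - f w - L (f^[3] w - w)) =O[𝓝 0] fun w => ‖w‖ ^ 3 := by
    obtain ⟨C, r, hC, hr, h⟩ := exists_norm_sub_sub_fderiv_le hf
    have h1 : (fun w => f (f^[3] w) - f w - L (f^[3] w - w)) =O[𝓝 0]
        fun w => max ‖f^[3] w‖ ‖w‖ * ‖f^[3] w - w‖ := by
      refine Asymptotics.IsBigO.of_bound C ?_
      filter_upwards [Metric.ball_mem_nhds (0 : C2) hr, hFt (Metric.ball_mem_nhds (0 : C2) hr)] with w hw hw'
      have h2 := h (f^[3] w) w (by simpa using hw') (by simpa using hw)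
      rw [norm_mul, norm_norm, Real.norm_of_nonneg (le_max_of_le_right (norm_nonneg _)), ← mul_assoc]
      exact h2
    have h3 : (fun w => f^[3] w - w) =O[𝓝 0] fun w => ‖w‖ ^ 2 := by
      have h4 : (fun w : C2 => ‖w‖ ^ 3) =O[𝓝 0] fun w => ‖w‖ ^ 2 := by
        refine Asymptotics.IsBigO.of_bound 1 ?_
        filter_upwards [Metric.ball_mem_nhds (0 : C2) one_pos] with w hw
        have hw : ‖w‖ < 1 := by simpa using hw
        rw [norm_pow, norm_pow, norm_norm, one_mul]
        exact pow_le_pow_of_le_one (norm_nonneg _) hw.le (by norm_num)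
      have := (hFO.trans h4).add hqO
      refine this.congr_left fun w => by abel
    have hF1 : f^[3] =O[𝓝 0] fun w : C2 => ‖w‖ := by
      have := hF.differentiableAt.isBigO_sub
      simp only [hF0, sub_zero] at this
      exact Asymptotics.isBigO_norm_right.2 this
    have hmax : (fun w => max ‖f^[3] w‖ ‖w‖) =O[𝓝 0] fun w : C2 => ‖w‖ := by
      have h5 : (fun w => max ‖f^[3] w‖ ‖w‖) =O[𝓝 0] fun w : C2 => ‖f^[3] w‖ + ‖w‖ := by
        refine Asymptotics.IsBigO.of_bound 1 (Eventually.of_forall fun w => ?_)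
        rw [one_mul, Real.norm_of_nonneg (le_max_of_le_right (norm_nonneg _)), Real.norm_of_nonneg (by positivity)]
        exact max_le (by linarith [norm_nonneg w]) (by linarith [norm_nonneg (f^[3] w)])
      exact h5.trans (hF1.norm_left.add hid.norm_left)
    refine h1.trans ((hmax.mul h3.norm_left).congr_right fun w => by ring)
  have hD : (fun w => L (f^[3] w - w - q w)) =O[𝓝 0] fun w => ‖w‖ ^ 3 :=
    (L.isBigO_comp _ _).trans hFO
  have hfin : (fun w => q (L w) - L (q w)) =O[𝓝 0] fun w => ‖w‖ ^ 3 := by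
    refine (((hC.sub hA).sub hqL).add hD).congr_left fun w => ?_
    have : f^[3] (f w) = f (f^[3] w) := by rw [← Function.iterate_succ_apply, Function.iterate_succ_apply']
    rw [this, map_sub, map_sub, map_sub]
    abel
  -- a quadratic form of third order vanishes
  obtain ⟨K, hK⟩ := hfin.bound
  rw [← sub_eq_zero, ← norm_eq_zero]
  have hline : ∀ᶠ x : ℝ in 𝓝[>] 0, ‖q (L z) - L (q z)‖ ≤ K * ‖z‖ ^ 3 * x := by
    have ht : Tendsto (fun x : ℝ => ((x : ℂ) • z)) (𝓝[>] 0) (𝓝 0) := by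
      have : Tendsto (fun x : ℝ => ((x : ℂ) • z)) (𝓝 0) (𝓝 (((0 : ℝ) : ℂ) • z)) :=
        Continuous.tendsto (by fun_prop) 0
      simpa using this.mono_left nhdsWithin_le_nhds
    filter_upwards [ht.eventually hK, self_mem_nhdsWithin] with x hx hx0
    have hx0 : 0 < x := hx0
    rw [map_smul, hq, quadraticPart_smul, quadraticPart_smul, map_smul, ← smul_sub, norm_smul, norm_pow, norm_pow, norm_norm, norm_smul,
      Complex.norm_real, Real.norm_of_nonneg hx0.le] at hx
    have h2 : x ^ 2 * ‖q (L z) - L (q z)‖ ≤ x ^ 2 * (K * ‖z‖ ^ 3 * x) := by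
      calc _ ≤ _ := hx
        _ = _ := by ring
    exact le_of_mul_le_mul_left h2 (by positivity)
  have hlim : Tendsto (fun x : ℝ => K * ‖z‖ ^ 3 * x) (𝓝[>] 0) (𝓝 (K * ‖z‖ ^ 3 * 0)) :=
    (Continuous.tendsto (by fun_prop) 0).mono_left nhdsWithin_le_nhds
  have := ge_of_tendsto hlim hline
  rw [mul_zero] at this
  exact le_antisymm this (norm_nonneg _)

/-- The map `(ξ, η) ↦ (η², ξ²)`. -/
def swapSq (x : C2) : C2 := ![x 1 ^ 2, x 0 ^ 2]

/-- Coordinates in which the quadratic part of the third iterate is `(ξ, η) ↦ -(η², ξ²)`, and the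
classification of the directions of its separatrices. -/
theorem exists_normal_coordinates {f : C2 → C2} (hf : IsAreaPreservingMapAtResonance f) :
    fderiv ℂ f^[3] 0 = 1 ∧ ∀ b, b ≠ 0 → quadraticPart f^[3] b = -b → ∃ T : C2 ≃L[ℂ] C2, T b = ![1, 1] ∧
      (∀ z, T (quadraticPart f^[3] z) = -swapSq (T z)) ∧
      ∀ b', b' ≠ 0 → quadraticPart f^[3] b' = -b' → ∃ k < 3, b' = (fderiv ℂ f 0 ^ k) b := by
  have han := hf.analytic
  have h0 := hf.map_zero
  set L := fderiv ℂ f 0 with hLdef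
  set μ := Complex.exp (2 * Real.pi * Complex.I / 3) with hμ
  set ν := Complex.exp (-(2 * Real.pi * Complex.I / 3)) with hν
  have hμν : μ * ν = 1 := by rw [hμ, hν, ← Complex.exp_add]; simp
  have hprim : IsPrimitiveRoot μ 3 := by
    have := Complex.isPrimitiveRoot_exp 3 (by norm_num)
    simpa [hμ] using this
  have hμ3 : μ ^ 3 = 1 := hprim.pow_eq_one
  have hμ1 : μ ≠ 1 := hprim.ne_one (by norm_num)
  have hμ0 : μ ≠ 0 := Complex.exp_ne_zero _
  have hνμ : ν = μ ^ 2 := mul_left_cancel₀ hμ0 (by rw [hμν, ← hμ3]; ring)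
  have hμne : μ ≠ ν := by
    rw [hνμ]; intro h
    apply hμ1
    have : μ * 1 = μ * μ := by rw [mul_one, ← sq, ← h]
    exact (mul_left_cancel₀ hμ0 this).symm
  obtain ⟨Ep, hEp⟩ := hf.eigenvalue_pos.exists_hasEigenvector
  obtain ⟨Em, hEm⟩ := hf.eigenvalue_neg.exists_hasEigenvector
  have hLp : L Ep = μ • Ep := hEp.apply_eq_smul
  have hLm : L Em = ν • Em := hEm.apply_eq_smul
  -- independence of the eigenvectors
  have hsep : ∀ u v : C2, L u = μ • u → L v = ν • v → u + v = 0 → u = 0 ∧ v = 0 := by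
    intro u v hu hv huv
    have h1 : L (u + v) = 0 := by rw [huv, map_zero]
    rw [map_add, hu, hv] at h1
    have h2 : v = -u := (neg_eq_of_add_eq_zero_right huv).symm
    rw [h2, smul_neg, ← sub_eq_add_neg, ← sub_smul] at h1
    have h3 := (smul_eq_zero.1 h1).resolve_left (sub_ne_zero.2 hμne)
    exact ⟨h3, by rw [h2, h3, neg_zero]⟩
  have hbasis : ∀ u v : C2, L u = μ • u → L v = ν • v → u ≠ 0 → v ≠ 0 →
      ∃ A : C2 ≃L[ℂ] C2, ∀ x, A x = x 0 • u + x 1 • v := by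
    intro u v hu hv hu0 hv0
    set A : C2 →ₗ[ℂ] C2 := (LinearMap.proj 0).smulRight u + (LinearMap.proj 1).smulRight v with hA
    have hAx : ∀ x, A x = x 0 • u + x 1 • v := fun x => by simp [hA]
    have hinj : Function.Injective A := by
      rw [injective_iff_map_eq_zero]
      intro x hx
      rw [hAx] at hx
      have h1 := hsep (x 0 • u) (x 1 • v) (by rw [map_smul, hu, smul_comm]) (by rw [map_smul, hv, smul_comm]) hx
      ext i
      fin_cases i
      · exact (smul_eq_zero.1 h1.1).resolve_right hu0
      · exact (smul_eq_zero.1 h1.2).resolve_right hv0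
    exact ⟨(LinearEquiv.ofInjectiveEndo A hinj).toContinuousLinearEquiv, fun x => hAx x⟩
  obtain ⟨A0, hA0⟩ := hbasis Ep Em hLp hLm hEp.2 hEm.2
  have hdecomp : ∀ z : C2, ∃ u v : C2, L u = μ • u ∧ L v = ν • v ∧ z = u + v := by
    intro z
    refine ⟨(A0.symm z) 0 • Ep, (A0.symm z) 1 • Em, by rw [map_smul, hLp, smul_comm],
      by rw [map_smul, hLm, smul_comm], ?_⟩
    rw [← hA0, A0.apply_symm_apply]
  have hLpow : ∀ k : ℕ, ∀ u v : C2, L u = μ • u → L v = ν • v → (L ^ k) (u + v) = μ ^ k • u + ν ^ k • v := by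
    intro k u v hu hv
    induction k with
    | zero => simp
    | succ k ih =>
      rw [pow_succ', mul_apply_eq_comp, ih, map_add, map_smul, map_smul, hu, hv, smul_smul, smul_smul,
        pow_succ, pow_succ]
  have hν3 : ν ^ 3 = 1 := by rw [hνμ, ← pow_mul, mul_comm, pow_mul, hμ3, one_pow]
  have hL3 : L ^ 3 = 1 := by
    ext1 z
    obtain ⟨u, v, hu, hv, rfl⟩ := hdecomp z
    rw [hLpow 3 u v hu hv, hμ3, hν3]; simp
  have hF : AnalyticAt ℂ f^[3] 0 := by
    have h1 : AnalyticAt ℂ (f ∘ f) 0 := AnalyticAt.comp (by rwa [h0]) han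
    have h2 : AnalyticAt ℂ ((f ∘ f) ∘ f) 0 := AnalyticAt.comp (by rwa [h0]) han
    exact h2
  have hFd : fderiv ℂ f^[3] 0 = 1 := by
    rw [← hL3]
    exact (han.differentiableAt.hasFDerivAt.iterate h0 3).fderiv
  refine ⟨hFd, fun b hb hqb => ?_⟩
  set q := quadraticPart f^[3] with hq
  have heq : ∀ z, q (L z) = L (q z) := quadraticPart_equivariant han h0 hL3
  set B := fderiv ℂ (fderiv ℂ f^[3]) 0 with hB
  have hsymm : ∀ x y, B x y = B y x := by
    have h1 : IsSymmSndFDerivAt ℂ f^[3] 0 := (hF.contDiffAt (n := 2)).isSymmSndFDerivAt (by simp)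
    exact fun x y => h1.eq x y
  have hqB : ∀ z, q z = (1 / 2 : ℂ) • B z z := fun z => rfl
  have hqadd : ∀ u v, q (u + v) = q u + q v + B u v := by
    intro u v
    rw [hqB, hqB, hqB, map_add, map_add, add_apply, add_apply, hsymm v u]
    module
  -- the action of `q` on eigenvectors
  have hqu : ∀ u, L u = μ • u → L (q u) = ν • q u := by
    intro u hu
    rw [← heq, hu, hq, quadraticPart_smul, hνμ]
  have hqv : ∀ v, L v = ν • v → L (q v) = μ • q v := by
    intro v hv
    rw [← heq, hv, hq, quadraticPart_smul]
    congr 1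
    rw [hνμ, ← pow_mul]
    calc μ ^ (2 * 2) = μ ^ 3 * μ := by ring
      _ = μ := by rw [hμ3, one_mul]
  -- Since μν = 1, equivariance makes B(u, v) a fixed vector of L, and 1 is not an eigenvalue. So
  -- only the squares ξ² and η² survive in q.
  have hBuv : ∀ u v, L u = μ • u → L v = ν • v → B u v = 0 := by
    intro u v hu hv
    have h1 : L (B u v) = B u v := by
      have h2 := heq (u + v)
      rw [map_add, hqadd, hqadd, map_add, map_add, ← heq, ← heq] at h2
      have h3 := add_left_cancel h2
      rw [← h3, hu, hv, map_smul, map_smul, smul_apply, smul_smul, mul_comm, hμν, one_smul]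
    obtain ⟨x, y, hx, hy, hxy⟩ := hdecomp (B u v)
    rw [hxy, map_add, hx, hy] at h1
    have h4 := hsep ((μ - 1) • x) ((ν - 1) • y) (by rw [map_smul, hx, smul_comm])
      (by rw [map_smul, hy, smul_comm]) (by rw [sub_smul, sub_smul, one_smul, one_smul, ← sub_eq_zero.2 h1]; abel)
    have hν1 : ν ≠ 1 := by
      intro h; rw [h, mul_one] at hμν; exact hμ1 hμν
    rw [hxy, (smul_eq_zero.1 h4.1).resolve_left (sub_ne_zero.2 hμ1),
      (smul_eq_zero.1 h4.2).resolve_left (sub_ne_zero.2 hν1), add_zero]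
  -- The form q exchanges the two eigenspaces, because μ² = ν and ν² = μ. The eigencomponents of q(u
  -- + v) = -(u + v) can be compared separately.
  have hsol : ∀ u v, L u = μ • u → L v = ν • v → q (u + v) = -(u + v) → q u = -v ∧ q v = -u := by
    intro u v hu hv h
    rw [hqadd, hBuv u v hu hv, add_zero] at h
    have := hsep (q v + u) (q u + v) (by rw [map_add, hqv v hv, hu, smul_add]) (by rw [map_add, hqu u hu, hv, smul_add])
      (by rw [show q v + u + (q u + v) = q u + q v + (u + v) by abel, h]; abel)
    exact ⟨eq_neg_of_add_eq_zero_left this.2, eq_neg_of_add_eq_zero_left this.1⟩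
  obtain ⟨u, v, hu, hv, rfl⟩ := hdecomp b
  obtain ⟨hquv, hqvu⟩ := hsol u v hu hv hqb
  have hq0 : q 0 = 0 := by simp [hq, quadraticPart]
  have hu0 : u ≠ 0 := by
    rintro rfl
    rw [hq0] at hquv
    apply hb
    rw [zero_add, ← neg_eq_zero, ← hquv]
  have hv0 : v ≠ 0 := by
    rintro rfl
    rw [hq0] at hqvu
    apply hb
    rw [add_zero, ← neg_eq_zero, ← hqvu]
  obtain ⟨A, hA⟩ := hbasis u v hu hv hu0 hv0
  have hqA : ∀ x, q (A x) = -A (swapSq x) := by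
    intro x
    rw [hA, hA, hqadd, hBuv _ _ (by rw [map_smul, hu, smul_comm]) (by rw [map_smul, hv, smul_comm]), hq,
      quadraticPart_smul, quadraticPart_smul, ← hq, hquv, hqvu]
    simp only [swapSq, Matrix.cons_val_zero, Matrix.cons_val_one]
    module
  refine ⟨A.symm, ?_, ?_, ?_⟩
  · rw [ContinuousLinearEquiv.symm_apply_eq, hA]; simp
  · intro z
    obtain ⟨x, rfl⟩ := A.surjective z
    rw [hqA, map_neg, A.symm_apply_apply, A.symm_apply_apply]
  · intro b' hb' hqb'
    obtain ⟨x, rfl⟩ := A.surjective b'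
    rw [hqA, neg_inj] at hqb'
    have hx := A.injective hqb'
    have hx0 : x 1 ^ 2 = x 0 := congrFun hx 0
    have hx1 : x 0 ^ 2 = x 1 := congrFun hx 1
    have hx00 : x 0 ≠ 0 := by
      intro h
      apply hb'
      have h1 : x 1 = 0 := by rw [← hx1, h]; ring
      rw [hA, h, h1]; simp
    -- From ξ = η² and η = ξ² follows ξ = ξ⁴. The three cube roots of unity correspond to b, L b and
    -- L² b.
    have hcube : x 0 ^ 3 = 1 := by
      have : x 0 * x 0 ^ 3 = x 0 * 1 := by rw [mul_one]; nth_rewrite 3 [← hx0]; rw [← hx1]; ring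
      exact mul_left_cancel₀ hx00 this
    obtain ⟨k, hk, hkx⟩ := hprim.eq_pow_of_pow_eq_one hcube
    refine ⟨k, hk, ?_⟩
    rw [hA, hLpow k u v hu hv, ← hx1, ← hkx, hνμ]
    congr 2
    rw [← pow_mul, ← pow_mul, mul_comm]

open Asymptotics

/-! ### Expansions to second order -/

/-- `X t = t⁻¹ b + t⁻² x + O(t⁻³)` along a filter. -/
def HasTwoTerms (l : Filter ℂ) (X : ℂ → C2) (b x : C2) : Prop :=
  (fun t => X t - (t⁻¹ • b + t⁻¹ ^ 2 • x)) =O[l] fun t => ‖t‖⁻¹ ^ 3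

theorem IsWedgeSeparatrix.hasTwoTerms {G : C2 → C2} {a : ℕ → C2} {ε M κ : ℝ} {V : ℂ → C2}
    (h : IsWedgeSeparatrix G a ε M κ V) : HasTwoTerms (wedgeFilter ε κ) V (a 1) (a 2) := by
  have := h.expansion 2
  simpa [HasTwoTerms, Finset.sum_Icc_succ_top] using this

theorem isBigO_smul_inv_pow {ε κ : ℝ} (n : ℕ) (v : C2) :
    (fun t : ℂ => t⁻¹ ^ n • v) =O[wedgeFilter ε κ] fun t => ‖t‖⁻¹ ^ n := by
  refine IsBigO.of_bound ‖v‖ (Eventually.of_forall fun t => ?_)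
  rw [norm_smul, norm_pow, norm_inv, norm_pow, norm_inv, norm_norm, mul_comm]

theorem quadraticPart_isBigO {ε κ : ℝ} (f : C2 → C2) {X Y : ℂ → C2}
    (hXY : (fun t => X t - Y t) =O[wedgeFilter ε κ] fun t => ‖t‖⁻¹ ^ 2)
    (hX : X =O[wedgeFilter ε κ] fun t => ‖t‖⁻¹) (hY : Y =O[wedgeFilter ε κ] fun t => ‖t‖⁻¹) :
    (fun t => quadraticPart f (X t) - quadraticPart f (Y t)) =O[wedgeFilter ε κ] fun t => ‖t‖⁻¹ ^ 3 := by
  set B := fderiv ℂ (fderiv ℂ f) 0 with hB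
  have hmul : ∀ P Q : ℂ → C2, (fun t => (1 / 2 : ℂ) • B (P t) (Q t)) =O[wedgeFilter ε κ] fun t => ‖P t‖ * ‖Q t‖ := by
    intro P Q
    refine IsBigO.of_bound (‖(1 / 2 : ℂ)‖ * ‖B‖) (Eventually.of_forall fun t => ?_)
    rw [norm_smul, norm_mul, norm_norm, norm_norm, mul_assoc, ← mul_assoc ‖B‖]
    exact mul_le_mul_of_nonneg_left (B.le_opNorm₂ _ _) (norm_nonneg _)
  have h1 := ((hmul _ X).trans (hXY.norm_left.mul hX.norm_left))
  have h2 := ((hmul Y _).trans (hY.norm_left.mul hXY.norm_left))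
  refine ((h1.congr_right fun t => by ring).add (h2.congr_right fun t => by ring)).congr_left fun t => ?_
  simp only [quadraticPart, ← hB, map_sub, sub_apply]
  module

theorem eventually_le_norm_wedgeFilter {ε κ : ℝ} (hε : |ε| = 1) (hκ : κ ≤ 1) (r : ℝ) : ∀ᶠ t in wedgeFilter ε κ, r ≤ ‖t‖ :=
  (tendsto_norm_wedgeFilter hε hκ).eventually (eventually_ge_atTop r)

theorem isBigO_inv_pow_wedgeFilter {ε κ : ℝ} (hε : |ε| = 1) (hκ : κ ≤ 1) {m n : ℕ} (h : m ≤ n) :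
    (fun t : ℂ => ‖t‖⁻¹ ^ n) =O[wedgeFilter ε κ] fun t => ‖t‖⁻¹ ^ m := by
  refine IsBigO.of_bound 1 ((eventually_le_norm_wedgeFilter hε hκ 1).mono fun t ht => ?_)
  rw [one_mul, norm_pow, norm_pow, norm_inv, norm_norm]
  exact pow_le_pow_of_le_one (by positivity) (inv_le_one_of_one_le₀ ht) h

theorem tendsto_inv_pow_wedgeFilter {ε κ : ℝ} (hε : |ε| = 1) (hκ : κ ≤ 1) {n : ℕ} (hn : n ≠ 0) :
    Tendsto (fun t : ℂ => ‖t‖⁻¹ ^ n) (wedgeFilter ε κ) (𝓝 0) := by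
  have := ((tendsto_inv_atTop_zero.comp (tendsto_norm_wedgeFilter hε hκ)).pow n)
  simpa [hn] using this

theorem isBigO_inv_add_wedgeFilter {ε κ : ℝ} (hε : |ε| = 1) (hκ : κ ≤ 1) (c : ℂ) :
    (fun t : ℂ => ‖t + c‖⁻¹) =O[wedgeFilter ε κ] fun t => ‖t‖⁻¹ := by
  refine IsBigO.of_bound 2 ((eventually_le_norm_wedgeFilter hε hκ (2 * ‖c‖ + 1)).mono fun t ht => ?_)
  have h1 : ‖t‖ ≤ ‖t + c‖ + ‖c‖ := by simpa using norm_sub_le (t + c) c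
  have h2 := norm_nonneg c
  rw [norm_inv, norm_inv, norm_norm, norm_norm, ← div_eq_mul_inv, ← one_div]
  rw [div_le_div_iff₀ (by linarith) (by linarith)]
  linarith

theorem HasTwoTerms.isBigO_sub {ε κ : ℝ} (hε : |ε| = 1) (hκ : κ ≤ 1) {X : ℂ → C2} {b x : C2} (h : HasTwoTerms (wedgeFilter ε κ) X b x) :
    (fun t => X t - t⁻¹ • b) =O[wedgeFilter ε κ] fun t => ‖t‖⁻¹ ^ 2 := by
  refine ((IsBigO.trans h (isBigO_inv_pow_wedgeFilter hε hκ (by norm_num))).add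
    (isBigO_smul_inv_pow 2 x)).congr_left fun t => by abel

theorem HasTwoTerms.isBigO {ε κ : ℝ} (hε : |ε| = 1) (hκ : κ ≤ 1) {X : ℂ → C2} {b x : C2} (h : HasTwoTerms (wedgeFilter ε κ) X b x) :
    X =O[wedgeFilter ε κ] fun t => ‖t‖⁻¹ := by
  have h1 := (h.isBigO_sub hε hκ).trans (isBigO_inv_pow_wedgeFilter hε hκ (show 1 ≤ 2 by norm_num))
  have h2 := isBigO_smul_inv_pow (ε := ε) (κ := κ) 1 b
  simp only [pow_one] at h1 h2
  exact (h1.add h2).congr_left fun t => by abel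

theorem HasTwoTerms.tendsto {ε κ : ℝ} (hε : |ε| = 1) (hκ : κ ≤ 1) {X : ℂ → C2} {b x : C2} (h : HasTwoTerms (wedgeFilter ε κ) X b x) :
    Tendsto X (wedgeFilter ε κ) (𝓝 0) := by
  have := tendsto_inv_pow_wedgeFilter (κ := κ) hε hκ (one_ne_zero)
  simp only [pow_one] at this
  exact (h.isBigO hε hκ).trans_tendsto this

/-- Because (t + c)⁻¹ = t⁻¹ - c t⁻² + O(t⁻³), a time shift moves the second coefficient along the
leading one and changes nothing else at this order. This is the freedom that produces the shift in
the theorem. -/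
theorem HasTwoTerms.comp_add {ε κ : ℝ} (hε : |ε| = 1) (hκ : κ ≤ 1) (hκ0 : 0 ≤ κ) {X : ℂ → C2} {b x : C2}
    (h : HasTwoTerms (wedgeFilter ε κ) X b x) (c : ℂ) :
    HasTwoTerms (wedgeFilter ε κ) (fun t => X (t + c)) b (x - c • b) := by
  have hs := isBigO_inv_add_wedgeFilter (κ := κ) hε hκ c
  have hid : (fun t : ℂ => t⁻¹) =O[wedgeFilter ε κ] fun t => ‖t‖⁻¹ :=
    IsBigO.of_bound 1 (Eventually.of_forall fun t => by simp)
  have hs' : (fun t : ℂ => (t + c)⁻¹) =O[wedgeFilter ε κ] fun t => ‖t‖⁻¹ :=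
    (IsBigO.of_bound 1 (Eventually.of_forall fun t => by simp)).trans hs
  have hne : ∀ᶠ t in wedgeFilter ε κ, t ≠ 0 ∧ t + c ≠ 0 := by
    filter_upwards [eventually_le_norm_wedgeFilter hε hκ (‖c‖ + 1)] with t ht
    have h1 := norm_nonneg c
    refine ⟨norm_pos_iff.1 (by linarith), fun h0 => ?_⟩
    have h2 : ‖t‖ ≤ ‖t + c‖ + ‖c‖ := by simpa using norm_sub_le (t + c) c
    rw [h0, norm_zero] at h2
    linarith
  have h1 : (fun t => X (t + c) - ((t + c)⁻¹ • b + (t + c)⁻¹ ^ 2 • x)) =O[wedgeFilter ε κ] fun t => ‖t‖⁻¹ ^ 3 :=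
    (IsBigO.comp_tendsto h (tendsto_add_wedgeFilter hε hκ0 hκ c)).trans (hs.pow 3)
  have h2 : (fun t : ℂ => (t + c)⁻¹ - t⁻¹ + c * t⁻¹ ^ 2) =O[wedgeFilter ε κ] fun t => ‖t‖⁻¹ ^ 3 := by
    have : (fun t : ℂ => c ^ 2 * (t⁻¹ ^ 2 * (t + c)⁻¹)) =O[wedgeFilter ε κ] fun t => ‖t‖⁻¹ ^ 3 :=
      (((hid.pow 2).mul hs').congr_right fun t => by ring).const_mul_left _
    refine this.congr' (hne.mono fun t ht => ?_) EventuallyEq.rfl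
    have := ht.1
    have := ht.2
    field_simp
    ring
  have h3 : (fun t : ℂ => (t + c)⁻¹ ^ 2 - t⁻¹ ^ 2) =O[wedgeFilter ε κ] fun t => ‖t‖⁻¹ ^ 3 := by
    have : (fun t : ℂ => -c * (((t + c)⁻¹ * t⁻¹) * ((t + c)⁻¹ + t⁻¹))) =O[wedgeFilter ε κ] fun t => ‖t‖⁻¹ ^ 3 :=
      (((hs'.mul hid).mul (hs'.add hid)).congr_right fun t => by ring).const_mul_left _
    refine this.congr' (hne.mono fun t ht => ?_) EventuallyEq.rfl
    have := ht.1
    have := ht.2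
    field_simp
    ring
  have hv : ∀ (φ : ℂ → ℂ) (v : C2), φ =O[wedgeFilter ε κ] (fun t => ‖t‖⁻¹ ^ 3) →
      (fun t => φ t • v) =O[wedgeFilter ε κ] fun t => ‖t‖⁻¹ ^ 3 := by
    intro φ v hφ
    refine (IsBigO.trans (IsBigO.of_bound ‖v‖ (Eventually.of_forall fun t => ?_)) hφ)
    rw [norm_smul, mul_comm]
  refine ((h1.add (hv _ b h2)).add (hv _ x h3)).congr_left fun t => ?_
  module

theorem HasTwoTerms.comp_analytic {ε κ : ℝ} (hε : |ε| = 1) (hκ : κ ≤ 1) {X : ℂ → C2} {b x : C2} (h : HasTwoTerms (wedgeFilter ε κ) X b x)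
    {f : C2 → C2} (hf : AnalyticAt ℂ f 0) (h0 : f 0 = 0) :
    HasTwoTerms (wedgeFilter ε κ) (fun t => f (X t)) (fderiv ℂ f 0 b)
      (fderiv ℂ f 0 x + quadraticPart f b) := by
  have hX := h.isBigO hε hκ
  have h1 : (fun t => f (X t) - fderiv ℂ f 0 (X t) - quadraticPart f (X t)) =O[wedgeFilter ε κ]
      fun t => ‖t‖⁻¹ ^ 3 :=
    ((isBigO_sub_quadraticPart hf h0).comp_tendsto (h.tendsto hε hκ)).trans (hX.norm_left.pow 3)
  have hb : (fun t : ℂ => t⁻¹ • b) =O[wedgeFilter ε κ] fun t => ‖t‖⁻¹ := by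
    simpa using isBigO_smul_inv_pow (ε := ε) (κ := κ) 1 b
  have h2 := quadraticPart_isBigO f (h.isBigO_sub hε hκ) hX hb
  have h3 := ((fderiv ℂ f 0).isBigO_comp _ _).trans h
  refine ((h1.add h2).add h3).congr_left fun t => ?_
  simp only [quadraticPart_smul, map_sub, map_add, map_smul]
  module


theorem eq_zero_of_isBigO_inv_pow {κ : ℝ} {n : ℕ} {v : C2}
    (h : (fun t : ℂ => t⁻¹ ^ n • v) =O[wedgeFilter 1 κ] fun t => ‖t‖⁻¹ ^ (n + 1)) : v = 0 := by
  obtain ⟨C, hC⟩ := (h.comp_tendsto (tendsto_ofReal_wedgeFilter κ)).bound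
  have h1 : ∀ᶠ x : ℝ in atTop, ‖v‖ ≤ C * x⁻¹ := by
    filter_upwards [hC, eventually_gt_atTop 0] with x hx hx0
    simp only [Function.comp, norm_smul, norm_pow, norm_inv, Complex.norm_real,
      Real.norm_of_nonneg hx0.le] at hx
    rw [pow_succ, mul_comm (x⁻¹ ^ n) x⁻¹, ← mul_assoc, mul_comm (x⁻¹ ^ n)] at hx
    exact le_of_mul_le_mul_right hx (by positivity)
  have h2 := ge_of_tendsto (tendsto_inv_atTop_zero.const_mul C) h1
  rw [mul_zero] at h2
  exact norm_le_zero_iff.1 h2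

theorem HasTwoTerms.second_unique {κ : ℝ} {X : ℂ → C2} {b x y : C2}
    (h : HasTwoTerms (wedgeFilter 1 κ) X b x) (h' : HasTwoTerms (wedgeFilter 1 κ) X b y) : x = y := by
  rw [← sub_eq_zero]
  refine eq_zero_of_isBigO_inv_pow (κ := κ) (n := 2) ((h'.sub h).congr_left fun t => ?_)
  module

/-- The leading coefficient of a separatrix. -/
theorem quadraticPart_leading {κ : ℝ} (hκ0 : 0 ≤ κ) (hκ : κ ≤ 1) {F : C2 → C2} (hF : AnalyticAt ℂ F 0)
    (hF0 : F 0 = 0) (hFd : fderiv ℂ F 0 = 1) {X : ℂ → C2} {b x : C2}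
    (h : HasTwoTerms (wedgeFilter 1 κ) X b x) (heq : ∀ᶠ t in wedgeFilter 1 κ, X (t + 1) = F (X t)) :
    quadraticPart F b = -b := by
  have h1 := h.comp_analytic (by simp) hκ hF hF0
  have h2 := h.comp_add (by simp) hκ hκ0 1
  rw [hFd] at h1
  simp only [one_apply_eq_self] at h1
  have h3 : HasTwoTerms (wedgeFilter 1 κ) (fun t => F (X t)) b (x - (1 : ℂ) • b) :=
    h2.congr' (heq.mono fun t ht => by simp only [ht]) EventuallyEq.rfl
  have h4 := h1.second_unique h3
  rw [one_smul, sub_eq_add_neg] at h4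
  -- At order t⁻² the equation reads x + q(b) = x - b.
  exact add_left_cancel h4

/-! ### Reality of the first two coefficients -/

theorem isClosed_isRealPoint : IsClosed {z : C2 | IsRealPoint z} := by
  simp only [IsRealPoint, Set.ofPred_forall]
  exact isClosed_iInter fun i => isClosed_eq (by fun_prop) continuous_const

theorem IsRealPoint.sub {z w : C2} (hz : IsRealPoint z) (hw : IsRealPoint w) : IsRealPoint (z - w) := by
  intro i; simp [hz i, hw i]

theorem IsRealPoint.smul {z : C2} (hz : IsRealPoint z) (r : ℝ) : IsRealPoint ((r : ℂ) • z) := by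
  intro i; simp [hz i]

/-- Each coefficient is the limit along the positive axis of rⁿ times what remains after removing
the previous term, and the real points form a closed set. -/
theorem HasTwoTerms.isRealPoint {κ : ℝ} (hκ : κ ≤ 1) {X : ℂ → C2} {b x : C2}
    (h : HasTwoTerms (wedgeFilter 1 κ) X b x)
    (hX : ∀ᶠ r : ℝ in atTop, IsRealPoint (X r)) : IsRealPoint b ∧ IsRealPoint x := by
  have hmain : ∀ (n : ℕ) (Y : ℂ → C2) (v : C2),
      (fun t => Y t - t⁻¹ ^ n • v) =O[wedgeFilter 1 κ] (fun t => ‖t‖⁻¹ ^ (n + 1)) →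
      (∀ᶠ r : ℝ in atTop, IsRealPoint (Y r)) → IsRealPoint v := by
    intro n Y v hY hreal
    have h1 : Tendsto (fun r : ℝ => ((r ^ n : ℝ) : ℂ) • Y r) atTop (𝓝 v) := by
      rw [tendsto_iff_norm_sub_tendsto_zero]
      obtain ⟨C, hC⟩ := (hY.comp_tendsto (tendsto_ofReal_wedgeFilter κ)).bound
      refine squeeze_zero' (Eventually.of_forall fun r => norm_nonneg _) ?_
        (by simpa using tendsto_inv_atTop_zero.const_mul C)
      filter_upwards [hC, eventually_gt_atTop 0] with r hr hr0
      simp only [Function.comp, norm_pow, norm_inv, Complex.norm_real, Real.norm_of_nonneg hr0.le] at hr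
      have hrC : (r : ℂ) ≠ 0 := by exact_mod_cast hr0.ne'
      have e : ((r ^ n : ℝ) : ℂ) • Y r - v = ((r ^ n : ℝ) : ℂ) • (Y r - (r : ℂ)⁻¹ ^ n • v) := by
        rw [smul_sub, smul_smul]
        push_cast
        rw [← mul_pow, mul_inv_cancel₀ hrC, one_pow, one_smul]
      rw [e, norm_smul, Complex.norm_real, Real.norm_of_nonneg (by positivity)]
      calc _ ≤ r ^ n * (C * r⁻¹ ^ (n + 1)) := by gcongr
        _ = C * r⁻¹ := by rw [pow_succ, inv_pow]; field_simp
    exact isClosed_isRealPoint.mem_of_tendsto h1 (hreal.mono fun r hr => hr.smul _)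
  have hb : IsRealPoint b := by
    refine hmain 1 X b ?_ hX
    simpa using h.isBigO_sub (by simp) hκ
  refine ⟨hb, hmain 2 (fun t => X t - t⁻¹ • b) x ?_ ?_⟩
  · exact IsBigO.congr_left h fun t => by abel
  · filter_upwards [hX] with r hr
    have := hr.sub (hb.smul r⁻¹)
    rwa [Complex.ofReal_inv] at this

/-! ### Uniqueness of separatrices -/

/-- The first hypothesis forbids decay faster than |t|^(-5/2) along horizontal steps in the
direction ε, while the second demands |t|⁻³; only zero meets both. -/
theorem eventually_eq_zero_of_le_shift {E : Type*} [NormedAddCommGroup E] {ε κ : ℝ} (hε : |ε| = 1)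
    {Δ : ℂ → E}
    (h1 : ∀ᶠ t in wedgeFilter ε κ, ‖Δ t‖ ≤ (1 + 5 / 2 * ‖t‖⁻¹) * ‖Δ (t + ε)‖)
    (h2 : Δ =O[wedgeFilter ε κ] fun t => ‖t‖⁻¹ ^ 3) : ∀ᶠ t in wedgeFilter ε κ, Δ t = 0 := by
  obtain ⟨C, hC⟩ := h2.bound
  obtain ⟨M, hM⟩ := eventually_wedgeFilter.1 (h1.and hC)
  have hε2 : ε * ε = 1 := by rw [← abs_mul_abs_self, hε, one_mul]
  have hshift : ∀ t ∈ wedge ε M κ, ∀ n : ℕ, t + (ε * n : ℝ) ∈ wedge ε M κ := by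
    intro t ht n
    refine add_real_mem_wedge ?_ ht
    rw [← mul_assoc, hε2, one_mul]; positivity
  have hre : ∀ (t : ℂ) (n : ℕ), ε * (t + (ε * n : ℝ)).re = ε * t.re + n := by
    intro t n
    rw [Complex.add_re, Complex.ofReal_re]
    linear_combination (n : ℝ) * hε2
  have hnorm : ∀ t : ℂ, ε * t.re ≤ ‖t‖ := by
    intro t
    calc ε * t.re ≤ |ε * t.re| := le_abs_self _
      _ = |t.re| := by rw [abs_mul, hε, one_mul]
      _ ≤ ‖t‖ := Complex.abs_re_le_norm t
  have hsucc : ∀ (t : ℂ) (n : ℕ), t + (ε * (n + 1 : ℕ) : ℝ) = t + (ε * n : ℝ) + ε := by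
    intro t n; push_cast; ring
  have hpos : ∀ t ∈ wedge ε M κ, 1 ≤ ε * t.re → Δ t = 0 := by
    intro t ht hy
    set y := ε * t.re with hy'
    -- The weight y⁵ goes with the square of the norm, which avoids the exponent 5/2. It makes the
    -- product nondecreasing because (z + 5/2)² z³ ≤ (z + 1)⁵.
    have step : ∀ n : ℕ, ‖Δ t‖ ^ 2 * y ^ 5 ≤ ‖Δ (t + (ε * n : ℝ))‖ ^ 2 * (y + n) ^ 5 := by
      intro n
      induction n with
      | zero => simp
      | succ n ih =>
        refine ih.trans ?_
        have h3 := (hM _ (hshift t ht n)).1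
        rw [← hsucc] at h3
        have h4 := hnorm (t + (ε * n : ℝ))
        rw [hre] at h4
        set z := y + n with hz
        have hz1 : 1 ≤ z := by
          have : (0:ℝ) ≤ n := n.cast_nonneg
          linarith
        have h5 : ‖t + (ε * n : ℝ)‖⁻¹ ≤ z⁻¹ := inv_anti₀ (by linarith) h4
        have h6 : ‖Δ (t + (ε * n : ℝ))‖ ≤ (1 + 5 / 2 * z⁻¹) * ‖Δ (t + (ε * (n + 1 : ℕ) : ℝ))‖ := h3.trans (by gcongr)
        calc _ ≤ ((1 + 5 / 2 * z⁻¹) * ‖Δ (t + (ε * (n + 1 : ℕ) : ℝ))‖) ^ 2 * z ^ 5 := by gcongr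
          _ = ‖Δ (t + (ε * (n + 1 : ℕ) : ℝ))‖ ^ 2 * ((z + 5 / 2) ^ 2 * z ^ 3) := by field_simp
          _ ≤ ‖Δ (t + (ε * (n + 1 : ℕ) : ℝ))‖ ^ 2 * (z + 1) ^ 5 := by
              gcongr
              nlinarith [pow_pos (by linarith : 0 < z) 3, pow_pos (by linarith : 0 < z) 2]
          _ = _ := by rw [hz]; push_cast; ring
    have hb : ∀ n : ℕ, ‖Δ t‖ ^ 2 * y ^ 5 ≤ C ^ 2 * (y + n)⁻¹ := by
      intro n
      refine (step n).trans ?_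
      have h3 := (hM _ (hshift t ht n)).2
      have h4 := hnorm (t + (ε * n : ℝ))
      rw [hre] at h4
      set z := y + n with hz
      have hz1 : 1 ≤ z := by
        have : (0:ℝ) ≤ n := n.cast_nonneg
        linarith
      have h5 : ‖t + (ε * n : ℝ)‖⁻¹ ≤ z⁻¹ := inv_anti₀ (by linarith) h4
      rw [norm_pow, norm_inv, norm_norm] at h3
      calc _ ≤ (C * ‖t + (ε * n : ℝ)‖⁻¹ ^ 3) ^ 2 * z ^ 5 := by gcongr
        _ = C ^ 2 * (‖t + (ε * n : ℝ)‖⁻¹ ^ 6 * z ^ 5) := by ring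
        _ ≤ C ^ 2 * (z⁻¹ ^ 6 * z ^ 5) := by gcongr
        _ = _ := by field_simp
    have hl : Tendsto (fun n : ℕ => C ^ 2 * (y + n)⁻¹) atTop (𝓝 (C ^ 2 * 0)) :=
      (tendsto_inv_atTop_zero.comp (tendsto_atTop_add_const_left _ _ tendsto_natCast_atTop_atTop)).const_mul _
    have h7 := ge_of_tendsto' hl hb
    rw [mul_zero] at h7
    have h8 : ‖Δ t‖ ^ 2 ≤ 0 := by
      by_contra h
      have := mul_pos (not_le.1 h) (pow_pos (by linarith : 0 < y) 5)
      linarith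
    exact norm_eq_zero.1 (pow_eq_zero_iff (two_ne_zero) |>.1 (le_antisymm h8 (by positivity)))
  refine eventually_wedgeFilter.2 ⟨M, fun t ht => ?_⟩
  -- Points of the wedge with ε re t < 1 reach the region already treated after finitely many steps,
  -- and the inequality carries the zero back.
  obtain ⟨n, hn⟩ := exists_nat_ge (1 - ε * t.re)
  have hz := hpos _ (hshift t ht n) (by rw [hre]; linarith)
  have hdesc : ∀ m : ℕ, Δ (t + (ε * m : ℝ)) = 0 → Δ t = 0 := by
    intro m
    induction m with
    | zero => simp
    | succ m ih =>
      intro h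
      apply ih
      have h3 := (hM _ (hshift t ht m)).1
      rw [← hsucc, h, norm_zero, mul_zero] at h3
      exact norm_le_zero_iff.1 h3
  exact hdesc n hz

/-- The exchange of the two coordinates. -/
def swap (v : C2) : C2 := ![v 1, v 0]

theorem norm_swap (v : C2) : ‖swap v‖ ≤ ‖v‖ := by
  rw [pi_norm_le_iff_of_nonneg (norm_nonneg _)]
  intro i
  fin_cases i
  · exact norm_le_pi_norm v 1
  · exact norm_le_pi_norm v 0

/-- The difference of two solutions with a common leading term satisfies an approximately linear
difference equation. -/
theorem exists_difference_equation {ε κ : ℝ} (hε : |ε| = 1) (hκ : κ ≤ 1) {F : C2 → C2}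
    (hF : AnalyticAt ℂ F 0) (hFd : fderiv ℂ F 0 = 1) (T : C2 ≃L[ℂ] C2) {b : C2} (hTb : T b = ![1, 1])
    (hT : ∀ z, T (quadraticPart F z) = -swapSq (T z)) {X Y : ℂ → C2} {x y : C2}
    (hX : HasTwoTerms (wedgeFilter ε κ) X b x) (hY : HasTwoTerms (wedgeFilter ε κ) Y b y)
    (heX : ∀ᶠ t in wedgeFilter ε κ, X (t + 1) = F (X t))
    (heY : ∀ᶠ t in wedgeFilter ε κ, Y (t + 1) = F (Y t)) :
    ∃ C, 0 ≤ C ∧ ∀ᶠ t in wedgeFilter ε κ,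
      ‖T (X (t + 1) - Y (t + 1)) - T (X t - Y t) + (2 * t⁻¹) • swap (T (X t - Y t))‖ ≤
        C * ‖t‖⁻¹ ^ 2 * ‖T (X t - Y t)‖ := by
  obtain ⟨C, r, hC, hr, h⟩ := exists_norm_remainder_sub_le hF
  obtain ⟨K, hK0, hK⟩ := (hX.isBigO hε hκ).exists_nonneg
  obtain ⟨K', hK0', hK'⟩ := (hY.isBigO hε hκ).exists_nonneg
  obtain ⟨A, hA0, hA⟩ := (hX.isBigO_sub hε hκ).exists_nonneg
  obtain ⟨A', hA0', hA'⟩ := (hY.isBigO_sub hε hκ).exists_nonneg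
  set N := ‖(T : C2 →L[ℂ] C2)‖ with hN
  set N' := ‖(T.symm : C2 →L[ℂ] C2)‖ with hN'
  refine ⟨N * (C * (K + K') ^ 2 * N') + N * (A + A'), by positivity, ?_⟩
  have hXr := (hX.tendsto hε hκ) (Metric.ball_mem_nhds (0 : C2) hr)
  have hYr := (hY.tendsto hε hκ) (Metric.ball_mem_nhds (0 : C2) hr)
  filter_upwards [hK.bound, hK'.bound, hA.bound, hA'.bound, hXr, hYr, heX, heY] with t h1 h2 h3 h4 h5 h6 h7 h8
  have h5 : ‖X t‖ < r := by simpa using h5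
  have h6 : ‖Y t‖ < r := by simpa using h6
  rw [norm_inv, norm_norm] at h1 h2
  rw [norm_pow, norm_inv, norm_norm] at h3 h4
  have hR := h (X t) (Y t) h5 h6
  rw [hFd, one_apply_eq_self] at hR
  set w := T (X t - Y t) with hw
  have hXYw : ‖X t - Y t‖ ≤ N' * ‖w‖ := by
    have := (T.symm : C2 →L[ℂ] C2).le_opNorm w
    simpa [hw] using this
  have hmax : max ‖X t‖ ‖Y t‖ ≤ (K + K') * ‖t‖⁻¹ := by
    refine max_le (h1.trans ?_) (h2.trans ?_)
    · gcongr; linarith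
    · gcongr; linarith
  -- A difference of squares factors as sum times difference, and the sums are 2/t + O(t⁻²) because
  -- both solutions have the leading term (1, 1)/t in these coordinates.
  have hsq : swapSq (T (X t)) - swapSq (T (Y t)) =
      ![(T (X t) 1 + T (Y t) 1) * w 1, (T (X t) 0 + T (Y t) 0) * w 0] := by
    ext i
    fin_cases i <;> simp [swapSq, hw] <;> ring
  have hcoef : ∀ i, ‖2 * t⁻¹ - (T (X t) i + T (Y t) i)‖ ≤ N * (A + A') * ‖t‖⁻¹ ^ 2 := by
    intro i
    have hone : T b i = 1 := by rw [hTb]; fin_cases i <;> simp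
    have e1 : ∀ Z : C2, t⁻¹ - T Z i = -(T (Z - t⁻¹ • b) i) := by
      intro Z; rw [map_sub, map_smul]; simp [hone]
    have e2 : 2 * t⁻¹ - (T (X t) i + T (Y t) i) = -(T (X t - t⁻¹ • b) i) + -(T (Y t - t⁻¹ • b) i) := by
      rw [← e1, ← e1]; ring
    have e3 : ∀ Z : C2, ‖T Z i‖ ≤ N * ‖Z‖ := fun Z =>
      (norm_le_pi_norm (T Z) i).trans ((T : C2 →L[ℂ] C2).le_opNorm Z)
    rw [e2]
    refine (norm_add_le _ _).trans ?_
    rw [norm_neg, norm_neg]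
    have e4 := (e3 (X t - t⁻¹ • b)).trans (mul_le_mul_of_nonneg_left h3 (norm_nonneg _))
    have e5 := (e3 (Y t - t⁻¹ • b)).trans (mul_le_mul_of_nonneg_left h4 (norm_nonneg _))
    linarith
  have hsplit : T (X (t + 1) - Y (t + 1)) - w + (2 * t⁻¹) • swap w =
      T (F (X t) - F (Y t) - (X t - Y t) - (quadraticPart F (X t) - quadraticPart F (Y t))) +
        ((2 * t⁻¹) • swap w - (swapSq (T (X t)) - swapSq (T (Y t)))) := by
    rw [h7, h8, map_sub (f := T) (F (X t) - F (Y t) - (X t - Y t)), map_sub (f := T) (F (X t) - F (Y t)),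
      map_sub (f := T) (quadraticPart F (X t)), hT, hT]
    abel
  rw [hsplit]
  refine (norm_add_le _ _).trans ?_
  have p1 : ‖T (F (X t) - F (Y t) - (X t - Y t) - (quadraticPart F (X t) - quadraticPart F (Y t)))‖ ≤
      N * (C * (K + K') ^ 2 * N') * ‖t‖⁻¹ ^ 2 * ‖w‖ := by
    refine ((T : C2 →L[ℂ] C2).le_opNorm _).trans ?_
    calc _ ≤ N * (C * ((K + K') * ‖t‖⁻¹) ^ 2 * (N' * ‖w‖)) := by
          refine mul_le_mul_of_nonneg_left (hR.trans ?_) (norm_nonneg _)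
          gcongr
      _ = _ := by ring
  have p2 : ‖(2 * t⁻¹) • swap w - (swapSq (T (X t)) - swapSq (T (Y t)))‖ ≤
      N * (A + A') * ‖t‖⁻¹ ^ 2 * ‖w‖ := by
    rw [hsq, pi_norm_le_iff_of_nonneg (by positivity)]
    intro i
    have e : ∀ j, ‖(2 * t⁻¹) * w j - (T (X t) j + T (Y t) j) * w j‖ ≤ N * (A + A') * ‖t‖⁻¹ ^ 2 * ‖w‖ := by
      intro j
      rw [← sub_mul, norm_mul]
      exact mul_le_mul (hcoef j) (norm_le_pi_norm w j) (norm_nonneg _) (by positivity)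
    fin_cases i
    · simpa [swap] using e 1
    · simpa [swap] using e 0
  linarith

/-- Second coefficients of two solutions with a common leading term differ by a multiple of it. -/
theorem second_coefficient_symmetric {κ : ℝ} (hκ : κ ≤ 1) {F : C2 → C2}
    (hF : AnalyticAt ℂ F 0) (hFd : fderiv ℂ F 0 = 1) (T : C2 ≃L[ℂ] C2) {b : C2} (hTb : T b = ![1, 1])
    (hT : ∀ z, T (quadraticPart F z) = -swapSq (T z)) {X Y : ℂ → C2} {x y : C2}
    (hX : HasTwoTerms (wedgeFilter 1 κ) X b x) (hY : HasTwoTerms (wedgeFilter 1 κ) Y b y)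
    (heX : ∀ᶠ t in wedgeFilter 1 κ, X (t + 1) = F (X t))
    (heY : ∀ᶠ t in wedgeFilter 1 κ, Y (t + 1) = F (Y t)) : T (x - y) 0 = T (x - y) 1 := by
  by_contra hne
  obtain ⟨C, hC0, hC⟩ := exists_difference_equation (by simp) hκ hF hFd T hTb hT hX hY heX heY
  set Δ : ℂ → C2 := fun t => T (X t - Y t) with hΔ
  set p : ℂ → ℂ := fun t => Δ t 0 - Δ t 1 with hp
  set d := T (x - y) 0 - T (x - y) 1 with hd
  have hd0 : 0 < ‖d‖ := norm_pos_iff.2 (sub_ne_zero.2 hne)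
  have hΔ3 : (fun t => Δ t - t⁻¹ ^ 2 • T (x - y)) =O[wedgeFilter 1 κ] fun t => ‖t‖⁻¹ ^ 3 := by
    have h1 := ((T : C2 →L[ℂ] C2).isBigO_comp _ _).trans (IsBigO.sub hX hY)
    refine h1.congr_left fun t => ?_
    simp only [hΔ, ContinuousLinearEquiv.coe_coe, map_sub, map_add, map_smul]
    module
  have hΔ2 : Δ =O[wedgeFilter 1 κ] fun t => ‖t‖⁻¹ ^ 2 :=
    ((hΔ3.trans (isBigO_inv_pow_wedgeFilter (by simp) hκ (by norm_num))).add
      (isBigO_smul_inv_pow 2 (T (x - y)))).congr_left fun t => by abel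
  obtain ⟨A3, hA30, hA3⟩ := hΔ3.exists_nonneg
  obtain ⟨A2, hA20, hA2⟩ := hΔ2.exists_nonneg
  have hcomp : ∀ v : C2, ‖v 0 - v 1‖ ≤ 2 * ‖v‖ := by
    intro v
    have := norm_sub_le (v 0) (v 1)
    linarith [norm_le_pi_norm v 0, norm_le_pi_norm v 1]
  have hT' := tendsto_ofReal_wedgeFilter κ
  -- On the positive real axis p satisfies p(r+1) = (1 + 2/r) p(r) + O(r⁻⁴). If d ≠ 0, then |p| is
  -- at least |d| r⁻²/2, so for large r the error is at most (2/r)|p| and |p| cannot decrease; but p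
  -- tends to zero.
  have hmono : ∀ᶠ r : ℝ in atTop, 0 < ‖p r‖ ∧ ‖p r‖ ≤ ‖p (r + 1 : ℝ)‖ := by
    filter_upwards [hT'.eventually hC, hT'.eventually hA3.bound, hT'.eventually hA2.bound,
      eventually_ge_atTop (4 * A3 / ‖d‖ + 1), eventually_ge_atTop (2 * C * A2 / ‖d‖ + 1)] with r h1 h2 h3 h4 h5
    have hr : 0 < r := by
      have : 0 ≤ 4 * A3 / ‖d‖ := by positivity
      linarith
    simp only [norm_pow, norm_inv, Complex.norm_real, Real.norm_of_nonneg hr.le] at h1 h2 h3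
    have e1 : p r - (r : ℂ)⁻¹ ^ 2 * d = (Δ r - (r : ℂ)⁻¹ ^ 2 • T (x - y)) 0 - (Δ r - (r : ℂ)⁻¹ ^ 2 • T (x - y)) 1 := by
      simp only [hp, hd, Pi.sub_apply, Pi.smul_apply, smul_eq_mul]; ring
    have h6 : ‖p r - (r : ℂ)⁻¹ ^ 2 * d‖ ≤ 2 * (A3 * r⁻¹ ^ 3) := by
      rw [e1]; exact (hcomp _).trans (by linarith)
    have h7 : r⁻¹ ^ 2 * ‖d‖ ≤ ‖p r‖ + 2 * (A3 * r⁻¹ ^ 3) := by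
      have := norm_sub_norm_le ((r : ℂ)⁻¹ ^ 2 * d) (p r)
      rw [norm_sub_rev _ (p r), norm_mul, norm_pow, norm_inv, Complex.norm_real, Real.norm_of_nonneg hr.le] at this
      linarith
    have h8 : 2 * (A3 * r⁻¹ ^ 3) ≤ r⁻¹ ^ 2 * ‖d‖ / 2 := by
      have : 4 * A3 ≤ r * ‖d‖ := by
        rw [← div_le_iff₀ hd0]; linarith
      calc 2 * (A3 * r⁻¹ ^ 3) = (4 * A3) * r⁻¹ ^ 3 / 2 := by ring
        _ ≤ (r * ‖d‖) * r⁻¹ ^ 3 / 2 := by gcongr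
        _ = _ := by field_simp
    have h9 : r⁻¹ ^ 2 * ‖d‖ / 2 ≤ ‖p r‖ := by linarith
    refine ⟨lt_of_lt_of_le (by positivity) h9, ?_⟩
    have e2 : p (r + 1 : ℝ) - (1 + 2 * (r : ℂ)⁻¹) * p r =
        (Δ (r + 1) - Δ r + (2 * (r : ℂ)⁻¹) • swap (Δ r)) 0 - (Δ (r + 1) - Δ r + (2 * (r : ℂ)⁻¹) • swap (Δ r)) 1 := by
      simp only [hp, Pi.sub_apply, Pi.add_apply, Pi.smul_apply, smul_eq_mul, swap, Matrix.cons_val_zero,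
        Matrix.cons_val_one, Complex.ofReal_add, Complex.ofReal_one]
      ring
    have h10 : ‖p (r + 1 : ℝ) - (1 + 2 * (r : ℂ)⁻¹) * p r‖ ≤ 2 * (C * r⁻¹ ^ 2 * ‖Δ r‖) := by
      rw [e2]
      exact (hcomp _).trans (by linarith)
    have h11 : 2 * (C * r⁻¹ ^ 2 * ‖Δ r‖) ≤ 2 * r⁻¹ * ‖p r‖ := by
      have : 2 * C * A2 ≤ r * ‖d‖ := by
        rw [← div_le_iff₀ hd0]; linarith
      calc 2 * (C * r⁻¹ ^ 2 * ‖Δ r‖) ≤ 2 * (C * r⁻¹ ^ 2 * (A2 * r⁻¹ ^ 2)) := by gcongr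
        _ = (2 * C * A2) * r⁻¹ ^ 4 := by ring
        _ ≤ (r * ‖d‖) * r⁻¹ ^ 4 := by gcongr
        _ = 2 * r⁻¹ * (r⁻¹ ^ 2 * ‖d‖ / 2) := by field_simp
        _ ≤ _ := by gcongr
    have h12 : ‖(1 + 2 * (r : ℂ)⁻¹) * p r‖ = (1 + 2 * r⁻¹) * ‖p r‖ := by
      rw [norm_mul]
      congr 1
      have : (1 + 2 * (r : ℂ)⁻¹) = ((1 + 2 * r⁻¹ : ℝ) : ℂ) := by push_cast; ring
      rw [this, Complex.norm_real, Real.norm_of_nonneg (by positivity)]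
    have h13 := norm_sub_norm_le ((1 + 2 * (r : ℂ)⁻¹) * p r) (p (r + 1 : ℝ))
    rw [norm_sub_rev _ (p (r + 1 : ℝ)), h12] at h13
    linarith
  obtain ⟨r0, hr0⟩ := eventually_atTop.1 hmono
  have hiter : ∀ n : ℕ, ‖p r0‖ ≤ ‖p (r0 + n : ℝ)‖ := by
    intro n
    induction n with
    | zero => simp
    | succ n ih =>
      refine ih.trans ?_
      have := (hr0 (r0 + n) (by linarith [n.cast_nonneg (α := ℝ)])).2
      rw [add_assoc] at this
      push_cast at this ⊢
      exact this
  have hlim : Tendsto (fun n : ℕ => ‖p (r0 + n : ℝ)‖) atTop (𝓝 0) := by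
    have h1 : Tendsto Δ (wedgeFilter 1 κ) (𝓝 0) :=
      hΔ2.trans_tendsto (tendsto_inv_pow_wedgeFilter (by simp) hκ two_ne_zero)
    have h2 : Tendsto p (wedgeFilter 1 κ) (𝓝 0) := by
      have := ((tendsto_pi_nhds.1 h1) 0).sub ((tendsto_pi_nhds.1 h1) 1)
      simpa using this
    have h3 := (h2.comp hT').comp (tendsto_atTop_add_const_left atTop r0 tendsto_natCast_atTop_atTop)
    simpa using h3.norm
  have := ge_of_tendsto' hlim hiter
  linarith [(hr0 r0 le_rfl).1]

/-- Two solutions which agree to second order agree. -/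
theorem eventually_eq_of_hasTwoTerms {ε κ : ℝ} (hε : ε = 1 ∨ ε = -1) (hκ0 : 0 ≤ κ) (hκ : κ ≤ 1) {F : C2 → C2}
    (hF : AnalyticAt ℂ F 0) (hFd : fderiv ℂ F 0 = 1) (T : C2 ≃L[ℂ] C2) {b : C2} (hTb : T b = ![1, 1])
    (hT : ∀ z, T (quadraticPart F z) = -swapSq (T z)) {X Y : ℂ → C2} {x : C2}
    (hX : HasTwoTerms (wedgeFilter ε κ) X b x) (hY : HasTwoTerms (wedgeFilter ε κ) Y b x)
    (heX : ∀ᶠ t in wedgeFilter ε κ, X (t + 1) = F (X t))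
    (heY : ∀ᶠ t in wedgeFilter ε κ, Y (t + 1) = F (Y t)) : ∀ᶠ t in wedgeFilter ε κ, X t = Y t := by
  have hε1 : |ε| = 1 := by rcases hε with rfl | rfl <;> simp
  obtain ⟨C, hC0, hC⟩ := exists_difference_equation hε1 hκ hF hFd T hTb hT hX hY heX heY
  set Δ : ℂ → C2 := fun t => T (X t - Y t) with hΔ
  have hΔ3 : Δ =O[wedgeFilter ε κ] fun t => ‖t‖⁻¹ ^ 3 := by
    have h1 := ((T : C2 →L[ℂ] C2).isBigO_comp _ _).trans (IsBigO.sub hX hY)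
    refine h1.congr_left fun t => ?_
    simp only [hΔ, ContinuousLinearEquiv.coe_coe]
    congr 1; abel
  -- The constant 9/4 exceeds the true coefficient 2 to absorb the error, and stays below 5/2 to
  -- leave room when the inequality is inverted or shifted back by one step.
  have hincr : ∀ᶠ t in wedgeFilter ε κ, ‖Δ (t + 1) - Δ t‖ ≤ 9 / 4 * ‖t‖⁻¹ * ‖Δ t‖ := by
    filter_upwards [hC, eventually_le_norm_wedgeFilter hε1 hκ (4 * C + 1)] with t h1 h2
    have ht : 0 < ‖t‖ := by linarith
    have h3 : ‖(2 * t⁻¹) • swap (Δ t)‖ ≤ 2 * ‖t‖⁻¹ * ‖Δ t‖ := by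
      rw [norm_smul, norm_mul, norm_inv, Complex.norm_two]
      gcongr
      exact norm_swap _
    have h4 : C * ‖t‖⁻¹ ^ 2 * ‖Δ t‖ ≤ 1 / 4 * ‖t‖⁻¹ * ‖Δ t‖ := by
      rw [pow_two, ← mul_assoc]
      have : C * ‖t‖⁻¹ ≤ 1 / 4 := by
        rw [← div_eq_mul_inv, div_le_iff₀ ht]
        linarith
      gcongr
    have h5 := norm_sub_le (Δ (t + 1) - Δ t + (2 * t⁻¹) • swap (Δ t)) ((2 * t⁻¹) • swap (Δ t))
    rw [add_sub_cancel_right] at h5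
    linarith
  have hle : ∀ᶠ t in wedgeFilter ε κ, ‖Δ t‖ ≤ (1 + 5 / 2 * ‖t‖⁻¹) * ‖Δ (t + ε)‖ := by
    rcases hε with rfl | rfl
    · filter_upwards [hincr, eventually_le_norm_wedgeFilter hε1 hκ 30] with t h1 h2
      have ht : ‖t‖⁻¹ ≤ 1 / 30 := by
        rw [one_div]; exact inv_anti₀ (by norm_num) h2
      have ht0 : 0 ≤ ‖t‖⁻¹ := by positivity
      have h3 := norm_sub_norm_le (Δ t) (Δ (t + 1))
      rw [norm_sub_rev] at h3
      rw [Complex.ofReal_one]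
      have h4 : (1 - 9 / 4 * ‖t‖⁻¹) * ‖Δ t‖ ≤ ‖Δ (t + 1)‖ := by linarith
      have h5 : 1 ≤ (1 + 5 / 2 * ‖t‖⁻¹) * (1 - 9 / 4 * ‖t‖⁻¹) := by nlinarith
      calc ‖Δ t‖ ≤ ((1 + 5 / 2 * ‖t‖⁻¹) * (1 - 9 / 4 * ‖t‖⁻¹)) * ‖Δ t‖ :=
            le_mul_of_one_le_left (norm_nonneg _) h5
        _ = (1 + 5 / 2 * ‖t‖⁻¹) * ((1 - 9 / 4 * ‖t‖⁻¹) * ‖Δ t‖) := by ring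
        _ ≤ _ := by gcongr
    · filter_upwards [(tendsto_add_wedgeFilter hε1 hκ0 hκ (-1)).eventually hincr,
        eventually_le_norm_wedgeFilter hε1 hκ 30] with t h1 h2
      rw [neg_add_cancel_right] at h1
      have h3 := norm_sub_norm_le (Δ t) (Δ (t + -1))
      have h4 : ‖t‖ - 1 ≤ ‖t + -1‖ := by simpa [sub_eq_add_neg] using norm_sub_norm_le t 1
      have h5 : 9 / 4 * ‖t + -1‖⁻¹ ≤ 5 / 2 * ‖t‖⁻¹ := by
        rw [← div_eq_mul_inv, ← div_eq_mul_inv, div_le_div_iff₀ (by linarith) (by linarith)]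
        linarith
      have h6 := mul_le_mul_of_nonneg_right h5 (norm_nonneg (Δ (t + -1)))
      push_cast
      linarith
  refine (eventually_eq_zero_of_le_shift hε1 hle hΔ3).mono fun t ht => ?_
  exact sub_eq_zero.1 (T.injective (by rw [map_zero]; exact ht))

/-! ### The Stokes constant under symplectic changes of coordinates -/

theorem norm_omega_le (u v : C2) : ‖omega u v‖ ≤ 2 * ‖u‖ * ‖v‖ := by
  have h1 := mul_le_mul (norm_le_pi_norm u 0) (norm_le_pi_norm v 1) (norm_nonneg _) (norm_nonneg _)
  have h2 := mul_le_mul (norm_le_pi_norm u 1) (norm_le_pi_norm v 0) (norm_nonneg _) (norm_nonneg _)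
  have h3 := norm_sub_le (u 0 * v 1) (u 1 * v 0)
  rw [norm_mul, norm_mul] at h3
  rw [omega]
  linarith

/-- `L` is a bounded symplectic derivative of `Ψ` near the origin, with a quadratic error. -/
def HasSymplecticDeriv (Ψ : C2 → C2) (L : C2 → C2 →L[ℂ] C2) : Prop :=
  ∃ C r : ℝ, 0 ≤ C ∧ 0 < r ∧ (∀ z, ‖z‖ < r → ‖L z‖ ≤ C ∧ ∀ u v, omega (L z u) (L z v) = omega u v) ∧
    ∀ z w, ‖z‖ < r → ‖w‖ < r → ‖Ψ z - Ψ w - L w (z - w)‖ ≤ C * ‖z - w‖ ^ 2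

theorem IsSymplecticMap.hasSymplecticDeriv {Ψ : C2 → C2} (h : IsSymplecticMap Ψ) :
    HasSymplecticDeriv Ψ (fderiv ℂ Ψ) := by
  obtain ⟨C, r, hC, hr, -, hq⟩ := exists_norm_sub_sub_fderiv_le_sq h.analytic
  have hc : ∀ᶠ z in 𝓝 (0 : C2), ‖fderiv ℂ Ψ z‖ < ‖fderiv ℂ Ψ 0‖ + 1 :=
    (h.analytic.fderiv.continuousAt.norm).eventually_lt continuousAt_const (lt_add_one _)
  obtain ⟨r', hr', hd⟩ := Metric.eventually_nhds_iff.1 (hc.and h.preserves)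
  refine ⟨C + (‖fderiv ℂ Ψ 0‖ + 1), min r r', by positivity, lt_min hr hr', fun z hz => ?_, fun z w hz hw => ?_⟩
  · have := hd (y := z) (by rw [dist_zero_right]; exact hz.trans_le (min_le_right _ _))
    exact ⟨by linarith [this.1], this.2⟩
  · refine (hq z w (hz.trans_le (min_le_left _ _)) (hw.trans_le (min_le_left _ _))).trans ?_
    gcongr
    linarith [norm_nonneg (fderiv ℂ Ψ 0)]

theorem HasSymplecticDeriv.eventually_hasFDerivAt {Ψ : C2 → C2} {L : C2 → C2 →L[ℂ] C2}
    (h : HasSymplecticDeriv Ψ L) : ∀ᶠ z in 𝓝 (0 : C2), HasFDerivAt Ψ (L z) z := by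
  obtain ⟨C, r, hC, hr, -, hq⟩ := h
  filter_upwards [Metric.ball_mem_nhds (0 : C2) hr] with w hw
  have hw' : ‖w‖ < r := by simpa using hw
  rw [hasFDerivAt_iff_isLittleO]
  have h1 : (fun z => Ψ z - Ψ w - L w (z - w)) =O[𝓝 w] fun z => ‖z - w‖ ^ 2 := by
    refine IsBigO.of_bound C ?_
    filter_upwards [Metric.isOpen_ball.mem_nhds hw] with z hz
    rw [norm_pow, norm_norm]
    exact hq z w (by simpa using hz) hw'
  refine h1.trans_isLittleO ?_
  have h2 : (fun z : C2 => ‖z - w‖ ^ 2) =o[𝓝 w] fun z => ‖z - w‖ ^ 1 := by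
    have h3 : Tendsto (fun z : C2 => ‖z - w‖) (𝓝 w) (𝓝 0) := by
      have : Continuous fun z : C2 => ‖z - w‖ := by fun_prop
      simpa using this.tendsto w
    exact (isLittleO_pow_pow (𝕜 := ℝ) (by norm_num : 1 < 2)).comp_tendsto h3
  simpa using h2

/-- Conjugation of a map by complex conjugation. -/
def conjMap (Ψ : C2 → C2) (z : C2) : C2 := star (Ψ (star z))

/-- Conjugating a complex linear map on both sides gives a complex linear map again, norms do not
change, and ω commutes with conjugation. Only these bounds are transferred, so analyticity of the
conjugate map need not be discussed. -/
theorem HasSymplecticDeriv.exists_conjMap {Ψ : C2 → C2} {L : C2 → C2 →L[ℂ] C2}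
    (h : HasSymplecticDeriv Ψ L) : ∃ L', HasSymplecticDeriv (conjMap Ψ) L' := by
  obtain ⟨C, r, hC, hr, hL, hq⟩ := h
  have hlin : ∀ A : C2 →L[ℂ] C2, ∃ A' : C2 →L[ℂ] C2, ∀ u, A' u = star (A (star u)) := by
    intro A
    refine ⟨LinearMap.toContinuousLinearMap
      { toFun := fun u => star (A (star u))
        map_add' := fun u v => by rw [star_add, map_add, star_add]
        map_smul' := fun c u => by rw [star_smul, map_smul, star_smul, star_star, RingHom.id_apply] }, fun u => rfl⟩
  choose A' hA' using hlin
  have homega : ∀ u v, omega (star u) (star v) = star (omega u v) := by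
    intro u v
    simp [omega]
  refine ⟨fun z => A' (L (star z)), C, r, hC, hr, fun z hz => ?_, fun z w hz hw => ?_⟩
  · have h1 := hL (star z) (by rwa [norm_star])
    refine ⟨ContinuousLinearMap.opNorm_le_bound _ hC fun u => ?_, fun u v => ?_⟩
    · rw [hA', norm_star]
      refine ((L (star z)).le_opNorm _).trans ?_
      rw [norm_star]
      exact mul_le_mul_of_nonneg_right h1.1 (norm_nonneg _)
    · rw [hA', hA', homega, h1.2, homega, star_star]
  · have h1 := hq (star z) (star w) (by rwa [norm_star]) (by rwa [norm_star])
    rw [hA', conjMap, conjMap, ← star_sub, ← star_sub, norm_star, star_sub z w]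
    rwa [← star_sub z w, norm_star, star_sub z w] at h1

/-- The function whose exponentially weighted limit is the Stokes constant. -/
def stokesForm (Vp Vm : ℂ → C2) (t : ℂ) : ℂ := omega (Vp t - Vm t) (deriv Vm t)

theorem norm_exp_two_pi_I (t : ℂ) :
    ‖Complex.exp (2 * Real.pi * Complex.I * t)‖ = Real.exp (-(2 * Real.pi * t.im)) := by
  rw [Complex.norm_exp]; congr 1; simp

/-- A symplectic change of coordinates does not affect the leading exponentially small term. -/
theorem tendsto_stokesForm_comp_sub {Ψ : C2 → C2} {L : C2 → C2 →L[ℂ] C2}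
    (h : HasSymplecticDeriv Ψ L) {Vp Vm : ℂ → C2} (p : ℂ) {B S D : ℝ}
    (hdecay : ∀ s : ℝ, S ≤ s → ‖Vp (-Complex.I * s + p) - Vm (-Complex.I * s + p)‖ ≤
      B * Real.exp (-(3 * Real.pi / 2 * s)))
    (hVp : Tendsto (fun s : ℝ => Vp (-Complex.I * s + p)) atTop (𝓝 0))
    (hVm : Tendsto (fun s : ℝ => Vm (-Complex.I * s + p)) atTop (𝓝 0))
    (hd : ∀ᶠ s : ℝ in atTop, DifferentiableAt ℂ Vm (-Complex.I * s + p) ∧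
      ‖deriv Vm (-Complex.I * s + p)‖ ≤ D) :
    Tendsto (fun s : ℝ => Complex.exp (2 * Real.pi * Complex.I * (-Complex.I * s + p)) *
      (stokesForm (fun t => Ψ (Vp t)) (fun t => Ψ (Vm t)) (-Complex.I * s + p) -
        stokesForm Vp Vm (-Complex.I * s + p))) atTop (𝓝 0) := by
  have hF := h.eventually_hasFDerivAt
  obtain ⟨C, r, hC, hr, hL, hq⟩ := h
  have hpi := Real.pi_pos
  have hlim : Tendsto (fun s : ℝ => Real.exp (-(2 * Real.pi * p.im)) * (2 * C * B ^ 2 * C * D) * Real.exp (-(Real.pi * s)))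
      atTop (𝓝 (Real.exp (-(2 * Real.pi * p.im)) * (2 * C * B ^ 2 * C * D) * 0)) :=
    (Real.tendsto_exp_neg_atTop_nhds_zero.comp (tendsto_id.const_mul_atTop hpi)).const_mul _
  rw [mul_zero] at hlim
  refine squeeze_zero_norm' ?_ hlim
  filter_upwards [eventually_ge_atTop S, hVp (Metric.ball_mem_nhds (0 : C2) hr),
    hVm (Metric.ball_mem_nhds (0 : C2) hr), hd, hVm.eventually hF] with s h1 h2 h3 h4 h5
  set t : ℂ := -Complex.I * s + p with ht
  have h2 : ‖Vp t‖ < r := mem_ball_zero_iff.1 h2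
  have h3 : ‖Vm t‖ < r := mem_ball_zero_iff.1 h3
  have h6 : deriv (fun t => Ψ (Vm t)) t = L (Vm t) (deriv Vm t) :=
    (h5.comp_hasDerivAt t h4.1.hasDerivAt).deriv
  -- The linear part of Ψ at V⁻ preserves ω and cancels exactly, which leaves only the Taylor
  -- remainder paired with the transported velocity.
  have h7 : stokesForm (fun t => Ψ (Vp t)) (fun t => Ψ (Vm t)) t - stokesForm Vp Vm t =
      omega (Ψ (Vp t) - Ψ (Vm t) - L (Vm t) (Vp t - Vm t)) (L (Vm t) (deriv Vm t)) := by
    rw [stokesForm, stokesForm, h6, ← (hL _ h3).2 (Vp t - Vm t) (deriv Vm t)]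
    simp only [omega, Pi.sub_apply]
    ring
  have h8 : ‖omega (Ψ (Vp t) - Ψ (Vm t) - L (Vm t) (Vp t - Vm t)) (L (Vm t) (deriv Vm t))‖ ≤
      2 * C * B ^ 2 * C * D * Real.exp (-(3 * Real.pi * s)) := by
    refine (norm_omega_le _ _).trans ?_
    have e1 := hq _ _ h2 h3
    have e2 : ‖L (Vm t) (deriv Vm t)‖ ≤ C * D :=
      ((L (Vm t)).le_opNorm _).trans (mul_le_mul (hL _ h3).1 h4.2 (norm_nonneg _) hC)
    have e3 : ‖Vp t - Vm t‖ ^ 2 ≤ B ^ 2 * Real.exp (-(3 * Real.pi * s)) := by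
      calc _ ≤ (B * Real.exp (-(3 * Real.pi / 2 * s))) ^ 2 := by
            gcongr; exact hdecay s h1
        -- Squaring the decay rate 3π/2 gives 3π, which beats the weight rate 2π. Any rate above π
        -- would do.
        _ = B ^ 2 * (Real.exp (-(3 * Real.pi / 2 * s)) * Real.exp (-(3 * Real.pi / 2 * s))) := by ring
        _ = _ := by rw [← Real.exp_add]; ring_nf
    calc _ ≤ 2 * (C * (B ^ 2 * Real.exp (-(3 * Real.pi * s)))) * (C * D) := by
          gcongr
          exact e1.trans (by gcongr)
      _ = _ := by ring
  rw [h7, norm_mul, norm_exp_two_pi_I]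
  have him : t.im = p.im - s := by simp [ht]; ring
  calc _ ≤ Real.exp (-(2 * Real.pi * t.im)) * (2 * C * B ^ 2 * C * D * Real.exp (-(3 * Real.pi * s))) := by gcongr
    _ = (2 * C * B ^ 2 * C * D) * (Real.exp (-(2 * Real.pi * t.im)) * Real.exp (-(3 * Real.pi * s))) := by ring
    _ = (2 * C * B ^ 2 * C * D) * (Real.exp (-(2 * Real.pi * p.im)) * Real.exp (-(Real.pi * s))) := by
        rw [← Real.exp_add, ← Real.exp_add, him]; ring_nf
    _ = _ := by ring

/-- Far down a vertical strip κ|im t| dominates the bounded real part whatever the sign ε. Such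
half-strips lie in both wedges, and there the two separatrices of a pair can be compared. -/
theorem exists_strip_of_eventually {ε κ : ℝ} (hε : |ε| = 1) (hκ : 0 < κ) {P : ℂ → Prop}
    (h : ∀ᶠ t in wedgeFilter ε κ, P t) (p : ℂ) (A : ℝ) :
    ∃ M, ∀ t : ℂ, |t.re| ≤ A → t.im ≤ -M → P (t + p) := by
  obtain ⟨M, hM⟩ := eventually_wedgeFilter.1 h
  refine ⟨(|M| + |A| + ‖p‖ + 1) / κ + ‖p‖, fun t h1 h2 => hM _ ?_⟩
  change M < ε * (t + p).re + κ * |(t + p).im|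
  have h3 : -(|A| + ‖p‖) ≤ ε * (t + p).re := by
    have : |ε * (t + p).re| ≤ |A| + ‖p‖ := by
      rw [abs_mul, hε, one_mul, Complex.add_re]
      exact (abs_add_le _ _).trans (add_le_add (h1.trans (le_abs_self _)) (Complex.abs_re_le_norm p))
    linarith [(abs_le.1 this).1]
  have h4 : (|M| + |A| + ‖p‖ + 1) / κ ≤ |(t + p).im| := by
    refine le_trans ?_ (neg_le_abs _)
    rw [Complex.add_im]
    linarith [(abs_le.1 (Complex.abs_im_le_norm p)).2]
  rw [div_le_iff₀ hκ] at h4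
  linarith [le_abs_self M]

theorem tendsto_vertical_wedgeFilter {ε κ : ℝ} (hε : |ε| = 1) (hκ : 0 < κ) (p : ℂ) :
    Tendsto (fun s : ℝ => -Complex.I * s + p) atTop (wedgeFilter ε κ) := by
  intro s hs
  obtain ⟨M, hM⟩ := exists_strip_of_eventually hε hκ (show ∀ᶠ t in wedgeFilter ε κ, t ∈ s from hs) p 0
  change ∀ᶠ x : ℝ in atTop, -Complex.I * x + p ∈ s
  filter_upwards [eventually_ge_atTop M] with x hx
  exact hM _ (by simp) (by simpa using hx)

theorem IsWedgeSeparatrix.tendsto {G : C2 → C2} {a : ℕ → C2} {ε M κ : ℝ} {V : ℂ → C2}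
    (h : IsWedgeSeparatrix G a ε M κ V) (hε : |ε| = 1) (hκ : κ ≤ 1) :
    Tendsto V (wedgeFilter ε κ) (𝓝 0) := h.hasTwoTerms.tendsto hε hκ

theorem IsWedgeSeparatrix.eventually_equation {G : C2 → C2} {a : ℕ → C2} {ε M κ : ℝ} {V : ℂ → C2}
    (h : IsWedgeSeparatrix G a ε M κ V) (hε : |ε| = 1) (hκ0 : 0 ≤ κ) (hκ : κ ≤ 1) :
    ∀ᶠ t in wedgeFilter ε κ, V (t + 1) = G (V t) := by
  filter_upwards [eventually_mem_wedge ε M κ,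
    (tendsto_add_wedgeFilter hε hκ0 hκ 1).eventually (eventually_mem_wedge ε M κ)] with t h1 h2
  exact h.equation t h1 h2

/-- The derivative is bounded by Cauchy's estimate on unit discs; the wedge is shrunk by 2 because a
translation by c costs 2‖c‖. -/
theorem IsWedgeSeparatrix.eventually_deriv {G : C2 → C2} {a : ℕ → C2} {ε M κ : ℝ} {V : ℂ → C2}
    (h : IsWedgeSeparatrix G a ε M κ V) (hε : |ε| = 1) (hκ0 : 0 ≤ κ) (hκ : κ ≤ 1) :
    ∀ᶠ t in wedgeFilter ε κ, DifferentiableAt ℂ V t ∧ DifferentiableAt ℂ (deriv V) t ∧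
      ‖V t‖ ≤ 1 ∧ ‖deriv V t‖ ≤ 1 := by
  have h1 : ∀ᶠ t in wedgeFilter ε κ, ‖V t‖ ≤ 1 := by
    filter_upwards [(h.tendsto hε hκ) (Metric.ball_mem_nhds (0 : C2) one_pos)] with t ht
    have : ‖V t‖ < 1 := by simpa using ht
    exact this.le
  obtain ⟨M', hM'⟩ := eventually_wedgeFilter.1 ((eventually_mem_wedge ε M κ).and h1)
  refine eventually_wedgeFilter.2 ⟨M' + 2, fun t ht => ?_⟩
  have hball : ∀ z ∈ Metric.closedBall t 1, z ∈ wedge ε M' κ := by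
    intro z hz
    have h2 : ‖z - t‖ ≤ 1 := by rwa [← dist_eq_norm]
    have := add_mem_wedge hε hκ0 hκ (z - t) (wedge_mono (by linarith) ht)
    rwa [add_sub_cancel] at this
  have hd : DifferentiableOn ℂ V (wedge ε M' κ) := h.analytic.mono fun z hz => (hM' z hz).1
  have htm := hball t (Metric.mem_closedBall_self zero_le_one)
  refine ⟨hd.differentiableAt ((isOpen_wedge _ _ _).mem_nhds htm),
    (hd.deriv (isOpen_wedge _ _ _)).differentiableAt ((isOpen_wedge _ _ _).mem_nhds htm), (hM' t htm).2, ?_⟩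
  have := Complex.norm_deriv_le_of_forall_mem_sphere_norm_le (f := V) (c := t) (R := 1) (C := 1) one_pos
    (DifferentiableOn.diffContOnCl fun z hz => (hd z (hball z (Metric.closure_ball_subset_closedBall hz))).mono
      fun w hw => hball w (Metric.closure_ball_subset_closedBall hw))
    (fun z hz => (hM' z (hball z (Metric.sphere_subset_closedBall hz))).2)
  simpa using this

/-- The difference of the two separatrices of a pair is exponentially small along vertical lines. -/
theorem exists_exponential_decay_sub {G : C2 → C2} (hG : AnalyticAt ℂ G 0)
    (hGd : fderiv ℂ G 0 = 1) {a : ℕ → C2} {M κ : ℝ} (hκ0 : 0 < κ) (hκ : κ ≤ 1) {Vp Vm : ℂ → C2}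
    (hp : IsWedgeSeparatrix G a 1 M κ Vp) (hm : IsWedgeSeparatrix G a (-1) M κ Vm) (p : ℂ) :
    ∃ B S : ℝ, ∀ s : ℝ, S ≤ s → ‖Vp (-Complex.I * s + p) - Vm (-Complex.I * s + p)‖ ≤
      B * Real.exp (-(3 * Real.pi / 2 * s)) := by
  have e1 : |(1 : ℝ)| = 1 := by simp
  have e2 : |(-1 : ℝ)| = 1 := by simp
  obtain ⟨C, r, hC, hr, hGl⟩ := exists_norm_sub_sub_fderiv_le hG
  obtain ⟨K, hK0, hK⟩ := (hp.hasTwoTerms.isBigO e1 hκ).exists_nonneg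
  obtain ⟨K', hK0', hK'⟩ := (hm.hasTwoTerms.isBigO e2 hκ).exists_nonneg
  obtain ⟨M₁, hM₁⟩ := exists_strip_of_eventually e1 hκ0
    (((hp.eventually_deriv e1 hκ0.le hκ).and (hp.eventually_equation e1 hκ0.le hκ)).and
      (hK.bound.and ((hp.tendsto e1 hκ) (Metric.ball_mem_nhds (0 : C2) hr)))) p 2
  obtain ⟨M₂, hM₂⟩ := exists_strip_of_eventually e2 hκ0
    (((hm.eventually_deriv e2 hκ0.le hκ).and (hm.eventually_equation e2 hκ0.le hκ)).and
      (hK'.bound.and ((hm.tendsto e2 hκ) (Metric.ball_mem_nhds (0 : C2) hr)))) p 2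
  have hhalf : ∀ t : ℂ, t.im ≤ -(2 * ‖p‖ + 2) → 0 < -t.im ∧ ‖t + p‖⁻¹ ≤ 2 / (-t.im) ∧ ‖t + p‖⁻¹ ≤ 1 := by
    intro t ht
    have h0 := norm_nonneg p
    have h1 : -t.im / 2 ≤ ‖t + p‖ := by
      refine le_trans ?_ ((neg_le_abs _).trans (Complex.abs_im_le_norm (t + p)))
      rw [Complex.add_im]
      linarith [(abs_le.1 (Complex.abs_im_le_norm p)).2]
    refine ⟨by linarith, ?_, inv_le_one_of_one_le₀ (by linarith)⟩
    calc ‖t + p‖⁻¹ ≤ (-t.im / 2)⁻¹ := inv_anti₀ (by linarith) h1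
      _ = _ := by rw [inv_div]
  refine exists_exponential_decay (fun t => Vp (t + p) - Vm (t + p)) (max (max M₁ M₂) (2 * ‖p‖ + 2))
    (C * (K + K') * 2) (by positivity) ?_ ?_ ?_
  · intro t h1 h2
    have h3 := (hM₁ t h1 (by linarith [(le_max_left M₁ M₂).trans (le_max_left _ (2 * ‖p‖ + 2))])).1.1.1
    have h4 := (hM₂ t h1 (by linarith [(le_max_right M₁ M₂).trans (le_max_left _ (2 * ‖p‖ + 2))])).1.1.1
    exact (DifferentiableAt.comp t (f := fun t => t + p) h3 (by fun_prop)).sub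
      (DifferentiableAt.comp t (f := fun t => t + p) h4 (by fun_prop))
  · intro t h1 h2
    have h3 := (hM₁ t (by linarith) (by linarith [(le_max_left M₁ M₂).trans (le_max_left _ (2 * ‖p‖ + 2))]))
    have h4 := (hM₂ t (by linarith) (by linarith [(le_max_right M₁ M₂).trans (le_max_left _ (2 * ‖p‖ + 2))]))
    have h5 := hhalf t (by linarith [le_max_right (max M₁ M₂) (2 * ‖p‖ + 2)])
    have h6 := hGl (Vp (t + p)) (Vm (t + p)) (by simpa using h3.2.2) (by simpa using h4.2.2)
    rw [hGd, one_apply_eq_self] at h6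
    have h7 := h3.2.1
    have h8 := h4.2.1
    rw [norm_inv, norm_norm] at h7 h8
    have h9 : max ‖Vp (t + p)‖ ‖Vm (t + p)‖ ≤ (K + K') * (2 / (-t.im)) := by
      have hq : 0 ≤ 2 / (-t.im) := (by positivity : 0 ≤ ‖t + p‖⁻¹).trans h5.2.1
      refine max_le (h7.trans ?_) (h8.trans ?_)
      · exact mul_le_mul (by linarith) h5.2.1 (by positivity) (by positivity)
      · exact mul_le_mul (by linarith) h5.2.1 (by positivity) (by positivity)
    rw [add_right_comm t 1 p, h3.1.2, h4.1.2]
    refine h6.trans ?_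
    calc _ ≤ C * ((K + K') * (2 / (-t.im))) * ‖Vp (t + p) - Vm (t + p)‖ := by gcongr
      _ = _ := by ring
  · intro N
    obtain ⟨C₁, hC₁0, hC₁⟩ := (hp.expansion N).exists_nonneg
    obtain ⟨C₂, hC₂0, hC₂⟩ := (hm.expansion N).exists_nonneg
    obtain ⟨N₁, hN₁⟩ := exists_strip_of_eventually e1 hκ0 hC₁.bound p 2
    obtain ⟨N₂, hN₂⟩ := exists_strip_of_eventually e2 hκ0 hC₂.bound p 2
    refine ⟨(C₁ + C₂) * 2 ^ N, max (max N₁ N₂) (2 * ‖p‖ + 2), fun t h1 h2 => ?_⟩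
    have h3 := hN₁ t h1 (by linarith [(le_max_left N₁ N₂).trans (le_max_left _ (2 * ‖p‖ + 2))])
    have h4 := hN₂ t h1 (by linarith [(le_max_right N₁ N₂).trans (le_max_left _ (2 * ‖p‖ + 2))])
    have h5 := hhalf t (by linarith [le_max_right (max N₁ N₂) (2 * ‖p‖ + 2)])
    have h6 : ‖t + p‖⁻¹ ^ (N + 1) ≤ 2 ^ N * (-t.im) ^ (-(N : ℤ)) := by
      calc ‖t + p‖⁻¹ ^ (N + 1) ≤ ‖t + p‖⁻¹ ^ N :=
            pow_le_pow_of_le_one (by positivity) h5.2.2 (Nat.le_succ N)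
        _ ≤ (2 / (-t.im)) ^ N := by gcongr; exact h5.2.1
        _ = _ := by rw [div_pow, zpow_neg, zpow_natCast, div_eq_mul_inv]
    rw [norm_pow, norm_inv, norm_norm] at h3 h4
    have h7 := norm_sub_le (Vp (t + p) - ∑ n ∈ Finset.Icc 1 N, ((t + p)⁻¹) ^ n • a n)
      (Vm (t + p) - ∑ n ∈ Finset.Icc 1 N, ((t + p)⁻¹) ^ n • a n)
    rw [sub_sub_sub_cancel_right] at h7
    calc _ ≤ (C₁ + C₂) * ‖t + p‖⁻¹ ^ (N + 1) := by linarith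
      _ ≤ (C₁ + C₂) * (2 ^ N * (-t.im) ^ (-(N : ℤ))) := by gcongr
      _ = _ := by ring

/-! ### Comparison of Stokes constants -/

/-- The limit defining the Stokes constant is the same along all vertical lines. -/
theorem stokes_limit_unique {F : C2 → C2} {b : ℕ → C2} {M κ : ℝ} (hκ0 : 0 < κ) (hκ : κ ≤ 1)
    {Wp Wm : ℂ → C2} (hp : IsWedgeSeparatrix F b 1 M κ Wp) (hm : IsWedgeSeparatrix F b (-1) M κ Wm)
    {θ θ' c : ℂ}
    (h : Tendsto (fun s : ℝ => Complex.exp (2 * Real.pi * Complex.I * (-Complex.I * s + 0)) *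
      stokesForm Wp Wm (-Complex.I * s + 0)) atTop (𝓝 θ))
    (h' : Tendsto (fun s : ℝ => Complex.exp (2 * Real.pi * Complex.I * (-Complex.I * s + c)) *
      stokesForm Wp Wm (-Complex.I * s + c)) atTop (𝓝 θ')) : θ = θ' := by
  have e1 : |(1 : ℝ)| = 1 := by simp
  have e2 : |(-1 : ℝ)| = 1 := by simp
  have hpi := Real.pi_pos
  set w : ℂ → ℂ := fun t => Complex.exp (2 * Real.pi * Complex.I * t) * stokesForm Wp Wm t with hw
  have h0 : Tendsto (fun s : ℝ => w ((0 : ℝ) - Complex.I * s)) atTop (𝓝 θ) := by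
    refine h.congr fun s => ?_
    simp only [hw]
    rw [show (-Complex.I * s + 0 : ℂ) = (0 : ℝ) - Complex.I * s by push_cast; ring]
  -- The imaginary part of c only reparametrizes the vertical line. The remaining shift is
  -- horizontal, and the two lines bound a half-strip.
  have hc : Tendsto (fun s : ℝ => w ((c.re : ℝ) - Complex.I * s)) atTop (𝓝 θ') := by
    have h1 : Tendsto (fun s : ℝ => s + c.im) atTop atTop := tendsto_atTop_add_const_right _ _ tendsto_id
    refine (h'.comp h1).congr fun s => ?_
    simp only [hw, Function.comp]
    have : (-Complex.I * (s + c.im : ℝ) + c : ℂ) = c.re - Complex.I * s := by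
      push_cast
      linear_combination (-1 : ℂ) * Complex.re_add_im c
    rw [this]
  obtain ⟨M₁, hM₁⟩ := exists_strip_of_eventually e1 hκ0 (hp.eventually_deriv e1 hκ0.le hκ) 0 |c.re|
  obtain ⟨M₂, hM₂⟩ := exists_strip_of_eventually e2 hκ0 (hm.eventually_deriv e2 hκ0.le hκ) 0 |c.re|
  simp only [add_zero] at hM₁ hM₂
  set N := max 0 (max M₁ M₂) with hN
  have hN1 : M₁ ≤ N := (le_max_left _ _).trans (le_max_right _ _)
  have hN2 : M₂ ≤ N := (le_max_right _ _).trans (le_max_right _ _)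
  have hd : ∀ t : ℂ, |t.re| ≤ |c.re| → t.im ≤ -N → DifferentiableAt ℂ w t := by
    intro t h1 h2
    have h3 := (hM₁ t h1 (by linarith)).1
    have h4 := hM₂ t h1 (by linarith)
    have h5 := differentiableAt_pi.1 h3
    have h6 := differentiableAt_pi.1 h4.1
    have h7 := differentiableAt_pi.1 h4.2.1
    simp only [hw, stokesForm, omega, Pi.sub_apply]
    refine DifferentiableAt.mul (by fun_prop) ?_
    exact (((h5 0).sub (h6 0)).mul (h7 1)).sub (((h5 1).sub (h6 1)).mul (h7 0))
  have hg : ∀ t : ℂ, |t.re| ≤ |c.re| → t.im ≤ -N → ‖w t‖ ≤ 4 * Real.exp (2 * Real.pi * (-t.im)) := by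
    intro t h1 h2
    have h3 := hM₁ t h1 (by linarith)
    have h4 := hM₂ t h1 (by linarith)
    simp only [hw]
    rw [norm_mul, norm_exp_two_pi_I, mul_comm, mul_neg]
    gcongr
    refine (norm_omega_le _ _).trans ?_
    have h5 := norm_sub_le (Wp t) (Wm t)
    calc _ ≤ (2 * 2 * 1 : ℝ) := by
          refine mul_le_mul ?_ h4.2.2.2 (norm_nonneg _) (by norm_num)
          linarith [h3.2.2.1, h4.2.2.1]
      _ = 4 := by norm_num
  rcases lt_trichotomy 0 c.re with hlt | heq | hgt
  · refine limit_eq_of_halfStrip w 0 c.re N 4 (2 * Real.pi) θ θ' hlt (by positivity) (le_max_left _ _)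
      (fun t h1 h2 => hd t ?_) (fun t h1 h2 => hg t ?_) h0 hc
    all_goals rwa [abs_of_nonneg h1, abs_of_pos hlt]
  · rw [← heq] at hc
    exact tendsto_nhds_unique h0 hc
  · refine (limit_eq_of_halfStrip w c.re 0 N 4 (2 * Real.pi) θ' θ hgt (by positivity) (le_max_left _ _)
      (fun t h1 h2 => hd t ?_) (fun t h1 h2 => hg t ?_) hc h0).symm
    all_goals
      rw [abs_of_nonpos h2, abs_of_neg hgt]
      linarith

/-- Conjugate pairs of separatrices have Stokes constants which differ by the phase of the shift. -/
theorem stokesConstant_phase {G F : C2 → C2} (hG : AnalyticAt ℂ G 0) (hGd : fderiv ℂ G 0 = 1)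
    (hF : AnalyticAt ℂ F 0) (hFd : fderiv ℂ F 0 = 1) {a b : ℕ → C2} {M κ : ℝ} (hκ0 : 0 < κ) (hκ : κ ≤ 1)
    {Vp Vm Wp Wm : ℂ → C2}
    (hVp : IsWedgeSeparatrix G a 1 M κ Vp) (hVm : IsWedgeSeparatrix G a (-1) M κ Vm)
    (hWp : IsWedgeSeparatrix F b 1 M κ Wp) (hWm : IsWedgeSeparatrix F b (-1) M κ Wm)
    {Φ Ψ : C2 → C2} {L L' : C2 → C2 →L[ℂ] C2} (hΦ : HasSymplecticDeriv Φ L) (hΨ : HasSymplecticDeriv Ψ L')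
    {c : ℂ} (hp : ∀ᶠ t in wedgeFilter 1 κ, Φ (Vp t) = Ψ (Wp (t + c)))
    (hm : ∀ᶠ t in wedgeFilter (-1) κ, Φ (Vm t) = Ψ (Wm (t + c)))
    {θG θF : ℂ} (hθG : IsStokesConstant Vp Vm θG) (hθF : IsStokesConstant Wp Wm θF) :
    θF = Complex.exp (2 * Real.pi * Complex.I * c) * θG := by
  have e1 : |(1 : ℝ)| = 1 := by simp
  have e2 : |(-1 : ℝ)| = 1 := by simp
  obtain ⟨B, S, hB⟩ := exists_exponential_decay_sub hG hGd hκ0 hκ hVp hVm 0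
  obtain ⟨B', S', hB'⟩ := exists_exponential_decay_sub hF hFd hκ0 hκ hWp hWm c
  have t1 := tendsto_vertical_wedgeFilter e1 hκ0 (0 : ℂ)
  have t2 := tendsto_vertical_wedgeFilter e2 hκ0 (0 : ℂ)
  have t1' := tendsto_vertical_wedgeFilter e1 hκ0 c
  have t2' := tendsto_vertical_wedgeFilter e2 hκ0 c
  have k1 := tendsto_stokesForm_comp_sub hΦ 0 hB ((hVp.tendsto e1 hκ).comp t1) ((hVm.tendsto e2 hκ).comp t2)
    ((t2.eventually (hVm.eventually_deriv e2 hκ0.le hκ)).mono fun s hs => ⟨hs.1, hs.2.2.2⟩)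
  have k2 := tendsto_stokesForm_comp_sub hΨ c hB' ((hWp.tendsto e1 hκ).comp t1') ((hWm.tendsto e2 hκ).comp t2')
    ((t2'.eventually (hWm.eventually_deriv e2 hκ0.le hκ)).mono fun s hs => ⟨hs.1, hs.2.2.2⟩)
  have hθG' : Tendsto (fun s : ℝ => Complex.exp (2 * Real.pi * Complex.I * (-Complex.I * s + 0)) *
      stokesForm Vp Vm (-Complex.I * s + 0)) atTop (𝓝 θG) := by
    simp only [add_zero, stokesForm]
    exact hθG
  have hθF' : Tendsto (fun s : ℝ => Complex.exp (2 * Real.pi * Complex.I * (-Complex.I * s + 0)) *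
      stokesForm Wp Wm (-Complex.I * s + 0)) atTop (𝓝 θF) := by
    simp only [add_zero, stokesForm]
    exact hθF
  have hform : ∀ᶠ t in wedgeFilter (-1) κ,
      deriv (fun t => Φ (Vm t)) t = deriv (fun t => Ψ (Wm t)) (t + c) := by
    obtain ⟨M', hM'⟩ := eventually_wedgeFilter.1 hm
    refine eventually_wedgeFilter.2 ⟨M', fun t ht => ?_⟩
    rw [← deriv_comp_add_const (fun t => Ψ (Wm t)) c]
    refine EventuallyEq.deriv_eq ?_
    filter_upwards [(isOpen_wedge _ _ _).mem_nhds ht] with u hu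
    exact hM' u hu
  have hXY : ∀ᶠ s : ℝ in atTop,
      stokesForm (fun t => Φ (Vp t)) (fun t => Φ (Vm t)) (-Complex.I * s + 0) =
        stokesForm (fun t => Ψ (Wp t)) (fun t => Ψ (Wm t)) (-Complex.I * s + c) := by
    filter_upwards [t1.eventually hp, t2.eventually hm, t2.eventually hform] with s h1 h2 h3
    rw [stokesForm, stokesForm, h3, h1, h2]
    simp only [add_zero]
  -- Along the line through c the form of the pair W agrees, up to negligible terms, with that of V
  -- along the line through 0, while the weight gains the factor exp(2πic).
  refine stokes_limit_unique hκ0 hκ hWp hWm hθF' (c := c) ?_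
  have k3 := ((hθG'.add k1).const_mul (Complex.exp (2 * Real.pi * Complex.I * c))).sub k2
  rw [add_zero, sub_zero] at k3
  refine k3.congr' ?_
  filter_upwards [hXY] with s hs
  rw [hs]
  have : Complex.exp (2 * Real.pi * Complex.I * (-Complex.I * s + c)) =
      Complex.exp (2 * Real.pi * Complex.I * c) * Complex.exp (2 * Real.pi * Complex.I * (-Complex.I * s + 0)) := by
    rw [← Complex.exp_add]; ring_nf
  rw [this]
  ring

theorem reflection_of_isRealPoint {V : ℂ → C2} {ε M κ : ℝ} (hε : |ε| = 1)
    (hV : DifferentiableOn ℂ V (wedge ε M κ))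
    (hreal : ∀ t ∈ wedge ε M κ, t.im = 0 → IsRealPoint (V t)) {t : ℂ} (ht : t ∈ wedge ε M κ) :
    V ((starRingEnd ℂ) t) = star (V t) := by
  have hε2 : ε * ε = 1 := by rw [← abs_mul_abs_self, hε, one_mul]
  have hopen := isOpen_wedge ε M κ
  have key : ∀ i, ∀ u ∈ wedge ε M κ, V u i = (starRingEnd ℂ) (V ((starRingEnd ℂ) u) i) := by
    intro i
    have hVi : DifferentiableOn ℂ (fun u => V u i) (wedge ε M κ) := (differentiableOn_pi.1 hV) i
    have hVc : DifferentiableOn ℂ (fun u => (starRingEnd ℂ) (V ((starRingEnd ℂ) u) i)) (wedge ε M κ) := by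
      intro u hu
      have h1 : DifferentiableAt ℂ (fun u => V u i) ((starRingEnd ℂ) u) :=
        hVi.differentiableAt (hopen.mem_nhds (conj_mem_wedge hu))
      have h2 := h1.conj_conj
      rw [Complex.conj_conj] at h2
      exact h2.differentiableWithinAt
    set p : ℂ := ((ε * (M + 1) : ℝ) : ℂ) with hp
    have hpm : ∀ x : ℝ, 0 ≤ x → ((ε * (M + 1 + x) : ℝ) : ℂ) ∈ wedge ε M κ := by
      intro x hx
      change M < ε * ((ε * (M + 1 + x) : ℝ) : ℂ).re + κ * |((ε * (M + 1 + x) : ℝ) : ℂ).im|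
      rw [Complex.ofReal_re, Complex.ofReal_im, ← mul_assoc, hε2]
      simp; linarith
    have hpw : p ∈ wedge ε M κ := by simpa [hp] using hpm 0 le_rfl
    refine AnalyticOnNhd.eqOn_of_preconnected_of_frequently_eq (hVi.analyticOnNhd hopen)
      (hVc.analyticOnNhd hopen) (isPreconnected_wedge hε) hpw ?_
    -- The components of V and their reflections agree at real points accumulating at p, so the
    -- identity theorem makes them agree on the wedge.
    have htend : Tendsto (fun n : ℕ => ((ε * (M + 1 + 1 / ((n : ℝ) + 1)) : ℝ) : ℂ)) atTop (𝓝[≠] p) := by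
      refine tendsto_nhdsWithin_iff.2 ⟨?_, Eventually.of_forall fun n => ?_⟩
      · have h3 : Tendsto (fun n : ℕ => ε * (M + 1 + 1 / ((n : ℝ) + 1))) atTop (𝓝 (ε * (M + 1 + 0))) :=
          (tendsto_one_div_add_atTop_nhds_zero_nat.const_add _).const_mul _
        rw [add_zero] at h3
        exact (Complex.continuous_ofReal.tendsto _).comp h3
      · intro h
        have h3 : ε * (M + 1 + 1 / ((n : ℝ) + 1)) = ε * (M + 1) := Complex.ofReal_injective h
        have hε0 : ε ≠ 0 := by rintro rfl; simp at hε
        have h4 := mul_left_cancel₀ hε0 h3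
        have h5 : 0 < 1 / ((n : ℝ) + 1) := by positivity
        linarith
    refine htend.frequently (Eventually.of_forall fun n => ?_).frequently
    have h6 := hreal _ (hpm (1 / ((n : ℝ) + 1)) (by positivity)) (Complex.ofReal_im _) i
    rw [Complex.conj_ofReal]
    exact (Complex.conj_eq_iff_im.2 h6).symm
  funext i
  have := key i _ (conj_mem_wedge ht)
  rw [Complex.conj_conj] at this
  rw [this]
  rfl

/-! ### Symplectic germs and their action on separatrices -/

theorem IsSymplecticMap.comp {A B : C2 → C2} (hA : IsSymplecticMap A) (hB : IsSymplecticMap B) :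
    IsSymplecticMap (A ∘ B) := by
  have hB0 := hB.map_zero
  have ht : Tendsto B (𝓝 0) (𝓝 0) := by simpa [hB0] using hB.analytic.continuousAt.tendsto
  refine ⟨AnalyticAt.comp (by rw [hB0]; exact hA.analytic) hB.analytic, by simp [hB0, hA.map_zero], ?_⟩
  filter_upwards [ht.eventually hA.preserves, hB.preserves, ht.eventually hA.analytic.eventually_analyticAt,
    hB.analytic.eventually_analyticAt] with z h1 h2 h3 h4 u v
  rw [fderiv_comp z h3.differentiableAt h4.differentiableAt]
  simp only [ContinuousLinearMap.comp_apply]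
  rw [h1, h2]

theorem IsSymplecticMap.iterate {A : C2 → C2} (hA : IsSymplecticMap A) (k : ℕ) :
    IsSymplecticMap A^[k] := by
  induction k with
  | zero =>
    refine ⟨analyticAt_id, rfl, Eventually.of_forall fun z u v => ?_⟩
    rw [Function.iterate_zero, fderiv_id]
    rfl
  | succ k ih => rw [Function.iterate_succ]; exact ih.comp hA

theorem IsRealMap.iterate {A : C2 → C2} (hA : IsSymplecticMap A) (h : IsRealMap A) (k : ℕ) :
    IsRealMap A^[k] := by
  have ht : Tendsto A (𝓝 0) (𝓝 0) := by simpa [hA.map_zero] using hA.analytic.continuousAt.tendsto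
  induction k with
  | zero => exact Eventually.of_forall fun z hz => hz
  | succ k ih =>
    filter_upwards [h, ht.eventually ih] with z h1 h2 hz
    exact h2 (h1 hz)

theorem IsSymplecticMap.fderiv_ne_zero {A : C2 → C2} (hA : IsSymplecticMap A) {v : C2} (hv : v ≠ 0) :
    fderiv ℂ A 0 v ≠ 0 := by
  intro h
  have hp := hA.preserves.self_of_nhds
  apply hv
  have h1 : ∀ u, omega v u = 0 := fun u => by rw [← hp, h]; simp [omega]
  have h2 := h1 ![0, 1]
  have h3 := h1 ![1, 0]
  simp [omega] at h2 h3
  funext i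
  fin_cases i
  · exact h2
  · exact h3

/-- A symplectic conjugacy maps separatrices to separatrices, up to a time shift. -/
theorem exists_shift {g f Φ : C2 → C2} (hf : IsAreaPreservingMapAtResonance f) (hΦ : IsSymplecticMap Φ)
    (hconj : ∀ᶠ z in 𝓝 (0 : C2), Φ (g^[3] z) = f^[3] (Φ z)) {a b : ℕ → C2} {M κ : ℝ} (hκ0 : 0 < κ)
    (hκ : κ ≤ 1) (ha : a 1 ≠ 0) (hb : b 1 ≠ 0) {Vp Vm Wp Wm : ℂ → C2}
    (hVp : IsWedgeSeparatrix g^[3] a 1 M κ Vp) (hVm : IsWedgeSeparatrix g^[3] a (-1) M κ Vm)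
    (hWp : IsWedgeSeparatrix f^[3] b 1 M κ Wp) (hWm : IsWedgeSeparatrix f^[3] b (-1) M κ Wm) :
    ∃ k < 3, ∃ c : ℂ, (∀ᶠ t in wedgeFilter 1 κ, Φ (Vp t) = f^[k] (Wp (t + c))) ∧
      (∀ᶠ t in wedgeFilter (-1) κ, Φ (Vm t) = f^[k] (Wm (t + c))) ∧ (IsRealMap Φ → c.im = 0) := by
  have e1 : |(1 : ℝ)| = 1 := by simp
  have e2 : |(-1 : ℝ)| = 1 := by simp
  have hfs := hf.toIsSymplecticMap
  have hFs := hfs.iterate 3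
  obtain ⟨hFd, hnormal⟩ := exists_normal_coordinates hf
  have hXp := hVp.hasTwoTerms.comp_analytic e1 hκ hΦ.analytic hΦ.map_zero
  have hXm := hVm.hasTwoTerms.comp_analytic e2 hκ hΦ.analytic hΦ.map_zero
  have heq : ∀ {ε : ℝ} {V : ℂ → C2}, |ε| = 1 → IsWedgeSeparatrix g^[3] a ε M κ V →
      ∀ᶠ t in wedgeFilter ε κ, Φ (V (t + 1)) = f^[3] (Φ (V t)) := by
    intro ε V hε hV
    filter_upwards [hV.eventually_equation hε hκ0.le hκ, (hV.tendsto hε hκ).eventually hconj] with t h1 h2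
    rw [h1, h2]
  have hqX := quadraticPart_leading hκ0.le hκ hFs.analytic hFs.map_zero hFd hXp (heq e1 hVp)
  have hqW := quadraticPart_leading hκ0.le hκ hFs.analytic hFs.map_zero hFd hWp.hasTwoTerms
    (hWp.eventually_equation e1 hκ0.le hκ)
  have hX0 := hΦ.fderiv_ne_zero ha
  obtain ⟨-, -, -, hclass⟩ := hnormal (b 1) hb hqW
  obtain ⟨k, hk, hkb⟩ := hclass _ hX0 hqX
  -- The normal coordinates are now based at the common leading coefficient of Φ∘V and f^k∘W, which
  -- T sends to (1, 1).
  obtain ⟨T, hTb, hT, -⟩ := hnormal _ hX0 hqX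
  have hks := hfs.iterate k
  have hkd : fderiv ℂ f^[k] 0 (b 1) = fderiv ℂ Φ 0 (a 1) := by
    rw [hkb, (hf.analytic.differentiableAt.hasFDerivAt.iterate hf.map_zero k).fderiv]
  have hYp := hWp.hasTwoTerms.comp_analytic e1 hκ hks.analytic hks.map_zero
  have hYm := hWm.hasTwoTerms.comp_analytic e2 hκ hks.analytic hks.map_zero
  rw [hkd] at hYp hYm
  set v := fderiv ℂ Φ 0 (a 1) with hv
  set x := fderiv ℂ Φ 0 (a 2) + quadraticPart Φ (a 1) with hx
  set y := fderiv ℂ f^[k] 0 (b 2) + quadraticPart f^[k] (b 1) with hy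
  have heqW : ∀ {ε : ℝ} {W : ℂ → C2}, |ε| = 1 → IsWedgeSeparatrix f^[3] b ε M κ W →
      ∀ᶠ t in wedgeFilter ε κ, f^[k] (W (t + 1)) = f^[3] (f^[k] (W t)) := by
    intro ε W hε hW
    filter_upwards [hW.eventually_equation hε hκ0.le hκ] with t h1
    rw [h1, ← Function.iterate_add_apply, ← Function.iterate_add_apply, add_comm]
  have hsym := second_coefficient_symmetric hκ hFs.analytic hFd T hTb hT hXp hYp (heq e1 hVp) (heqW e1 hWp)
  set δ := T (x - y) 0 with hδ
  -- In normal coordinates the difference of the second coefficients is symmetric, hence a multiple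
  -- of (1, 1). The scalar δ is found from the stable pair, but the coefficients x and y are the
  -- same for the unstable one, so the shift -δ serves both.
  have hxy : x - y = δ • v := by
    apply T.injective
    rw [map_smul, hTb]
    funext i
    fin_cases i
    · simp [hδ]
    · simp [← hsym]
  have hshift : ∀ {ε : ℝ} {V W : ℂ → C2}, (ε = 1 ∨ ε = -1) → IsWedgeSeparatrix g^[3] a ε M κ V →
      IsWedgeSeparatrix f^[3] b ε M κ W → HasTwoTerms (wedgeFilter ε κ) (fun t => Φ (V t)) v x →
      HasTwoTerms (wedgeFilter ε κ) (fun t => f^[k] (W t)) v y →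
      ∀ᶠ t in wedgeFilter ε κ, Φ (V t) = f^[k] (W (t + -δ)) := by
    intro ε V W hε hV hW hX hY
    have hε1 : |ε| = 1 := by rcases hε with rfl | rfl <;> simp
    have hY' := hY.comp_add hε1 hκ hκ0.le (-δ)
    rw [show y - -δ • v = x by rw [neg_smul, sub_neg_eq_add, ← hxy]; abel] at hY'
    refine eventually_eq_of_hasTwoTerms hε hκ0.le hκ hFs.analytic hFd T hTb hT hX hY' (heq hε1 hV) ?_
    filter_upwards [(tendsto_add_wedgeFilter hε1 hκ0.le hκ (-δ)).eventually (heqW hε1 hW)] with t ht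
    rwa [add_right_comm] at ht
  refine ⟨k, hk, -δ, hshift (Or.inl rfl) hVp hWp hXp hYp, hshift (Or.inr rfl) hVm hWm hXm hYm, fun hreal => ?_⟩
  have hto := tendsto_ofReal_wedgeFilter κ
  have hrealcomp : ∀ {A : C2 → C2} {G : C2 → C2} {α : ℕ → C2} {V : ℂ → C2}, IsRealMap A →
      IsWedgeSeparatrix G α 1 M κ V → ∀ᶠ r : ℝ in atTop, IsRealPoint (A (V r)) := by
    intro A G α V hA hV
    filter_upwards [hto.eventually (eventually_mem_wedge 1 M κ),
      hto.eventually ((hV.tendsto e1 hκ).eventually hA)] with r h1 h2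
    exact h2 (hV.real _ h1 (Complex.ofReal_im r))
  obtain ⟨hvr, hxr⟩ := hXp.isRealPoint hκ (hrealcomp hreal hVp)
  obtain ⟨-, hyr⟩ := hYp.isRealPoint hκ (hrealcomp (hf.real.iterate hfs k) hWp)
  obtain ⟨i, hi⟩ := Function.ne_iff.1 hX0
  have h1 : (δ * v i).im = 0 := by
    have := (hxr.sub hyr) i
    rwa [hxy] at this
  have h2 : (v i).re ≠ 0 := by
    intro h
    exact hi (Complex.ext h (hvr i))
  rw [Complex.mul_im, hvr i, mul_zero, zero_add] at h1
  rw [Complex.neg_im, (mul_eq_zero.1 h1).resolve_right h2, neg_zero]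

/-- The complex conjugate of a conjugacy between separatrices. -/
theorem eventually_conjMap_eq {G F Φ Ψ : C2 → C2} {a b : ℕ → C2} {ε M κ : ℝ} (hε : |ε| = 1) (hκ0 : 0 < κ)
    (hκ : κ ≤ 1) {V W : ℂ → C2} (hV : IsWedgeSeparatrix G a ε M κ V) (hW : IsWedgeSeparatrix F b ε M κ W)
    (hΨ : IsSymplecticMap Ψ) (hΨr : IsRealMap Ψ) {c : ℂ}
    (h : ∀ᶠ t in wedgeFilter ε κ, Φ (V t) = Ψ (W (t + c))) :
    ∀ᶠ t in wedgeFilter ε κ, conjMap Φ (V t) = Ψ (W (t + (starRingEnd ℂ) c)) := by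
  obtain ⟨M', hM'⟩ := eventually_wedgeFilter.1 (((hW.tendsto hε hκ).eventually
    (hΨ.analytic.eventually_analyticAt.and hΨr)).and (eventually_mem_wedge ε M κ))
  have hrefl : ∀ t ∈ wedge ε M' κ, Ψ (W ((starRingEnd ℂ) t)) = star (Ψ (W t)) := by
    intro t ht
    refine reflection_of_isRealPoint (V := fun t => Ψ (W t)) hε (fun u hu => ?_) (fun u hu hu0 => ?_) ht
    · have h1 := hM' u hu
      exact (h1.1.1.differentiableAt.comp u (hW.analytic.differentiableAt
        ((isOpen_wedge _ _ _).mem_nhds h1.2))).differentiableWithinAt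
    · have h1 := hM' u hu
      exact h1.1.2 (hW.real u h1.2 hu0)
  have hconj : Tendsto (starRingEnd ℂ) (wedgeFilter ε κ) (wedgeFilter ε κ) :=
    tendsto_comap_iff.2 (by
      have : ((fun t : ℂ => ε * t.re + κ * |t.im|) ∘ (starRingEnd ℂ)) = fun t : ℂ => ε * t.re + κ * |t.im| := by
        funext t; simp
      rw [this]; exact tendsto_comap)
  -- Bars denoting conjugation, the chain is: conjMap Φ (V t) is the conjugate of Φ(V(t̄)) = Ψ(W(t̄
  -- + c)), and reflection of Ψ∘W turns this into Ψ(W(t + c̄)).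
  filter_upwards [hconj.eventually h, eventually_mem_wedge ε M κ,
    (tendsto_add_wedgeFilter hε hκ0.le hκ ((starRingEnd ℂ) c)).eventually (eventually_mem_wedge ε M' κ)] with t h1 h2 h3
  rw [conjMap, ← reflection_of_isRealPoint hε hV.analytic hV.real h2, h1, ← hrefl _ (by
    have := conj_mem_wedge h3
    rwa [map_add, Complex.conj_conj] at this), map_add, Complex.conj_conj]

end

end Resonance13

/-! ### Phase of the Stokes constant and the real time shift -/

open Resonance13 in
/-- The maps are germs at the origin. `Φ` is a local symplectic diffeomorphism (its Jacobian
determinant is one), so that `Φ ∘ G₀ = F₀ ∘ Φ` near the origin says `G₀ = Φ⁻¹ ∘ F₀ ∘ Φ`. -/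
theorem mainTheorem2
    (g f Φ : C2 → C2)
    (hg : IsAreaPreservingMapAtResonance g) (hg_nondeg : IsNondegenerate g)
    (hf : IsAreaPreservingMapAtResonance f) (hf_nondeg : IsNondegenerate f)
    (hΦ : IsSymplecticMap Φ)
    (hconj : ∀ᶠ z in nhds (0 : C2), Φ (g^[3] z) = f^[3] (Φ z))
    (Vp Vm Wp Wm : ℂ → C2)
    (hV : IsCompatiblePair g^[3] Vp Vm) (hW : IsCompatiblePair f^[3] Wp Wm)
    (θG θF : ℂ) (hθG : IsStokesConstant Vp Vm θG) (hθF : IsStokesConstant Wp Wm θF) :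
    ‖θG‖ = ‖θF‖ ∧
    ∃ c : ℝ, θG = Complex.exp (-(2 * Real.pi * Complex.I * c)) * θF ∧
      (IsRealMap Φ → ∃ k < 3, ∃ R > 0, ∃ δ > 0,
        (∀ t ∈ sectorPlus R δ, Φ (Vp t) = f^[k] (Wp (t + c))) ∧
        (∀ t ∈ sectorMinus R δ, Φ (Vm t) = f^[k] (Wm (t + c)))) := by
  obtain ⟨M, κ, a, b, -, hκ0, hκ, ha, hb, hVp, hVm, hWp, hWm⟩ := exists_isWedgeSeparatrix hV hW
  obtain ⟨k, hk, c, hp, hm, hreal⟩ := exists_shift hf hΦ hconj hκ0 hκ ha hb hVp hVm hWp hWm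
  have hGs := hg.toIsSymplecticMap.iterate 3
  have hFs := hf.toIsSymplecticMap.iterate 3
  have hks := hf.toIsSymplecticMap.iterate k
  have hGd := (exists_normal_coordinates hg).1
  have hFd := (exists_normal_coordinates hf).1
  have hphase : θF = Complex.exp (2 * Real.pi * Complex.I * c) * θG :=
    stokesConstant_phase hGs.analytic hGd hFs.analytic hFd hκ0 hκ hVp hVm hWp hWm
      hΦ.hasSymplecticDeriv hks.hasSymplecticDeriv hp hm hθG hθF
  obtain ⟨L', hL'⟩ := hΦ.hasSymplecticDeriv.exists_conjMap
  have hphase' : θF = Complex.exp (2 * Real.pi * Complex.I * (starRingEnd ℂ) c) * θG :=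
    stokesConstant_phase hGs.analytic hGd hFs.analytic hFd hκ0 hκ hVp hVm hWp hWm hL' hks.hasSymplecticDeriv
      (eventually_conjMap_eq (by simp) hκ0 hκ hVp hWp hks (hf.real.iterate hf.toIsSymplecticMap k) hp)
      (eventually_conjMap_eq (by simp) hκ0 hκ hVm hWm hks (hf.real.iterate hf.toIsSymplecticMap k) hm) hθG hθF
  have hcases : θG = 0 ∨ c.im = 0 := by
    by_cases h0 : θG = 0
    · exact Or.inl h0
    · right
      -- The shifts c and c̄ give the same factor. Its modulus is exp(-2π im c) by one formula and
      -- exp(2π im c) by the other, so im c = 0.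
      have h1 := mul_right_cancel₀ h0 (hphase.symm.trans hphase')
      have h2 := congrArg norm h1
      rw [norm_exp_two_pi_I, norm_exp_two_pi_I, Complex.conj_im] at h2
      have h3 := Real.exp_injective h2
      have h4 : Real.pi * c.im = 0 := by linarith
      exact (mul_eq_zero.1 h4).resolve_left Real.pi_ne_zero
  -- When both constants vanish any real number would serve; the real part of c is taken so that the
  -- same witness is the time shift for real Φ.
  have hformula : θG = Complex.exp (-(2 * Real.pi * Complex.I * c.re)) * θF := by
    rcases hcases with h0 | h0
    · rw [h0, mul_zero] at hphase
      rw [h0, hphase, mul_zero]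
    · have hc : (c.re : ℂ) = c := Complex.ext (Complex.ofReal_re _) (by rw [Complex.ofReal_im, h0])
      rw [hc, hphase, ← mul_assoc, ← Complex.exp_add, neg_add_cancel, Complex.exp_zero, one_mul]
  refine ⟨?_, c.re, hformula, fun hΦr => ⟨k, hk, ?_⟩⟩
  · rw [hformula, norm_mul, Complex.norm_exp]
    simp
  · have hc : (c.re : ℂ) = c := Complex.ext (Complex.ofReal_re _) (by rw [Complex.ofReal_im, hreal hΦr])
    obtain ⟨M₁, hM₁⟩ := eventually_wedgeFilter.1 hp
    obtain ⟨M₂, hM₂⟩ := eventually_wedgeFilter.1 hm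
    obtain ⟨R, hR, δ, hδ, hsub⟩ := exists_sectorPlus_subset_wedge (M := max M₁ M₂) hκ0 hκ
    rw [hc]
    exact ⟨R, hR, δ, hδ, fun t ht => hM₁ t (wedge_mono (le_max_left _ _) (hsub ht)),
      fun t ht => hM₂ t (mem_wedge_neg_one.2 (wedge_mono (le_max_right _ _) (hsub ht)))⟩
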